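/- **Notation.** For a compact convex $K\subset\mathbb R^2$ with $0$ in its interior let $\gamma(x)=\inf\{\lambda>0 : x\in\lambda K\}$ be its gauge function and let $\gamma^\circ$ be the gauge function of the polar $K^\circ=\{x:\langle x,y\rangle\le 1\ \forall y\in K\}$. For a bounded open $U\subset\mathbb R^2$ put $d_K(x)=\min_{y\in\partial U}\gamma(x-y)$; a point $y\in\partial U$ with $d_K(x)=\gamma(x-y)$ is a $\gamma$-closest point to $x$, and $R_{K,0}$ is the set of points of $U$ with more than one $\gamma$-closest point. Write $v^\perp=(-v_2,v_1)$. A function is $C^{k,\alpha}$ around $x$ if it is so in a neighbourhood of $x$; $k=\infty$ and $k=\omega$ (analytic) are allowed, and then $\alpha$ plays no role; $C^{k,0}=C^k$. **Hypotheses.** Let $k\ge 2$ (possibly $\infty$ or $\omega$) and $0\le\alpha\le1$. Let $K\subset\mathbb R^2$ be a compact strictly convex set with $0$ in its interior, such that $\partial K$ is $C^{k,\alpha}$ with positive curvature except at finitely many points, where it vanishes; let $\{\mu_j\}$ be the outward unit normals to $\partial K$ at these points. Let $U\subset\mathbb R^2$ be a bounded open set whose boundary is a finite disjoint union of simple closed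 curves, made of finitely many regular arcs $S_i$ that are $C^{k,\alpha}$ up to their end points, $U$ lying on exactly one side of each arc. The points where an arc ends and the next one begins are the corners; their opening angles (measured in $U$) are strictly between $0$ and $2\pi$. A corner is reentrant if its angle is $\ge\pi$, strict reentrant if it is $>\pi$, non-strict reentrant if it is $=\pi$. Assume that whenever $y\in S_i$ is an interior point of $S_i$ or a reentrant corner, and the inward unit normal to $S_i$ at $y$ belongs to $\{\mu_j\}$, then $S_i$ has positive curvature at $y$ or $S_i$ is a line segment. Parametrize $S_i$ by $c$ so that $\nu=(c')^\perp$ is an inward normal. The curvature is $\kappa=\langle\nu',\nu^\perp\rangle/|\nu|^3$, the $K$-curvature is $\kappa_K=\langle D^2\gamma^\circ(\nu)\,\nu',\nu^\perp\rangle/|\nu|^2$ (and $\kappa_K=0$ on a line segment whose inward unit normal is some $\mu_j$), and the inward $K$-normal is $\nu_K=D\gamma^\circ(\nu)$. A corner has two of each, one from each side. (Where $\nu$ is a positive multiple of some $\mu_j$ and $S_i$ is not a line segment, $D^2\gamma^\circ(\nu)$ does not exist; there the conditions on $\kappa_K$ below are understood with the convention $\kappa_K=0$.) Let $x\in U\setminus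 R_{K,0}$ and let $y$ be the unique $\gamma$-closest point to $x$ on $\partial U$. **Theorem.** 1. If $y$ is not a reentrant corner and $\kappa_K(y)d_K(x)\ne1$, then $d_K$ is $C^{k,\alpha}$ around $x$. Moreover, for every inward normal $\nu$ to $\partial U$ at $y$, every unit vector $\zeta$ orthogonal to $x-y$, and all $v,w\in\mathbb R^2$, $$Dd_K(x)=\frac{\nu}{\gamma^\circ(\nu)},\qquad \Delta d_K(x)=\frac{-\kappa(y)\,|\nu|^3\,|D\gamma^\circ(\nu)|^2}{\gamma^\circ(\nu)^3\,(1-\kappa_K(y)d_K(x))},\qquad D^2_{vw}d_K(x)=\Delta d_K(x)\,\langle v,\zeta\rangle\langle w,\zeta\rangle .$$ 2. Let $y$ be a strict reentrant corner. (a) If $x-y$ is not a positive multiple of either inward $K$-normal at $y$, then $d_K(z)=\gamma(z-y)$ for all $z$ close to $x$, and $d_K$ is $C^{k,\alpha}$ around $x$. (b) If $x-y$ is a positive multiple of one of the inward $K$-normals at $y$ and $\kappa_K(y)d_K(x)\ne1$ for the $K$-curvature of the corresponding arc, then $d_K$ is $C^{1,1}$ around $x$. 3. If $y$ is a non-strict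 reentrant corner and $\kappa_{K,1}d_K(x)\ne1$ and $\kappa_{K,2}d_K(x)\ne1$, where $\kappa_{K,1},\kappa_{K,2}$ are the $K$-curvatures at $y$ from the two sides, then $d_K$ is $C^{1,1}$ around $x$. 4. In 2(b) and in 3, $d_K$ is in general not $C^2$ around $x$: for every such $k,\alpha$ there are $K,U,x,y$ satisfying all hypotheses of 2(b), and others satisfying all hypotheses of 3, for which $d_K$ is not $C^2$ around $x$. -/

import Mathlib

open Set Filter Topology Real
open scoped NNReal InnerProductSpace

noncomputable section

/-- The Euclidean plane. -/
abbrev Plane : Type := EuclideanSpace ℝ (Fin 2)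

/-- Counterclockwise rotation by a right angle. -/
def perp (v : Plane) : Plane := !₂[-v 1, v 0]

/-- `f` is of class `C^{k,α}` around `x`. For finite `k` the derivative of order `k` is Hölder
continuous with exponent `α` near `x` (no extra condition if `α = 0`). For `k = ∞` and `k = ω`
(analytic), `α` plays no role. -/
def CkAlphaAround {E F : Type*} [NormedAddCommGroup E] [NormedSpace ℝ E]
    [NormedAddCommGroup F] [NormedSpace ℝ F]
    (k : WithTop ℕ∞) (α : ℝ≥0) (f : E → F) (x : E) : Prop :=
  ∃ V : Set E, IsOpen V ∧ x ∈ V ∧ ContDiffOn ℝ k f V ∧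
    ∀ m : ℕ, k = (m : WithTop ℕ∞) → ∃ C : ℝ≥0, HolderOnWith C α (iteratedFDeriv ℝ m f) V

/-- `S` is a `C^{k,α}` curve without end points: near each of its points it is given by an equation
`f = 0` with `f` of class `C^{k,α}` and `Df ≠ 0`. -/
def IsCkAlphaCurve (k : WithTop ℕ∞) (α : ℝ≥0) (S : Set Plane) : Prop :=
  ∀ p ∈ S, ∃ f : Plane → ℝ, CkAlphaAround k α f p ∧ gradient f p ≠ 0 ∧
    ∀ᶠ z in 𝓝 p, (z ∈ S ↔ f z = 0)

/-! ### The convex body -/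

/-- The polar `K° = {x | ⟪x, y⟫ ≤ 1 for all y ∈ K}`. -/
def polarBody (K : Set Plane) : Set Plane := {x | ∀ y ∈ K, ⟪x, y⟫_ℝ ≤ 1}

/-- The gauge function `γ°` of the polar of `K`. The gauge function `γ` of `K` is `gauge K`. -/
def polarGauge (K : Set Plane) : Plane → ℝ := gauge (polarBody K)

/-- The curvature at `p` of the level curve of `g` through `p`, with respect to the side on which
`g` is smaller (so that the unit circle as a level curve of the norm has curvature `1`). -/
def levelCurvature (g : Plane → ℝ) (p : Plane) : ℝ :=
  fderiv ℝ (fderiv ℝ g) p (perp (gradient g p)) (perp (gradient g p)) / ‖gradient g p‖ ^ 3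

/-- The curvature of `∂K = {γ = 1}` at `p`. -/
def bodyCurvature (K : Set Plane) (p : Plane) : ℝ := levelCurvature (gauge K) p

/-- `K` is a compact strictly convex set with zero in its interior, whose boundary is `C^{k,α}` and
has positive curvature except at finitely many points. -/
structure AdmissibleBody (k : WithTop ℕ∞) (α : ℝ≥0) (K : Set Plane) : Prop where
  compact : IsCompact K
  strictConvex : StrictConvex ℝ K
  zero_mem_interior : (0 : Plane) ∈ interior K
  smooth_boundary : IsCkAlphaCurve k α (frontier K)
  finite_flat : {p ∈ frontier K | ¬ 0 < bodyCurvature K p}.Finite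

/-- The outward unit normals to `∂K` at the points where the curvature of `∂K` vanishes. -/
def flatNormals (K : Set Plane) : Set Plane :=
  {n | ‖n‖ = 1 ∧ ∃ p ∈ frontier K, bodyCurvature K p = 0 ∧ ∀ z ∈ K, ⟪n, z - p⟫_ℝ ≤ 0}

/-! ### The distance function -/

/-- `d_K(x) = min {γ(x - y) | y ∈ ∂U}`. -/
def distK (K U : Set Plane) (x : Plane) : ℝ := sInf ((fun y => gauge K (x - y)) '' frontier U)

/-- `y` is a `γ`-closest point to `x` on `∂U`. -/
def IsClosestPoint (K U : Set Plane) (x y : Plane) : Prop :=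
  y ∈ frontier U ∧ ∀ w ∈ frontier U, gauge K (x - y) ≤ gauge K (x - w)

/-- `R_{K,0}`: the points of `U` with more than one `γ`-closest point on `∂U`. -/
def ridgeZero (K U : Set Plane) : Set Plane :=
  {x ∈ U | ∃ y z, y ≠ z ∧ IsClosestPoint K U x y ∧ IsClosestPoint K U x z}

/-! ### Plane curves -/

/-- The normal `ν = (-c₂', c₁')`, pointing to the left of the parametrized curve `c`. -/
def leftNormal (c : ℝ → Plane) (t : ℝ) : Plane := perp (deriv c t)

/-- The ordinary signed curvature `κ = ⟪ν', ν^⊥⟫ / |ν|³`. -/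
def curveCurvature (c : ℝ → Plane) (t : ℝ) : ℝ :=
  ⟪deriv (leftNormal c) t, perp (leftNormal c t)⟫_ℝ / ‖leftNormal c t‖ ^ 3

/-- The unit normal `ν / |ν|`. -/
def unitNormal (c : ℝ → Plane) (t : ℝ) : Plane := ‖leftNormal c t‖⁻¹ • leftNormal c t

/-- The `K`-normal `ν_K = Dγ°(ν)`. -/
def normalK (K : Set Plane) (c : ℝ → Plane) (t : ℝ) : Plane :=
  gradient (polarGauge K) (leftNormal c t)

open Classical in
/-- The `K`-curvature `κ_K = ⟪D²γ°(ν) ν', ν^⊥⟫ / |ν|²`; it is `0` if `ν` is a positive multiple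
of a normal to `∂K` at a point of zero curvature, where `D²γ°` is not defined (this value is used
only along line segments). -/
def curvatureK (K : Set Plane) (c : ℝ → Plane) (t : ℝ) : ℝ :=
  if unitNormal c t ∈ flatNormals K then 0
  else fderiv ℝ (fderiv ℝ (polarGauge K)) (leftNormal c t)
    (deriv (leftNormal c) t) (perp (leftNormal c t)) / ‖leftNormal c t‖ ^ 2

/-- The angle in `[0, 2π)` by which `a` has to be turned counterclockwise to point in the
direction of `b`. -/
def ccwAngle (a b : Plane) : ℝ :=
  if Complex.arg ⟨⟪a, b⟫_ℝ, ⟪perp a, b⟫_ℝ⟩ < 0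
  then Complex.arg ⟨⟪a, b⟫_ℝ, ⟪perp a, b⟫_ℝ⟩ + 2 * π
  else Complex.arg ⟨⟪a, b⟫_ℝ, ⟪perp a, b⟫_ℝ⟩

/-! ### Domains with piecewise smooth boundary -/

/-- A description of `∂U` as a finite disjoint union of simple closed curves made of arcs which
are `C^{k,α}` up to their end points. Each arc is parametrized regularly by `[0, 1]`, with `U` on
its left and the complement of the closure of `U` on its right, and it is followed on its closed
curve by the arc with index `next i`. -/
structure PiecewiseBoundary (k : WithTop ℕ∞) (α : ℝ≥0) (U : Set Plane) where
  /-- the number of arcs -/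
  N : ℕ
  /-- the parametrizations; only the values on `[0, 1]` matter, the values outside provide an
  extension past the end points -/
  arc : Fin N → ℝ → Plane
  /-- the arc following a given one -/
  next : Equiv.Perm (Fin N)
  smooth : ∀ i, ∀ t ∈ Icc (0 : ℝ) 1, CkAlphaAround k α (arc i) t
  regular : ∀ i, ∀ t ∈ Icc (0 : ℝ) 1, deriv (arc i) t ≠ 0
  joined : ∀ i, arc i 1 = arc (next i) 0
  simple : ∀ i j, ∀ s ∈ Ico (0 : ℝ) 1, ∀ t ∈ Ico (0 : ℝ) 1, arc i s = arc j t → i = j ∧ s = t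
  frontier_eq : frontier U = ⋃ i, arc i '' Icc (0 : ℝ) 1
  inward : ∀ i, ∀ t ∈ Ioo (0 : ℝ) 1, ∀ᶠ s in 𝓝[>] (0 : ℝ),
    arc i t + s • leftNormal (arc i) t ∈ U ∧ arc i t - s • leftNormal (arc i) t ∉ closure U
  no_cusp : ∀ i, ccwAngle (deriv (arc (next i)) 0) (-deriv (arc i) 1) ≠ 0

namespace PiecewiseBoundary

variable {k : WithTop ℕ∞} {α : ℝ≥0} {U : Set Plane}

/-- The opening angle of `U` at the corner where the arc `i` ends and the next one starts. It lies
strictly between `0` and `2π`, because cusps are excluded. -/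
def openingAngle (B : PiecewiseBoundary k α U) (i : Fin B.N) : ℝ :=
  ccwAngle (deriv (B.arc (B.next i)) 0) (-deriv (B.arc i) 1)

/-- `y` is a reentrant corner: a corner with opening angle at least `π`. -/
def IsReentrantCorner (B : PiecewiseBoundary k α U) (y : Plane) : Prop :=
  ∃ i, B.arc i 1 = y ∧ π ≤ B.openingAngle i

/-- At interior points of the arcs and at reentrant corners, where the inward unit normal to an arc
is an outward normal to `∂K` at a point of zero curvature, the arc has positive curvature or it is a
line segment. -/
def FlatCompatible (B : PiecewiseBoundary k α U) (K : Set Plane) : Prop :=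
  ∀ i, ∀ t ∈ Icc (0 : ℝ) 1, (t ∈ Ioo (0 : ℝ) 1 ∨ B.IsReentrantCorner (B.arc i t)) →
    unitNormal (B.arc i) t ∈ flatNormals K →
      0 < curveCurvature (B.arc i) t ∨
        B.arc i '' Icc (0 : ℝ) 1 = segment ℝ (B.arc i 0) (B.arc i 1)

end PiecewiseBoundary

/-- The standing hypotheses: an admissible body `K`, a bounded open set `U` with piecewise
`C^{k,α}` boundary compatible with the flat points of `K`, and a point `x ∈ U - R_{K,0}` with its
`γ`-closest point `y` on `∂U`. -/
structure Setting {k : WithTop ℕ∞} {α : ℝ≥0} {U : Set Plane} (K : Set Plane)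
    (B : PiecewiseBoundary k α U) (x y : Plane) : Prop where
  body : AdmissibleBody k α K
  isOpen : IsOpen U
  bounded : Bornology.IsBounded U
  flatCompatible : B.FlatCompatible K
  mem : x ∈ U \ ridgeZero K U
  closest : IsClosestPoint K U x y

end

/-! Near `x` the distance is `γ(z - q z)` with `q z` the foot point of `z` on the boundary, and the
envelope theorem gives `Dd(z) = Dγ(z - q z)`: to first order the motion of the foot point does not
matter. Hence the distance is one order smoother than the projection. A projection of class
`C^{k-1,α}` yields `C^{k,α}` (`ckAlphaAround_envelope`), a Lipschitz one yields `C^{1,1}`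
(`c11Around_envelope`). All that is needed is a good projection to the boundary near `y`; because
`y` is the only closest point, compactness makes it a global one (`eventually_distK_eq`).

On an arc `c` the foot parameter solves `∂_u γ(z - c(u)) = 0`. At the foot point of `x` the second
derivative of `u ↦ γ(x - c(u))` is `D²γ(c', c') (1 - κ_K d)` if the normal is not flat
(`second_derivative_eq`). This uses the duality of `K` and its polar: `Dγ°(ν)` is the point of `∂K`
with outward normal `ν`, and the tangential Hessians of `γ` and `γ°` are reciprocal up to positive
factors. Minimality makes the second derivative nonnegative, `κ_K d ≠ 1` makes it positive, and a
Hölder version of the implicit function theorem produces the foot point (`exists_foot`). If the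
normal is flat, then `D²γ(c', c') = 0` and minimality forces the curvature of the arc to be at most
`0`. By assumption the arc is then a segment, and strict convexity of `K` shows that the foot point
is the linear projection along `x - y` (`exists_foot_line`). Differentiating `Dγ(z - c(s z))` and
the equation for `s` gives the Hessian.

The open `γ`-ball touching the boundary at `y` lies in `U`. This fixes the direction of the normal,
and it excludes that `y` is a corner of angle less than `π` (`false_of_crossing`,
`false_of_convex_corner`). At a reentrant corner each of the two arcs has its own foot point,
truncated at the corner and hence only Lipschitz. For `z` near `x` the form `Dγ(z - y)` is not
positive on both directions that lead from `y` into the arcs, so at most one of the foot points `q₁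
z`, `q₂ z` differs from `y`, and `q₁ + q₂ - y` is a Lipschitz projection
(`HasHalfProjection.combine`).

That `C²` fails is seen with `K` the unit disc and `U` bounded by two elliptic arcs: on a line
through `x`, the function `d²` is compared with parabolas whose second order coefficients differ on
the two sides of `x`. -/

set_option linter.unusedSectionVars false
set_option linter.unusedVariables false

/-! ### Calculus of `C^{k,α}` maps. -/

section HolderCalculus

open Asymptotics

variable {E F G H : Type} [NormedAddCommGroup E] [NormedSpace ℝ E]
  [NormedAddCommGroup F] [NormedSpace ℝ F] [NormedAddCommGroup G] [NormedSpace ℝ G]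
  [NormedAddCommGroup H] [NormedSpace ℝ H]

/-- `f` is Hölder continuous with exponent `α` near `x`. -/
def LocHolder (α : ℝ≥0) (f : E → F) (x : E) : Prop :=
  (fun p : E × E => f p.1 - f p.2) =O[𝓝 (x, x)] fun p => ‖p.1 - p.2‖ ^ (α : ℝ)

theorem tendsto_fst_nhds_diag (x : E) : Tendsto (fun p : E × E => p.1) (𝓝 (x, x)) (𝓝 x) :=
  (continuous_fst.tendsto' (x, x) x rfl)

theorem tendsto_snd_nhds_diag (x : E) : Tendsto (fun p : E × E => p.2) (𝓝 (x, x)) (𝓝 x) :=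
  (continuous_snd.tendsto' (x, x) x rfl)

theorem LocHolder.congr {α : ℝ≥0} {f g : E → F} {x : E} (h : LocHolder α f x) (e : f =ᶠ[𝓝 x] g) :
    LocHolder α g x := by
  refine IsBigO.congr' h ?_ EventuallyEq.rfl
  filter_upwards [(tendsto_fst_nhds_diag x).eventually e, (tendsto_snd_nhds_diag x).eventually e]
    with p h1 h2
  rw [h1, h2]

/-- Distances less than `1` are at most their powers with exponent `α ≤ 1`. This is where Lipschitz
implies Hölder. -/
theorem isBigO_norm_sub_rpow {α : ℝ≥0} (hα : α ≤ 1) (x : E) :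
    (fun p : E × E => p.1 - p.2) =O[𝓝 (x, x)] fun p => ‖p.1 - p.2‖ ^ (α : ℝ) := by
  refine IsBigO.of_bound 1 ?_
  have : ∀ᶠ p : E × E in 𝓝 (x, x), ‖p.1 - p.2‖ < 1 := by
    have hc : Continuous fun p : E × E => ‖p.1 - p.2‖ := by fun_prop
    exact (hc.tendsto' (x, x) 0 (by simp)).eventually (gt_mem_nhds one_pos)
  filter_upwards [this] with p hp
  rw [one_mul, Real.norm_of_nonneg (by positivity)]
  nth_rewrite 1 [← Real.rpow_one ‖p.1 - p.2‖]
  exact Real.rpow_le_rpow_of_exponent_ge' (norm_nonneg _) hp.le (by positivity) (by exact_mod_cast hα)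

theorem locHolder_of_isBigO {α : ℝ≥0} (hα : α ≤ 1) {f : E → F} {x : E}
    (h : (fun p : E × E => f p.1 - f p.2) =O[𝓝 (x, x)] fun p => p.1 - p.2) : LocHolder α f x :=
  h.trans (isBigO_norm_sub_rpow hα x)

theorem ContDiffAt.isBigO_sub_diag {n : WithTop ℕ∞} {f : E → F} {x : E} (h : ContDiffAt ℝ n f x)
    (hn : 1 ≤ n) :
    (fun p : E × E => f p.1 - f p.2) =O[𝓝 (x, x)] fun p => p.1 - p.2 :=
  (h.hasStrictFDerivAt (by rintro rfl; simp at hn)).isBigO_sub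

theorem LocHolder.add {α : ℝ≥0} {f g : E → F} {x : E} (hf : LocHolder α f x)
    (hg : LocHolder α g x) : LocHolder α (fun z => f z + g z) x := by
  refine (IsBigO.add hf hg).congr_left fun p => ?_
  simp only; abel

theorem LocHolder.bilin {α : ℝ≥0} (B : F →L[ℝ] G →L[ℝ] H) {f : E → F} {g : E → G} {x : E}
    (hf : LocHolder α f x) (hg : LocHolder α g x) (hfc : ContinuousAt f x)
    (hgc : ContinuousAt g x) : LocHolder α (fun z => B (f z) (g z)) x := by
  have h1 : (fun p : E × E => B (f p.1) (g p.1 - g p.2)) =O[𝓝 (x, x)]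
      fun p => ‖p.1 - p.2‖ ^ (α : ℝ) := by
    have hb : (fun p : E × E => f p.1) =O[𝓝 (x, x)] fun _ => (1 : ℝ) :=
      (hfc.tendsto.comp (tendsto_fst_nhds_diag x)).isBigO_one ℝ
    refine (IsBigO.of_bound ‖B‖ (Eventually.of_forall fun p => ?_)).trans
      ((hb.norm_left.mul (IsBigO.norm_left hg)).congr_right fun p => one_mul _)
    rw [norm_mul, norm_norm, norm_norm, ← mul_assoc]
    exact B.le_opNorm₂ _ _
  have h2 : (fun p : E × E => B (f p.1 - f p.2) (g p.2)) =O[𝓝 (x, x)]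
      fun p => ‖p.1 - p.2‖ ^ (α : ℝ) := by
    have hb : (fun p : E × E => g p.2) =O[𝓝 (x, x)] fun _ => (1 : ℝ) :=
      (hgc.tendsto.comp (tendsto_snd_nhds_diag x)).isBigO_one ℝ
    refine (IsBigO.of_bound ‖B‖ (Eventually.of_forall fun p => ?_)).trans
      (((IsBigO.norm_left hf).mul hb.norm_left).congr_right fun p => mul_one _)
    rw [norm_mul, norm_norm, norm_norm, ← mul_assoc]
    exact B.le_opNorm₂ _ _
  refine (h1.add h2).congr_left fun p => ?_
  simp

theorem LocHolder.comp {α : ℝ≥0} {g : F → G} {f : E → F} {x : E} (hg : LocHolder α g (f x))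
    (hf : ContDiffAt ℝ 1 f x) : LocHolder α (fun z => g (f z)) x := by
  have ht : Tendsto (fun p : E × E => (f p.1, f p.2)) (𝓝 (x, x)) (𝓝 (f x, f x)) :=
    (hf.continuousAt.tendsto.comp (tendsto_fst_nhds_diag x)).prodMk_nhds
      (hf.continuousAt.tendsto.comp (tendsto_snd_nhds_diag x))
  refine (IsBigO.comp_tendsto hg ht).trans ?_
  have := (hf.isBigO_sub_diag le_rfl).norm_norm
  exact IsBigO.rpow (NNReal.coe_nonneg α) (Eventually.of_forall fun p => norm_nonneg _) this

/-- `f` is of class `C^n` at `x` and its derivative of order `n` is `α`-Hölder near `x`. -/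
def CHolderAt (n : ℕ) (α : ℝ≥0) (f : E → F) (x : E) : Prop :=
  ContDiffAt ℝ n f x ∧ LocHolder α (iteratedFDeriv ℝ n f) x

/-- Currying is a linear isometry, so differences of the two iterated derivatives have equal norms.
All inductions on the order rest on this. -/
theorem locHolder_iteratedFDeriv_succ {n : ℕ} {α : ℝ≥0} {f : E → F} {x : E} :
    LocHolder α (iteratedFDeriv ℝ (n + 1) f) x ↔
      LocHolder α (iteratedFDeriv ℝ n (fderiv ℝ f)) x := by
  unfold LocHolder
  rw [← isBigO_norm_left, ← isBigO_norm_left (f' := fun p : E × E =>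
    iteratedFDeriv ℝ n (fderiv ℝ f) p.1 - iteratedFDeriv ℝ n (fderiv ℝ f) p.2)]
  simp only [iteratedFDeriv_succ_eq_comp_right, Function.comp_apply, ← dist_eq_norm,
    LinearIsometryEquiv.dist_map]

theorem locHolder_iteratedFDeriv_zero {α : ℝ≥0} {f : E → F} {x : E} :
    LocHolder α (iteratedFDeriv ℝ 0 f) x ↔ LocHolder α f x := by
  unfold LocHolder
  rw [← isBigO_norm_left, ← isBigO_norm_left (f' := fun p : E × E => f p.1 - f p.2)]
  simp only [iteratedFDeriv_zero_eq_comp, Function.comp_apply, ← dist_eq_norm,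
    LinearIsometryEquiv.dist_map]

theorem cHolderAt_zero {α : ℝ≥0} {f : E → F} {x : E} :
    CHolderAt 0 α f x ↔ ContDiffAt ℝ 0 f x ∧ LocHolder α f x := by
  unfold CHolderAt; rw [locHolder_iteratedFDeriv_zero]; rfl

theorem CHolderAt.fderiv {n : ℕ} {α : ℝ≥0} {f : E → F} {x : E} (h : CHolderAt (n + 1) α f x) :
    CHolderAt n α (fderiv ℝ f) x :=
  ⟨h.1.fderiv_right (by push_cast; exact le_rfl), locHolder_iteratedFDeriv_succ.1 h.2⟩

theorem cHolderAt_succ {n : ℕ} {α : ℝ≥0} {f : E → F} {x : E} {f' : E → E →L[ℝ] F}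
    (hf : ∀ᶠ z in 𝓝 x, HasFDerivAt f (f' z) z) (h : CHolderAt n α f' x) :
    CHolderAt (n + 1) α f x := by
  have e : f' =ᶠ[𝓝 x] _root_.fderiv ℝ f := hf.mono fun z hz => hz.fderiv.symm
  refine ⟨?_, locHolder_iteratedFDeriv_succ.2 (h.2.congr (e.iteratedFDeriv ℝ n))⟩
  exact contDiffAt_succ_iff_hasFDerivAt.2 ⟨f', ⟨_, hf, fun z hz => hz⟩, h.1⟩

theorem CHolderAt.congr {n : ℕ} {α : ℝ≥0} {f g : E → F} {x : E} (h : CHolderAt n α f x)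
    (e : f =ᶠ[𝓝 x] g) : CHolderAt n α g x :=
  ⟨h.1.congr_of_eventuallyEq e.symm, h.2.congr (e.iteratedFDeriv ℝ n)⟩

theorem ContDiffAt.cHolderAt {n : ℕ} {m : WithTop ℕ∞} {α : ℝ≥0} (hα : α ≤ 1) {f : E → F} {x : E}
    (h : ContDiffAt ℝ m f x) (hm : (n : WithTop ℕ∞) + 1 ≤ m) : CHolderAt n α f x := by
  refine ⟨h.of_le (le_trans le_self_add hm), locHolder_of_isBigO hα ?_⟩
  exact (h.iteratedFDeriv_right (m := 1) (by rwa [add_comm])).isBigO_sub_diag le_rfl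

theorem CHolderAt.of_succ {n : ℕ} {α : ℝ≥0} (hα : α ≤ 1) {f : E → F} {x : E}
    (h : CHolderAt (n + 1) α f x) : CHolderAt n α f x :=
  h.1.cHolderAt hα (by push_cast; exact le_rfl)

theorem CHolderAt.add {n : ℕ} {α : ℝ≥0} {f g : E → F} {x : E} (hf : CHolderAt n α f x)
    (hg : CHolderAt n α g x) : CHolderAt n α (fun z => f z + g z) x := by
  refine ⟨hf.1.add hg.1, (hf.2.add hg.2).congr ?_⟩
  filter_upwards [hf.1.eventually (by simp), hg.1.eventually (by simp)] with z h1 h2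
  exact (iteratedFDeriv_add_apply h1 h2).symm

theorem CHolderAt.eventually_hasFDerivAt {n : ℕ} {α : ℝ≥0} {f : E → F} {x : E}
    (h : CHolderAt (n + 1) α f x) : ∀ᶠ z in 𝓝 x, HasFDerivAt f (_root_.fderiv ℝ f z) z := by
  filter_upwards [h.1.eventually (by simp)] with z hz
  exact (hz.differentiableAt (by simp)).hasFDerivAt

/-- Induction by the product rule. The spaces are generalized because the two terms of the
derivative are bilinear expressions with values in spaces of linear maps. -/
theorem CHolderAt.bilin {n : ℕ} {α : ℝ≥0} (hα : α ≤ 1) (B : F →L[ℝ] G →L[ℝ] H) {f : E → F}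
    {g : E → G} {x : E} (hf : CHolderAt n α f x) (hg : CHolderAt n α g x) :
    CHolderAt n α (fun z => B (f z) (g z)) x := by
  induction n generalizing F G H with
  | zero =>
    rw [cHolderAt_zero] at *
    exact ⟨(B.isBoundedBilinearMap.contDiff.contDiffAt).comp x (hf.1.prodMk hg.1),
      hf.2.bilin B hg.2 hf.1.continuousAt hg.1.continuousAt⟩
  | succ n ih =>
    refine cHolderAt_succ (f' := fun z => B.precompR E (f z) (_root_.fderiv ℝ g z) +
      B.precompL E (_root_.fderiv ℝ f z) (g z)) ?_ ?_
    · filter_upwards [hf.eventually_hasFDerivAt, hg.eventually_hasFDerivAt] with z h1 h2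
      exact B.hasFDerivAt_of_bilinear h1 h2
    · exact (ih (B.precompR E) (hf.of_succ hα) hg.fderiv).add
        (ih (B.precompL E) hf.fderiv (hg.of_succ hα))

/-- Induction by the chain rule. The inner map is assumed `C^1` so that, already for `n = 0`, it is
Lipschitz and the Hölder exponent of the outer map survives. -/
theorem CHolderAt.comp {n : ℕ} {α : ℝ≥0} (hα : α ≤ 1) {f : E → F}
    {g : F → G} {x : E} (hg : CHolderAt n α g (f x)) (hf : CHolderAt n α f x)
    (h1 : ContDiffAt ℝ 1 f x) : CHolderAt n α (fun z => g (f z)) x := by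
  induction n generalizing G with
  | zero =>
    rw [cHolderAt_zero] at *
    exact ⟨hg.1.comp x hf.1, hg.2.comp h1⟩
  | succ n ih =>
    refine cHolderAt_succ (f' := fun z => ContinuousLinearMap.compL ℝ E F G
      (_root_.fderiv ℝ g (f z)) (_root_.fderiv ℝ f z)) ?_ ?_
    · filter_upwards [hf.eventually_hasFDerivAt,
        h1.continuousAt.tendsto.eventually hg.eventually_hasFDerivAt] with z h1 h2
      exact h2.comp z h1
    · exact CHolderAt.bilin hα _ (ih hg.fderiv (hf.of_succ hα)) hf.fderiv

/-- Characterization of `CkAlphaAround` that is local at each point. -/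
theorem ckAlphaAround_iff {k : WithTop ℕ∞} {α : ℝ≥0} {f : E → F} {x : E} :
    CkAlphaAround k α f x ↔ (∀ᶠ z in 𝓝 x, ContDiffAt ℝ k f z) ∧
      ∀ m : ℕ, k = m → CHolderAt m α f x := by
  constructor
  · rintro ⟨V, hV, hx, hf, hH⟩
    have h1 : ∀ᶠ z in 𝓝 x, ContDiffAt ℝ k f z := by
      filter_upwards [hV.mem_nhds hx] with z hz using hf.contDiffAt (hV.mem_nhds hz)
    refine ⟨h1, fun m hm => ⟨hm ▸ h1.self_of_nhds, ?_⟩⟩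
    obtain ⟨C, hC⟩ := hH m hm
    refine IsBigO.of_bound C ?_
    filter_upwards [prod_mem_nhds (hV.mem_nhds hx) (hV.mem_nhds hx)] with p hp
    rw [Real.norm_of_nonneg (by positivity), ← dist_eq_norm, ← dist_eq_norm]
    exact hC.dist_le hp.1 hp.2
  · rintro ⟨h1, h2⟩
    by_cases hk : ∃ m : ℕ, k = m
    · obtain ⟨m, rfl⟩ := hk
      obtain ⟨C, hC⟩ := (h2 m rfl).2.bound
      obtain ⟨V, hV, hVs⟩ := Metric.eventually_nhds_iff_ball.1 hC
      obtain ⟨r, hr, hr'⟩ := Metric.eventually_nhds_iff_ball.1 h1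
      refine ⟨Metric.ball x (min V r), Metric.isOpen_ball,
        Metric.mem_ball_self (lt_min hV hr), fun z hz =>
          (hr' z (Metric.ball_subset_ball (min_le_right _ _) hz)).contDiffWithinAt,
        fun m' hm' => ⟨C.toNNReal, ?_⟩⟩
      have hm'' : m = m' := by exact_mod_cast hm'
      subst hm''
      intro a ha b hb
      have hab : (a, b) ∈ Metric.ball ((x, x) : E × E) V := by
        rw [← ball_prod_same]
        exact ⟨Metric.ball_subset_ball (min_le_left _ _) ha,
          Metric.ball_subset_ball (min_le_left _ _) hb⟩
      have := hVs _ hab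
      rw [Real.norm_of_nonneg (by positivity), ← dist_eq_norm, ← dist_eq_norm] at this
      rw [edist_dist, edist_dist, ENNReal.ofReal_rpow_of_nonneg dist_nonneg α.coe_nonneg,
        ← ENNReal.ofReal_coe_nnreal, ← ENNReal.ofReal_mul (by simp)]
      refine ENNReal.ofReal_le_ofReal (this.trans ?_)
      gcongr
      exact Real.le_coe_toNNReal C
    · obtain ⟨r, hr, hr'⟩ := Metric.eventually_nhds_iff_ball.1 h1
      exact ⟨Metric.ball x r, Metric.isOpen_ball, Metric.mem_ball_self hr,
        fun z hz => (hr' z hz).contDiffWithinAt, fun m hm => (hk ⟨m, hm⟩).elim⟩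

namespace CkAlphaAround

variable {k : WithTop ℕ∞} {α : ℝ≥0}

theorem contDiffAt {f : E → F} {x : E} (h : CkAlphaAround k α f x) : ContDiffAt ℝ k f x :=
  (ckAlphaAround_iff.1 h).1.self_of_nhds

theorem eventually_contDiffAt {f : E → F} {x : E} (h : CkAlphaAround k α f x) :
    ∀ᶠ z in 𝓝 x, ContDiffAt ℝ k f z :=
  (ckAlphaAround_iff.1 h).1

theorem congr {f g : E → F} {x : E} (h : CkAlphaAround k α f x) (e : f =ᶠ[𝓝 x] g) :
    CkAlphaAround k α g x := by
  rw [ckAlphaAround_iff] at *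
  refine ⟨?_, fun m hm => (h.2 m hm).congr e⟩
  filter_upwards [h.1, e.eventually_nhds] with z h1 h2 using h1.congr_of_eventuallyEq
    (EventuallyEq.symm h2)

theorem of_contDiffAt {f : E → F} {x : E} (hα : α ≤ 1)
    (h : ∀ᶠ z in 𝓝 x, ContDiffAt ℝ (k + 1) f z) : CkAlphaAround k α f x := by
  refine ckAlphaAround_iff.2 ⟨h.mono fun z hz => hz.of_le le_self_add, fun m hm => ?_⟩
  subst hm
  exact h.self_of_nhds.cHolderAt hα le_rfl

theorem of_contDiff {f : E → F} {x : E} (hα : α ≤ 1) (h : ContDiff ℝ (k + 1) f) :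
    CkAlphaAround k α f x :=
  of_contDiffAt hα (Eventually.of_forall fun z => h.contDiffAt)

theorem bilin (hα : α ≤ 1) (B : F →L[ℝ] G →L[ℝ] H) {f : E → F} {g : E → G} {x : E}
    (hf : CkAlphaAround k α f x) (hg : CkAlphaAround k α g x) :
    CkAlphaAround k α (fun z => B (f z) (g z)) x := by
  rw [ckAlphaAround_iff] at *
  refine ⟨?_, fun m hm => (hf.2 m hm).bilin hα B (hg.2 m hm)⟩
  filter_upwards [hf.1, hg.1] with z h1 h2
  exact (B.isBoundedBilinearMap.contDiff.contDiffAt).comp z (h1.prodMk h2)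

theorem clm_comp (hα : α ≤ 1) (L : F →L[ℝ] G) {f : E → F} {x : E} (hf : CkAlphaAround k α f x) :
    CkAlphaAround k α (fun z => L (f z)) x :=
  bilin hα (ContinuousLinearMap.id ℝ (F →L[ℝ] G)) (f := fun _ => L)
    (of_contDiff hα contDiff_const) hf

theorem add {f g : E → F} {x : E} (hf : CkAlphaAround k α f x) (hg : CkAlphaAround k α g x) :
    CkAlphaAround k α (fun z => f z + g z) x := by
  rw [ckAlphaAround_iff] at *
  refine ⟨?_, fun m hm => (hf.2 m hm).add (hg.2 m hm)⟩
  filter_upwards [hf.1, hg.1] with z h1 h2 using h1.add h2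

theorem comp (hα : α ≤ 1) (hk : 1 ≤ k) {g : F → G} {f : E → F} {x : E}
    (hg : CkAlphaAround k α g (f x)) (hf : CkAlphaAround k α f x) :
    CkAlphaAround k α (fun z => g (f z)) x := by
  have hc := hf.contDiffAt
  rw [ckAlphaAround_iff] at *
  refine ⟨?_, fun m hm => (hg.2 m hm).comp hα (hf.2 m hm) (hc.of_le hk)⟩
  filter_upwards [hf.1, hc.continuousAt.tendsto.eventually hg.1] with z h1 h2 using h2.comp z h1

theorem fderiv {f : E → F} {x : E} (h : CkAlphaAround (k + 1) α f x) :
    CkAlphaAround k α (fderiv ℝ f) x := by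
  rw [ckAlphaAround_iff] at *
  refine ⟨h.1.mono fun z hz => hz.fderiv_right le_rfl, fun m hm => ?_⟩
  exact (h.2 (m + 1) (by subst hm; push_cast; rfl)).fderiv

/-- Adding `1` fixes both `∞` and `ω`, so a finite value of `k + 1` can only come from a finite `k`.
-/
theorem eq_add_one_of_natCast {n : ℕ} (h : k + 1 = (n : WithTop ℕ∞)) : ∃ m : ℕ, k = m ∧ n = m + 1 := by
  have hk : k ≠ ⊤ := by rintro rfl; simp at h
  lift k to ℕ∞ using hk
  have hk : k ≠ ⊤ := by
    rintro rfl
    rw [show (((⊤ : ℕ∞) : WithTop ℕ∞) + 1) = ((⊤ : ℕ∞) : WithTop ℕ∞) from rfl] at h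
    exact absurd (WithTop.coe_injective h) (by simp)
  lift k to ℕ using hk
  exact ⟨k, rfl, by exact_mod_cast h.symm⟩

/-- The assumption `h0` matters for `k = ω`: there the criterion in terms of the derivative also
asks for analyticity of the function itself. -/
theorem of_hasFDerivAt {f : E → F} {f' : E → E →L[ℝ] F} {x : E}
    (hf : ∀ᶠ z in 𝓝 x, HasFDerivAt f (f' z) z) (h0 : ∀ᶠ z in 𝓝 x, ContDiffAt ℝ k f z)
    (h : CkAlphaAround k α f' x) : CkAlphaAround (k + 1) α f x := by
  rw [ckAlphaAround_iff] at *
  refine ⟨?_, fun n hn => ?_⟩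
  · have e : f' =ᶠ[𝓝 x] _root_.fderiv ℝ f := hf.mono fun z hz => hz.fderiv.symm
    obtain ⟨V, hV, hVo, hxV⟩ := eventually_nhds_iff.1 (hf.and (h0.and (h.1.and e)))
    have : ContDiffOn ℝ (k + 1) f V := by
      rw [contDiffOn_succ_iff_fderiv_of_isOpen hVo]
      refine ⟨fun z hz => (hV z hz).1.differentiableAt.differentiableWithinAt, ?_, ?_⟩
      · rintro rfl z hz
        exact ((hV z hz).2.1.analyticAt).analyticWithinAt
      · refine ContDiffOn.congr (f := f') (fun z hz => (hV z hz).2.2.1.contDiffWithinAt) ?_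
        intro z hz
        exact (hV z hz).2.2.2.symm
    filter_upwards [hVo.mem_nhds hxV] with z hz using this.contDiffAt (hVo.mem_nhds hz)
  · obtain ⟨m, hm, rfl⟩ := eq_add_one_of_natCast hn
    exact cHolderAt_succ hf (h.2 m hm)

theorem of_le_one {f : E → F} {x : E} (hα : α ≤ 1) (h : CkAlphaAround (k + 1) α f x) :
    CkAlphaAround k α f x :=
  of_contDiffAt hα h.eventually_contDiffAt

end CkAlphaAround

end HolderCalculus

/-! ### The implicit function theorem in Hölder classes. -/

section Implicit

open Asymptotics

variable {E : Type} [NormedAddCommGroup E] [NormedSpace ℝ E]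

theorem CHolderAt.of_le {F : Type} [NormedAddCommGroup F] [NormedSpace ℝ F] {n m : ℕ} {α : ℝ≥0}
    (hα : α ≤ 1) {f : E → F} {x : E} (h : CHolderAt m α f x) (hn : n ≤ m) : CHolderAt n α f x := by
  induction m, hn using Nat.le_induction with
  | base => exact h
  | succ m _ ih => exact ih (h.of_succ hα)

/-- Complements `CHolderAt.comp`: one more derivative of the outer map replaces the `C^1` assumption
on the inner one, since for `n = 0` a Lipschitz map of a Hölder map is Hölder. -/
theorem CHolderAt.comp_of_contDiffAt {F G : Type} [NormedAddCommGroup F] [NormedSpace ℝ F]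
    [NormedAddCommGroup G] [NormedSpace ℝ G] {n : ℕ} {m : WithTop ℕ∞} {α : ℝ≥0} (hα : α ≤ 1)
    {f : E → F} {g : F → G} {x : E} (hg : ContDiffAt ℝ m g (f x))
    (hm : (n : WithTop ℕ∞) + 1 ≤ m) (hf : CHolderAt n α f x) :
    CHolderAt n α (fun z => g (f z)) x := by
  cases n with
  | zero =>
    rw [cHolderAt_zero] at *
    refine ⟨(hg.of_le bot_le).comp x hf.1, ?_⟩
    have ht : Tendsto (fun p : E × E => (f p.1, f p.2)) (𝓝 (x, x)) (𝓝 (f x, f x)) :=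
      (hf.1.continuousAt.tendsto.comp (tendsto_fst_nhds_diag x)).prodMk_nhds
        (hf.1.continuousAt.tendsto.comp (tendsto_snd_nhds_diag x))
    exact ((hg.isBigO_sub_diag (by simpa using hm)).comp_tendsto ht).trans hf.2
  | succ n => exact (hg.cHolderAt hα hm).comp hα hf (hf.1.of_le (by simp))

theorem isInvertible_comp_inr {L : E × ℝ →L[ℝ] ℝ} (h : L (0, 1) ≠ 0) :
    (L ∘L .inr ℝ E ℝ).IsInvertible := by
  refine ⟨ContinuousLinearEquiv.unitsEquivAut ℝ (Units.mk0 _ h), ?_⟩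
  ext
  simp

/-- The derivative of an implicitly defined function. -/
theorem hasFDerivAt_implicit {F : E × ℝ → ℝ} {u : E → ℝ} {z : E}
    (hF : DifferentiableAt ℝ F (z, u z)) (hu : DifferentiableAt ℝ u z)
    (h0 : ∀ᶠ w in 𝓝 z, F (w, u w) = 0) (hd : fderiv ℝ F (z, u z) (0, 1) ≠ 0) :
    HasFDerivAt u (-(fderiv ℝ F (z, u z) (0, 1))⁻¹ •
      (fderiv ℝ F (z, u z)).comp (ContinuousLinearMap.inl ℝ E ℝ)) z := by
  have h1 : HasFDerivAt (fun w => F (w, u w))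
      ((fderiv ℝ F (z, u z)).comp ((ContinuousLinearMap.id ℝ E).prod (fderiv ℝ u z))) z :=
    hF.hasFDerivAt.comp z ((hasFDerivAt_id z).prodMk hu.hasFDerivAt)
  have h2 : HasFDerivAt (fun w => F (w, u w)) (0 : E →L[ℝ] ℝ) z :=
    (hasFDerivAt_const (0 : ℝ) z).congr_of_eventuallyEq h0
  have h3 := h1.unique h2
  convert hu.hasFDerivAt using 1
  ext v
  have h4 : fderiv ℝ F (z, u z) (v, 0) + fderiv ℝ u z v * fderiv ℝ F (z, u z) (0, 1) = 0 := by
    have := DFunLike.congr_fun h3 v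
    simp only [ContinuousLinearMap.comp_apply, ContinuousLinearMap.prod_apply,
      ContinuousLinearMap.id_apply, zero_apply] at this
    have e : ((v, fderiv ℝ u z v) : E × ℝ) = (v, 0) + fderiv ℝ u z v • (0, 1) := by simp
    rwa [e, map_add, map_smul, smul_eq_mul] at this
  simp only [smul_apply, ContinuousLinearMap.comp_apply,
    ContinuousLinearMap.inl_apply, smul_eq_mul]
  field_simp
  linarith

variable [CompleteSpace E]

/-- A continuous solution stays in the neighbourhood where the solution is unique, hence it agrees
with the one from the implicit function theorem. -/
theorem contDiffAt_of_implicit {k : WithTop ℕ∞} (hk : 1 ≤ k) {F : E × ℝ → ℝ} {u : E → ℝ} {z : E}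
    (hF : ContDiffAt ℝ k F (z, u z)) (hu : ContinuousAt u z)
    (h0 : ∀ᶠ w in 𝓝 z, F (w, u w) = 0) (hd : fderiv ℝ F (z, u z) (0, 1) ≠ 0) :
    ContDiffAt ℝ k u z := by
  have hk0 : k ≠ 0 := by rintro rfl; simp at hk
  refine (hF.contDiffAt_implicitFunction hk0 (isInvertible_comp_inr hd)).congr_of_eventuallyEq ?_
  have ht : Tendsto (fun w => (w, u w)) (𝓝 z) (𝓝 (z, u z)) :=
    (tendsto_id.prodMk_nhds hu.tendsto)
  filter_upwards [h0, ht.eventually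
    (hF.eventually_apply_eq_iff_implicitFunction hk0 (isInvertible_comp_inr hd))] with w h1 h2
  exact (h2.1 (h1.trans h0.self_of_nhds.symm)).symm

namespace CkAlphaAround

variable {k : WithTop ℕ∞} {α : ℝ≥0}

theorem implicit (hα : α ≤ 1) (hk : 1 ≤ k) {F : E × ℝ → ℝ} {u : E → ℝ} {x : E}
    (hF : CkAlphaAround k α F (x, u x)) (hd : _root_.fderiv ℝ F (x, u x) (0, 1) ≠ 0)
    (hu : ∀ᶠ z in 𝓝 x, ContinuousAt u z) (h0 : ∀ᶠ z in 𝓝 x, F (z, u z) = 0) :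
    CkAlphaAround k α u x := by
  have hk0 : k ≠ 0 := by rintro rfl; simp at hk
  have ht : Tendsto (fun w => (w, u w)) (𝓝 x) (𝓝 (x, u x)) :=
    (tendsto_id.prodMk_nhds hu.self_of_nhds.tendsto)
  have hdc : ContinuousAt (fun p => _root_.fderiv ℝ F p (0, 1)) (x, u x) :=
    ((hF.contDiffAt.of_le hk).fderiv_right (m := 0) (by simp)).continuousAt.clm_apply
      continuousAt_const
  have hd' : ∀ᶠ z in 𝓝 x, _root_.fderiv ℝ F (z, u z) (0, 1) ≠ 0 :=
    (hdc.tendsto.comp ht).eventually (isOpen_ne.mem_nhds hd)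
  have hC : ∀ᶠ z in 𝓝 x, ContDiffAt ℝ k u z := by
    filter_upwards [ht.eventually hF.eventually_contDiffAt, hu, h0.eventually_nhds, hd']
      with z h1 h2 h3 h4 using contDiffAt_of_implicit hk h1 h2 h3 h4
  have hder : ∀ᶠ z in 𝓝 x, HasFDerivAt u (-(_root_.fderiv ℝ F (z, u z) (0, 1))⁻¹ •
      (_root_.fderiv ℝ F (z, u z)).comp (ContinuousLinearMap.inl ℝ E ℝ)) z := by
    filter_upwards [ht.eventually hF.eventually_contDiffAt, hC, h0.eventually_nhds, hd']
      with z h1 h2 h3 h4 using hasFDerivAt_implicit (h1.differentiableAt hk0)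
        (h2.differentiableAt hk0) h3 h4
  refine ckAlphaAround_iff.2 ⟨hC, fun m hm => ?_⟩
  subst hm
  have hFm := (ckAlphaAround_iff.1 hF).2 m rfl
  have hu1 : ContDiffAt ℝ 1 u x := hC.self_of_nhds.of_le hk
  -- Bootstrap: `Du` is a smooth expression in `DF(z, u z)`, so Hölder regularity of order `j` for
  -- `u` passes to `Du` and gives order `j + 1` for `u`. The start is the `C^1` regularity of the
  -- classical theorem.
  suffices ∀ j ≤ m, CHolderAt j α u x from this m le_rfl
  intro j
  induction j with
  | zero => exact fun _ => hu1.cHolderAt hα (by simp)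
  | succ j ih =>
    intro hj
    have huj := ih (by omega)
    have hFj : CHolderAt j α (_root_.fderiv ℝ F) (x, u x) := (hFm.of_le hα hj).fderiv
    have hid : CHolderAt j α (fun z : E => z) x :=
      (contDiff_id (n := ⊤)).contDiffAt.cHolderAt hα le_top
    have hpair : CHolderAt j α (fun z => (z, u z)) x := by
      have e1 : CHolderAt j α (fun z : E => (z, (0 : ℝ))) x :=
        (ContinuousLinearMap.inl ℝ E ℝ).contDiff.contDiffAt.cHolderAt (m := ⊤) hα le_top
      have e2 : CHolderAt j α (fun z : E => ((0 : E), u z)) x :=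
        CHolderAt.comp (g := fun t : ℝ => ((0 : E), t)) hα
          ((ContinuousLinearMap.inr ℝ E ℝ).contDiff.contDiffAt.cHolderAt (m := ⊤) hα le_top)
          huj hu1
      exact (e1.add e2).congr (Eventually.of_forall fun z => by simp)
    have hpair1 : ContDiffAt ℝ 1 (fun z => (z, u z)) x := contDiffAt_id.prodMk hu1
    have hA : CHolderAt j α (fun z => _root_.fderiv ℝ F (z, u z)) x :=
      CHolderAt.comp (g := _root_.fderiv ℝ F) hα hFj hpair hpair1
    refine cHolderAt_succ hder ?_
    refine CHolderAt.comp_of_contDiffAt hα (m := ⊤) (g := fun L : E × ℝ →L[ℝ] ℝ =>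
          -(L (0, 1))⁻¹ • L.comp (ContinuousLinearMap.inl ℝ E ℝ)) ?_ le_top hA
    have e0 : ContDiff ℝ ⊤ fun L : E × ℝ →L[ℝ] ℝ => L (0, 1) :=
      contDiff_id.clm_apply contDiff_const
    refine ContDiffAt.smul (ContDiffAt.neg (ContDiffAt.inv e0.contDiffAt hd)) ?_
    exact (contDiff_id.clm_comp contDiff_const).contDiffAt

theorem exists_implicit (hα : α ≤ 1) (hk : 1 ≤ k) {F : E × ℝ → ℝ} {x : E} {t : ℝ}
    (hF : CkAlphaAround k α F (x, t)) (hd : _root_.fderiv ℝ F (x, t) (0, 1) ≠ 0)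
    (hxt : F (x, t) = 0) :
    ∃ u : E → ℝ, u x = t ∧ CkAlphaAround k α u x ∧ ∀ᶠ z in 𝓝 x, F (z, u z) = 0 := by
  have hk0 : k ≠ 0 := by rintro rfl; simp at hk
  set u := hF.contDiffAt.implicitFunction hk0 (isInvertible_comp_inr hd) with hu_def
  have hux : u x = t := hF.contDiffAt.implicitFunction_apply_self hk0 (isInvertible_comp_inr hd)
  have hu0 : ∀ᶠ z in 𝓝 x, F (z, u z) = 0 := by
    filter_upwards [hF.contDiffAt.eventually_apply_implicitFunction hk0 (isInvertible_comp_inr hd)]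
      with z hz using hz.trans hxt
  have hu1 : ContDiffAt ℝ 1 u x :=
    (hF.contDiffAt.contDiffAt_implicitFunction hk0 (isInvertible_comp_inr hd)).of_le hk
  refine ⟨u, hux, ?_, hu0⟩
  rw [← hux] at hF hd
  exact implicit hα hk hF hd ((hu1.eventually (by simp)).mono fun z hz => hz.continuousAt) hu0

end CkAlphaAround
end Implicit

/-! ### Differentiating a distance through its projection. -/

section Envelope

open Asymptotics

variable {E : Type} [NormedAddCommGroup E] [NormedSpace ℝ E] {g d : E → ℝ} {q : E → E}

/-- The envelope theorem for the distance `d z = g (z - q z)`. -/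
theorem hasFDerivAt_envelope {g' : E →L[ℝ] ℝ} {z : E} (hg : HasStrictFDerivAt g g' (z - q z))
    (hq : ContinuousAt q z) (hd : ∀ᶠ w in 𝓝 z, d w = g (w - q w))
    (h1 : ∀ᶠ w in 𝓝 z, g (w - q w) ≤ g (w - q z))
    (h2 : ∀ᶠ w in 𝓝 z, g (z - q z) ≤ g (z - q w)) : HasFDerivAt d g' z := by
  rw [hasFDerivAt_iff_isLittleO]
  refine IsLittleO.of_bound fun c hc => ?_
  have hs := hg.isLittleO.bound hc
  -- The increment of `d` lies between `g (w - q w) - g (z - q w)` and `g (w - q z) - g (z - q z)`.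
  -- The base point of the lower bound moves with `w`, which is why strict differentiability is
  -- needed.
  have t1 : Tendsto (fun w => (w - q z, z - q z)) (𝓝 z) (𝓝 (z - q z, z - q z)) :=
    (Continuous.tendsto' (by fun_prop) _ _ rfl)
  have t2 : Tendsto (fun w => (w - q w, z - q w)) (𝓝 z) (𝓝 (z - q z, z - q z)) :=
    (tendsto_id.sub hq.tendsto).prodMk_nhds (tendsto_const_nhds.sub hq.tendsto)
  filter_upwards [t1.eventually hs, t2.eventually hs, hd, h1, h2] with w e1 e2 e3 e4 e5
  simp only [sub_sub_sub_cancel_right] at e1 e2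
  rw [Real.norm_eq_abs, abs_le] at *
  rw [e3, hd.self_of_nhds]
  constructor <;> linarith [e1.1, e1.2, e2.1, e2.2]

variable {A : Set E} {x : E}

theorem eventually_hasFDerivAt_envelope (hg : ContDiffAt ℝ 1 g (x - q x))
    (hq : ∀ᶠ z in 𝓝 x, ContinuousAt q z)
    (hA : ∀ᶠ z in 𝓝 x, d z = g (z - q z) ∧ q z ∈ A ∧ ∀ w ∈ A, g (z - q z) ≤ g (z - w)) :
    ∀ᶠ z in 𝓝 x, HasFDerivAt d (fderiv ℝ g (z - q z)) z := by
  have ht : Tendsto (fun z => z - q z) (𝓝 x) (𝓝 (x - q x)) :=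
    tendsto_id.sub hq.self_of_nhds.tendsto
  filter_upwards [ht.eventually (hg.eventually (by simp)), hq, hA.eventually_nhds]
    with z h1 h2 h3
  refine hasFDerivAt_envelope (h1.hasStrictFDerivAt (by simp)) h2 (h3.mono fun w hw => hw.1)
    (h3.mono fun w hw => hw.2.2 _ h3.self_of_nhds.2.1)
    (h3.mono fun w hw => h3.self_of_nhds.2.2 _ hw.2.1)

/-- The derivative `Dg(z - q z)` is as regular as `Dg` and `q`, so `d` gains one order over `q`. -/
theorem ckAlphaAround_envelope {j : WithTop ℕ∞} {α : ℝ≥0} (hα : α ≤ 1) (hj : 1 ≤ j)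
    (hg : CkAlphaAround (j + 1) α g (x - q x)) (hq : CkAlphaAround j α q x)
    (hA : ∀ᶠ z in 𝓝 x, d z = g (z - q z) ∧ q z ∈ A ∧ ∀ w ∈ A, g (z - q z) ≤ g (z - w)) :
    CkAlphaAround (j + 1) α d x := by
  have hid : CkAlphaAround j α (fun z => z - q z) x :=
    ((CkAlphaAround.of_contDiff (f := fun z : E => z) hα contDiff_id).add
      (hq.clm_comp hα (-ContinuousLinearMap.id ℝ E))).congr
      (Eventually.of_forall fun z => by simp [sub_eq_add_neg])
  have hgq : CkAlphaAround j α (fun z => g (z - q z)) x :=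
    CkAlphaAround.comp (g := g) (f := fun z => z - q z) hα hj (hg.of_le_one hα) hid
  refine CkAlphaAround.of_hasFDerivAt (eventually_hasFDerivAt_envelope
    (hg.contDiffAt.of_le (le_trans hj le_self_add))
    (hq.eventually_contDiffAt.mono fun z hz => hz.continuousAt) hA) ?_
    (CkAlphaAround.comp (g := fderiv ℝ g) (f := fun z => z - q z) hα hj hg.fderiv hid)
  exact (hgq.congr (hA.mono fun z hz => hz.1.symm)).eventually_contDiffAt

theorem eventually_continuousAt_of_isBigO
    (hq : (fun p : E × E => q p.1 - q p.2) =O[𝓝 (x, x)] fun p => p.1 - p.2) :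
    ∀ᶠ z in 𝓝 x, ContinuousAt q z := by
  obtain ⟨C, hC⟩ := hq.bound
  obtain ⟨r, hr, hC⟩ := Metric.eventually_nhds_iff_ball.1 hC
  filter_upwards [Metric.ball_mem_nhds x hr] with z hz
  obtain ⟨s, hs, hsub⟩ := Metric.isOpen_iff.1 Metric.isOpen_ball z hz
  refine continuousAt_of_locally_lipschitz hs C fun w hw => ?_
  have hwz : (w, z) ∈ Metric.ball (x, x) r := by
    rw [← ball_prod_same]
    exact ⟨hsub hw, hz⟩
  simpa only [dist_eq_norm] using hC _ hwz

/-- A distance with a locally Lipschitz projection is of class `C^{1,1}`. -/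
theorem c11Around_envelope (hg : ContDiffAt ℝ 2 g (x - q x))
    (hq : (fun p : E × E => q p.1 - q p.2) =O[𝓝 (x, x)] fun p => p.1 - p.2)
    (hA : ∀ᶠ z in 𝓝 x, d z = g (z - q z) ∧ q z ∈ A ∧ ∀ w ∈ A, g (z - q z) ≤ g (z - w)) :
    CkAlphaAround 1 1 d x := by
  have hqc := eventually_continuousAt_of_isBigO hq
  have hder := eventually_hasFDerivAt_envelope (hg.of_le (by norm_num)) hqc hA
  have ht : Tendsto (fun z => z - q z) (𝓝 x) (𝓝 (x - q x)) :=
    tendsto_id.sub hqc.self_of_nhds.tendsto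
  have hdg : ContDiffAt ℝ 1 (fderiv ℝ g) (x - q x) := hg.fderiv_right (by norm_num)
  have hL : CHolderAt 0 1 (fun z => fderiv ℝ g (z - q z)) x := by
    refine cHolderAt_zero.2 ⟨?_, locHolder_of_isBigO le_rfl ?_⟩
    · obtain ⟨V, hV, hVo, hxV⟩ := eventually_nhds_iff.1
        (hqc.and (ht.eventually (hdg.eventually (by simp))))
      refine (contDiffOn_zero.2 fun z hz => ?_ : ContDiffOn ℝ 0 _ V).contDiffAt
        (hVo.mem_nhds hxV)
      refine ContinuousAt.continuousWithinAt ?_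
      exact ContinuousAt.comp (g := fderiv ℝ g) (hV z hz).2.continuousAt
        (continuousAt_id.sub (hV z hz).1)
    · have ht2 : Tendsto (fun p : E × E => (p.1 - q p.1, p.2 - q p.2)) (𝓝 (x, x))
          (𝓝 (x - q x, x - q x)) :=
        (ht.comp (tendsto_fst_nhds_diag x)).prodMk_nhds (ht.comp (tendsto_snd_nhds_diag x))
      refine ((hdg.isBigO_sub_diag le_rfl).comp_tendsto ht2).trans ?_
      refine ((isBigO_refl (fun p : E × E => p.1 - p.2) _).sub hq).congr_left fun p => ?_
      simp only [Function.comp_apply]; abel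
  refine ckAlphaAround_iff.2 ⟨?_, fun m hm => ?_⟩
  · exact ((cHolderAt_succ hder hL).1.eventually (by simp)).mono fun z hz => by simpa using hz
  · have : m = 1 := by exact_mod_cast hm.symm
    subst this
    exact cHolderAt_succ hder hL

end Envelope

/-! ### Linear algebra of the plane. -/

section PlaneGeometry

theorem plane_inner (v w : Plane) : ⟪v, w⟫_ℝ = v 0 * w 0 + v 1 * w 1 := by
  simp [PiLp.inner_apply, Fin.sum_univ_two, mul_comm]

theorem plane_norm_sq (v : Plane) : ‖v‖ ^ 2 = v 0 ^ 2 + v 1 ^ 2 := by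
  rw [← real_inner_self_eq_norm_sq, plane_inner]; ring

theorem plane_ext {v w : Plane} (h0 : v 0 = w 0) (h1 : v 1 = w 1) : v = w := by
  ext i; fin_cases i <;> assumption

@[simp] theorem perp_apply_zero (v : Plane) : perp v 0 = -v 1 := by simp [perp]

@[simp] theorem perp_apply_one (v : Plane) : perp v 1 = v 0 := by simp [perp]

@[simp] theorem perp_perp (v : Plane) : perp (perp v) = -v := plane_ext (by simp) (by simp)

@[simp] theorem norm_perp (v : Plane) : ‖perp v‖ = ‖v‖ := by
  rw [← sq_eq_sq₀ (norm_nonneg _) (norm_nonneg _), plane_norm_sq, plane_norm_sq]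
  simp; ring

@[simp] theorem inner_perp_self (v : Plane) : ⟪perp v, v⟫_ℝ = 0 := by
  rw [plane_inner]; simp; ring

@[simp] theorem inner_self_perp (v : Plane) : ⟪v, perp v⟫_ℝ = 0 := by
  rw [plane_inner]; simp; ring

theorem inner_perp_left (v w : Plane) : ⟪perp v, w⟫_ℝ = -⟪v, perp w⟫_ℝ := by
  simp only [plane_inner, perp_apply_zero, perp_apply_one]; ring

theorem inner_perp_perp (v w : Plane) : ⟪perp v, perp w⟫_ℝ = ⟪v, w⟫_ℝ := by
  simp only [plane_inner, perp_apply_zero, perp_apply_one]; ring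

theorem perp_smul (a : ℝ) (v : Plane) : perp (a • v) = a • perp v :=
  plane_ext (by simp) (by simp)

theorem perp_ne_zero {v : Plane} (h : v ≠ 0) : perp v ≠ 0 := by
  rwa [← norm_ne_zero_iff, norm_perp, norm_ne_zero_iff]

/-- The rotation `perp` as a continuous linear map. -/
noncomputable def perpCLM : Plane →L[ℝ] Plane :=
  LinearMap.toContinuousLinearMap
    { toFun := perp
      map_add' := fun v w => plane_ext (by simp; ring) (by simp)
      map_smul' := fun a v => perp_smul a v }

@[simp] theorem perpCLM_apply (v : Plane) : perpCLM v = perp v := rfl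

theorem eq_smul_perp_of_inner_eq_zero {v n : Plane} (hn : n ≠ 0) (h : ⟪v, n⟫_ℝ = 0) :
    v = (⟪v, perp n⟫_ℝ / ‖n‖ ^ 2) • perp n := by
  have hn2 : ‖n‖ ^ 2 ≠ 0 := by positivity
  rw [plane_inner] at h
  rw [plane_norm_sq] at hn2 ⊢
  rw [plane_inner]
  refine plane_ext ?_ ?_
  · simp only [PiLp.smul_apply, perp_apply_zero, perp_apply_one, smul_eq_mul]
    field_simp
    linear_combination (n 0) * h
  · simp only [PiLp.smul_apply, perp_apply_zero, perp_apply_one, smul_eq_mul]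
    field_simp
    linear_combination (n 1) * h

theorem eq_smul_of_inner_perp_eq_zero {v n : Plane} (hn : n ≠ 0) (h : ⟪v, perp n⟫_ℝ = 0) :
    v = (⟪v, n⟫_ℝ / ‖n‖ ^ 2) • n := by
  have := eq_smul_perp_of_inner_eq_zero (perp_ne_zero hn) h
  simpa [neg_div] using this

theorem inner_gradient (f : Plane → ℝ) (x v : Plane) : ⟪gradient f x, v⟫_ℝ = fderiv ℝ f x v := by
  rw [← toDual_gradient]; rfl

end PlaneGeometry

/-! ### Regularity of the gauge function. -/

namespace AdmissibleBody

variable {k : WithTop ℕ∞} {α : ℝ≥0} {K : Set Plane}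

section Basic

variable (hK : AdmissibleBody k α K)
include hK

theorem convex : Convex ℝ K := hK.strictConvex.convex

theorem mem_nhds_zero : K ∈ 𝓝 (0 : Plane) := mem_interior_iff_mem_nhds.1 hK.zero_mem_interior

theorem zero_mem : (0 : Plane) ∈ K := mem_of_mem_nhds hK.mem_nhds_zero

theorem absorbent : Absorbent ℝ K := absorbent_nhds_zero hK.mem_nhds_zero

theorem gauge_pos_iff {z : Plane} : 0 < gauge K z ↔ z ≠ 0 :=
  gauge_pos hK.absorbent (NormedSpace.isVonNBounded_iff ℝ |>.2 hK.compact.isBounded)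

theorem continuous_gauge : Continuous (gauge K) :=
  _root_.continuous_gauge hK.convex hK.mem_nhds_zero

theorem gauge_le_one_iff {z : Plane} : gauge K z ≤ 1 ↔ z ∈ K := by
  rw [gauge_le_one_iff_mem_closure hK.convex hK.mem_nhds_zero, hK.compact.isClosed.closure_eq]

theorem gauge_eq_one_iff {z : Plane} : gauge K z = 1 ↔ z ∈ frontier K :=
  gauge_eq_one_iff_mem_frontier hK.convex hK.mem_nhds_zero

theorem gauge_smul {a : ℝ} (ha : 0 ≤ a) (z : Plane) : gauge K (a • z) = a * gauge K z := by
  rw [gauge_smul_of_nonneg ha]; rfl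

theorem gauge_add_le (z w : Plane) : gauge K (z + w) ≤ gauge K z + gauge K w :=
  _root_.gauge_add_le hK.convex hK.absorbent z w

theorem inv_gauge_smul_mem_frontier {z : Plane} (hz : z ≠ 0) :
    (gauge K z)⁻¹ • z ∈ frontier K := by
  have h := hK.gauge_pos_iff.2 hz
  rw [← hK.gauge_eq_one_iff, hK.gauge_smul (by positivity), inv_mul_cancel₀ h.ne']

theorem ne_zero_of_mem_frontier {p : Plane} (hp : p ∈ frontier K) : p ≠ 0 := by
  rw [← hK.gauge_pos_iff, hK.gauge_eq_one_iff.2 hp]; exact one_pos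

/-- Radial directions are transversal to the boundary of the body. -/
theorem fderiv_apply_self_ne_zero (hk : 1 ≤ k) {p : Plane} (hp : p ∈ frontier K) {f : Plane → ℝ}
    (hf : CkAlphaAround k α f p) (hf0 : gradient f p ≠ 0)
    (hfK : ∀ᶠ z in 𝓝 p, (z ∈ frontier K ↔ f z = 0)) : fderiv ℝ f p p ≠ 0 := by
  intro hcon
  have hk0 : k ≠ 0 := by rintro rfl; simp at hk
  set n := gradient f p with hn
  have hnn : fderiv ℝ f p n = ‖n‖ ^ 2 := by
    rw [← inner_gradient, real_inner_self_eq_norm_sq]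
  have hn2 : 0 < ‖n‖ ^ 2 := by positivity
  obtain ⟨ρ, hρ, hρK⟩ := Metric.mem_nhds_iff.1 hK.mem_nhds_zero
  -- The segment from `-δ n` to `δ n` lies inside `K`. Shrinking it towards `p` keeps it in the
  -- interior by convexity. If the radial derivative vanished, `f` would have opposite signs at the
  -- ends of the shrunken segment.
  obtain ⟨δ, hδ, hδn⟩ : ∃ δ : ℝ, 0 < δ ∧ δ * ‖n‖ < ρ := by
    refine ⟨ρ / (2 * ‖n‖), by positivity, ?_⟩
    field_simp
    linarith
  have hin : ∀ ε ∈ Ioo (0 : ℝ) 1, ∀ t ∈ Icc (-δ) δ, p + ε • (-p + t • n) ∈ interior K := by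
    intro ε hε t ht
    have h1 : t • n ∈ interior K := by
      refine interior_maximal hρK Metric.isOpen_ball ?_
      rw [mem_ball_zero_iff, norm_smul, Real.norm_eq_abs]
      exact lt_of_le_of_lt (by gcongr; exact abs_le.2 ht) hδn
    have h2 := hK.convex.combo_interior_self_mem_interior h1
      (hK.compact.isClosed.frontier_subset hp) hε.1 (sub_nonneg.2 hε.2.le) (by ring)
    convert h2 using 1
    module
  have hder : ∀ t : ℝ, HasDerivAt (fun ε : ℝ => f (p + ε • (-p + t • n))) (t * ‖n‖ ^ 2) 0 := by
    intro t
    have h1 : HasDerivAt (fun ε : ℝ => p + ε • (-p + t • n)) (-p + t • n) 0 := by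
      simpa using ((hasDerivAt_id (0 : ℝ)).smul_const (-p + t • n)).const_add p
    have h2 : HasFDerivAt f (fderiv ℝ f p) (p + (0 : ℝ) • (-p + t • n)) := by
      simpa using (hf.contDiffAt.differentiableAt hk0).hasFDerivAt
    have h3 := h2.comp_hasDerivAt 0 h1
    have e : fderiv ℝ f p (-p + t • n) = t * ‖n‖ ^ 2 := by
      rw [map_add, map_neg, hcon, map_smul, hnn]; simp
    rwa [e] at h3
  have hfp : f p = 0 := hfK.self_of_nhds.1 hp
  have hsign : ∀ t : ℝ, 0 < t → ∀ᶠ ε in 𝓝[>] (0 : ℝ), 0 < f (p + ε • (-p + t • n)) := by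
    intro t ht
    have h1 := (hasDerivAt_iff_tendsto_slope_zero.1 (hder t)).mono_left (nhdsGT_le_nhdsNE 0)
    filter_upwards [h1.eventually (lt_mem_nhds (show 0 < t * ‖n‖ ^ 2 by positivity)),
      self_mem_nhdsWithin] with ε h2 h3
    simp only [zero_add, zero_smul, add_zero, hfp, sub_zero, smul_eq_mul] at h2
    exact (pos_iff_pos_of_mul_pos h2).1 (inv_pos.2 h3)
  have hsign' : ∀ t : ℝ, t < 0 → ∀ᶠ ε in 𝓝[>] (0 : ℝ), f (p + ε • (-p + t • n)) < 0 := by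
    intro t ht
    have h1 := (hasDerivAt_iff_tendsto_slope_zero.1 (hder t)).mono_left (nhdsGT_le_nhdsNE 0)
    filter_upwards [h1.eventually (gt_mem_nhds (show t * ‖n‖ ^ 2 < 0 from
      mul_neg_of_neg_of_pos ht hn2)), self_mem_nhdsWithin] with ε h2 h3
    simp only [zero_add, zero_smul, add_zero, hfp, sub_zero, smul_eq_mul] at h2
    exact neg_of_mul_neg_right h2 (inv_nonneg.2 (le_of_lt h3))
  obtain ⟨r, hr, hball⟩ := Metric.eventually_nhds_iff_ball.1
    (hfK.and (hf.eventually_contDiffAt.mono fun z hz => hz.continuousAt))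
  have hsmall : ∀ᶠ ε in 𝓝[>] (0 : ℝ), ε * (‖p‖ + δ * ‖n‖) < r := by
    have : Tendsto (fun ε : ℝ => ε * (‖p‖ + δ * ‖n‖)) (𝓝[>] 0) (𝓝 0) :=
      tendsto_nhdsWithin_of_tendsto_nhds (Continuous.tendsto' (by fun_prop) _ _ (by simp))
    exact this.eventually (gt_mem_nhds hr)
  obtain ⟨ε, e1, e2, e3, e4⟩ := ((hsign δ hδ).and ((hsign' (-δ) (by linarith)).and
    (hsmall.and (Ioo_mem_nhdsGT one_pos)))).exists
  have hb : ∀ t ∈ Icc (-δ) δ, p + ε • (-p + t • n) ∈ Metric.ball p r := by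
    intro t ht
    rw [mem_ball_iff_norm, add_sub_cancel_left, norm_smul, Real.norm_of_nonneg e4.1.le]
    refine lt_of_le_of_lt ?_ e3
    have := e4.1.le
    gcongr
    refine (norm_add_le _ _).trans ?_
    rw [norm_neg, norm_smul, Real.norm_eq_abs]
    gcongr
    exact abs_le.2 ht
  have hc : ContinuousOn (fun t : ℝ => f (p + ε • (-p + t • n))) (Icc (-δ) δ) := by
    intro t ht
    refine ContinuousAt.continuousWithinAt ?_
    exact ContinuousAt.comp (g := f) (hball _ (hb t ht)).2 (by fun_prop)
  -- The zero of `f` found here is an interior point of `K` close to `p`, whereas near `p` the zeros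
  -- of `f` are boundary points.
  obtain ⟨t, ht, ht0⟩ := intermediate_value_Icc (by linarith) hc ⟨e2.le, e1.le⟩
  have := (hball _ (hb t ht)).1.2 ht0
  exact this.2 (hin ε e4 t ht)

/-- The number `1 / γ(z)` is the solution `t` of `f(t z) = 0`, and the derivative in `t` is nonzero
by transversality of the radial direction. Continuity of the gauge function identifies it with the
smooth solution. -/
theorem ckAlphaAround_gauge_of_mem_frontier (hα : α ≤ 1) (hk : 1 ≤ k) {p : Plane}
    (hp : p ∈ frontier K) : CkAlphaAround k α (gauge K) p := by
  have hk0 : k ≠ 0 := by rintro rfl; simp at hk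
  obtain ⟨f, hf, hf0, hfK⟩ := hK.smooth_boundary p hp
  have htr := hK.fderiv_apply_self_ne_zero hk hp hf hf0 hfK
  have hγp : gauge K p = 1 := hK.gauge_eq_one_iff.2 hp
  have hpos : ∀ᶠ z in 𝓝 p, z ≠ 0 := isOpen_ne.mem_nhds (hK.ne_zero_of_mem_frontier hp)
  set F : Plane × ℝ → ℝ := fun q => f (q.2 • q.1) with hF
  have hsm : ContDiff ℝ ⊤ fun q : Plane × ℝ => q.2 • q.1 := contDiff_snd.smul contDiff_fst
  have hFr : CkAlphaAround k α F (p, 1) := by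
    refine CkAlphaAround.comp (g := f) hα hk (by simpa using hf)
      (CkAlphaAround.of_contDiff hα (hsm.of_le le_top))
  have hu : ∀ z, z ≠ 0 → ContinuousAt (fun z => (gauge K z)⁻¹) z := fun z hz =>
    hK.continuous_gauge.continuousAt.inv₀ (hK.gauge_pos_iff.2 hz).ne'
  have hd : fderiv ℝ F (p, 1) (0, 1) ≠ 0 := by
    have h1 : HasFDerivAt f (fderiv ℝ f p) ((p, (1 : ℝ)).2 • (p, (1 : ℝ)).1) := by
      simpa using (hf.contDiffAt.differentiableAt hk0).hasFDerivAt
    have h2 := (hasFDerivAt_snd (𝕜 := ℝ) (p := (p, (1 : ℝ)))).smul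
      (hasFDerivAt_fst (𝕜 := ℝ) (p := (p, (1 : ℝ))))
    have h3 : HasFDerivAt F _ (p, 1) := h1.comp (p, (1 : ℝ)) h2
    rw [h3.fderiv]
    simpa using htr
  have huR : CkAlphaAround k α (fun z => (gauge K z)⁻¹) p := by
    refine CkAlphaAround.implicit (F := F) hα hk (by simpa [hγp] using hFr)
      (by simpa [hγp] using hd) (hpos.mono hu) ?_
    have ht : Tendsto (fun z => (gauge K z)⁻¹ • z) (𝓝 p) (𝓝 p) := by
      have : ContinuousAt (fun z => (gauge K z)⁻¹ • z) p :=
        (hu p (hK.ne_zero_of_mem_frontier hp)).smul continuousAt_id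
      simpa [ContinuousAt, hγp] using this
    filter_upwards [ht.eventually hfK, hpos] with z h1 h2
    exact h1.1 (hK.inv_gauge_smul_mem_frontier h2)
  have hinv : CkAlphaAround k α (fun t : ℝ => t⁻¹) (gauge K p)⁻¹ := by
    refine CkAlphaAround.of_contDiffAt hα ?_
    have : (gauge K p)⁻¹ ≠ 0 := by simp [hγp]
    filter_upwards [isOpen_ne.mem_nhds this] with t ht using contDiffAt_inv ℝ ht
  exact (CkAlphaAround.comp (g := fun t : ℝ => t⁻¹) (f := fun z => (gauge K z)⁻¹) hα hk hinv huR).congr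
    (Eventually.of_forall fun z => inv_inv _)

/-- The gauge function is as regular as the boundary, away from the origin. -/
theorem ckAlphaAround_gauge (hα : α ≤ 1) (hk : 1 ≤ k) {z : Plane} (hz : z ≠ 0) :
    CkAlphaAround k α (gauge K) z := by
  have hpos := hK.gauge_pos_iff.2 hz
  have h1 := hK.ckAlphaAround_gauge_of_mem_frontier hα hk (hK.inv_gauge_smul_mem_frontier hz)
  have h2 : CkAlphaAround k α (fun w => (gauge K z)⁻¹ • w) z :=
    CkAlphaAround.of_contDiff hα (contDiff_const_smul _)
  have h3 := (CkAlphaAround.comp (g := gauge K) (f := fun w => (gauge K z)⁻¹ • w) hα hk h1 h2).clm_comp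
    hα (gauge K z • ContinuousLinearMap.id ℝ ℝ)
  refine h3.congr (Eventually.of_forall fun w => ?_)
  simp only [smul_apply, ContinuousLinearMap.id_apply, smul_eq_mul]
  rw [hK.gauge_smul (by positivity), mul_inv_cancel_left₀ hpos.ne']

end Basic
end AdmissibleBody

/-! ### Homogeneity of the gauge, the support function and its derivatives. -/

namespace AdmissibleBody

variable {k : WithTop ℕ∞} {α : ℝ≥0} {K : Set Plane}

section GaugeDerivatives

variable (hK : AdmissibleBody k α K) (hα : α ≤ 1) (hk : 2 ≤ k)
include hK hα hk

theorem contDiffAt_gauge {z : Plane} (hz : z ≠ 0) : ContDiffAt ℝ 2 (gauge K) z :=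
  (hK.ckAlphaAround_gauge hα (le_trans (by norm_num) hk) hz).contDiffAt.of_le hk

theorem hasFDerivAt_gauge {z : Plane} (hz : z ≠ 0) :
    HasFDerivAt (gauge K) (fderiv ℝ (gauge K) z) z :=
  ((hK.contDiffAt_gauge hα hk hz).differentiableAt (by norm_num)).hasFDerivAt

theorem hasFDerivAt_fderiv_gauge {z : Plane} (hz : z ≠ 0) :
    HasFDerivAt (fderiv ℝ (gauge K)) (fderiv ℝ (fderiv ℝ (gauge K)) z) z :=
  (((hK.contDiffAt_gauge hα hk hz).fderiv_right (m := 1) (by norm_num)).differentiableAt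
    (by norm_num)).hasFDerivAt

theorem fderiv_gauge_self {z : Plane} (hz : z ≠ 0) : fderiv ℝ (gauge K) z z = gauge K z := by
  have h1 : HasDerivAt (fun a : ℝ => a • z) z 1 := by
    simpa using (hasDerivAt_id (1 : ℝ)).smul_const z
  have h2 : HasFDerivAt (gauge K) (fderiv ℝ (gauge K) z) ((1 : ℝ) • z) := by
    simpa using hK.hasFDerivAt_gauge hα hk hz
  have h3 := h2.comp_hasDerivAt 1 h1
  have h4 : HasDerivAt (fun a : ℝ => a * gauge K z) (gauge K z) 1 := by
    simpa using (hasDerivAt_id (1 : ℝ)).mul_const (gauge K z)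
  refine h3.unique (h4.congr_of_eventuallyEq ?_)
  filter_upwards [lt_mem_nhds (one_pos : (0 : ℝ) < 1)] with a ha
  exact hK.gauge_smul ha.le z

theorem fderiv_gauge_smul {a : ℝ} (ha : 0 < a) {z : Plane} (hz : z ≠ 0) :
    fderiv ℝ (gauge K) (a • z) = fderiv ℝ (gauge K) z := by
  have h1 : HasFDerivAt (fun w : Plane => a • w) (a • ContinuousLinearMap.id ℝ Plane) z :=
    (hasFDerivAt_id z).const_smul a
  have h2 := (hK.hasFDerivAt_gauge hα hk (z := a • z) (smul_ne_zero ha.ne' hz)).comp z h1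
  have h3 : HasFDerivAt (fun w => a * gauge K w) (a • fderiv ℝ (gauge K) z) z :=
    (hK.hasFDerivAt_gauge hα hk hz).const_mul a
  have h4 := h2.unique (h3.congr_of_eventuallyEq
    (Eventually.of_forall fun w => hK.gauge_smul ha.le w))
  ext v
  have := DFunLike.congr_fun h4 v
  simpa [ha.ne'] using this

theorem fderiv2_gauge_self {z : Plane} (hz : z ≠ 0) :
    fderiv ℝ (fderiv ℝ (gauge K)) z z = 0 := by
  have h1 : HasDerivAt (fun a : ℝ => a • z) z 1 := by
    simpa using (hasDerivAt_id (1 : ℝ)).smul_const z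
  have h2 : HasFDerivAt (fderiv ℝ (gauge K)) (fderiv ℝ (fderiv ℝ (gauge K)) z) ((1 : ℝ) • z) := by
    simpa using hK.hasFDerivAt_fderiv_gauge hα hk hz
  have h3 := h2.comp_hasDerivAt 1 h1
  refine h3.unique ((hasDerivAt_const 1 (fderiv ℝ (gauge K) z)).congr_of_eventuallyEq ?_)
  filter_upwards [lt_mem_nhds (one_pos : (0 : ℝ) < 1)] with a ha
  exact hK.fderiv_gauge_smul hα hk ha hz

theorem fderiv2_gauge_smul {a : ℝ} (ha : 0 < a) {z : Plane} (hz : z ≠ 0) :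
    a • fderiv ℝ (fderiv ℝ (gauge K)) (a • z) = fderiv ℝ (fderiv ℝ (gauge K)) z := by
  have h1 : HasFDerivAt (fun w : Plane => a • w) (a • ContinuousLinearMap.id ℝ Plane) z :=
    (hasFDerivAt_id z).const_smul a
  have h2 := (hK.hasFDerivAt_fderiv_gauge hα hk (z := a • z) (smul_ne_zero ha.ne' hz)).comp z h1
  have h4 := h2.unique ((hK.hasFDerivAt_fderiv_gauge hα hk hz).congr_of_eventuallyEq ?_)
  · rw [← h4]; ext v w; simp
  · filter_upwards [isOpen_ne.mem_nhds hz] with w hw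
    exact hK.fderiv_gauge_smul hα hk ha hw

theorem fderiv2_gauge_symm {z : Plane} (hz : z ≠ 0) (v w : Plane) :
    fderiv ℝ (fderiv ℝ (gauge K)) z v w = fderiv ℝ (fderiv ℝ (gauge K)) z w v :=
  (hK.contDiffAt_gauge hα hk hz).isSymmSndFDerivAt (by simp) v w

theorem fderiv2_gauge_apply_self {z : Plane} (hz : z ≠ 0) (v : Plane) :
    fderiv ℝ (fderiv ℝ (gauge K)) z v z = 0 := by
  rw [hK.fderiv2_gauge_symm hα hk hz, hK.fderiv2_gauge_self hα hk hz]; rfl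

/-- The Hessian of the gauge function is degenerate in the radial direction. -/
theorem fderiv2_gauge_eq {z ζ : Plane} (hz : z ≠ 0) (hζ : ‖ζ‖ = 1) (hzζ : ⟪ζ, z⟫_ℝ = 0)
    (v w : Plane) : fderiv ℝ (fderiv ℝ (gauge K)) z v w =
      fderiv ℝ (fderiv ℝ (gauge K)) z ζ ζ * ⟪v, ζ⟫_ℝ * ⟪w, ζ⟫_ℝ := by
  have hdec : ∀ v : Plane, ∃ a : ℝ, v = a • z + ⟪v, ζ⟫_ℝ • ζ := by
    intro v
    have h1 : ⟪v - ⟪v, ζ⟫_ℝ • ζ, ζ⟫_ℝ = 0 := by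
      rw [inner_sub_left, real_inner_smul_left, real_inner_self_eq_norm_sq, hζ]; ring
    have hζ0 : ζ ≠ 0 := by rintro rfl; simp at hζ
    have h2 := eq_smul_perp_of_inner_eq_zero hζ0 h1
    have h3 := eq_smul_perp_of_inner_eq_zero hζ0 ((real_inner_comm _ _).trans hzζ)
    set b := ⟪z, perp ζ⟫_ℝ / ‖ζ‖ ^ 2
    set c := ⟪v - ⟪v, ζ⟫_ℝ • ζ, perp ζ⟫_ℝ / ‖ζ‖ ^ 2
    have hb : b ≠ 0 := by
      intro hb; rw [hb, zero_smul] at h3; exact hz h3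
    refine ⟨c / b, ?_⟩
    rw [h3, smul_smul, div_mul_cancel₀ _ hb, ← h2]
    abel
  obtain ⟨a, ha⟩ := hdec v
  obtain ⟨b, hb⟩ := hdec w
  rw [ha, hb]
  simp only [map_add, map_smul, add_apply, smul_apply, hK.fderiv2_gauge_self hα hk hz,
    hK.fderiv2_gauge_apply_self hα hk hz, inner_add_left, real_inner_smul_left,
    real_inner_self_eq_norm_sq, hζ, (real_inner_comm _ _).trans hzζ]
  simp
  ring

/-- By subadditivity every forward difference quotient in direction `w` is at most `γ(w)`. -/
theorem fderiv_gauge_le {z : Plane} (hz : z ≠ 0) (w : Plane) :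
    fderiv ℝ (gauge K) z w ≤ gauge K w := by
  have h1 : HasDerivAt (fun a : ℝ => z + a • w) w 0 := by
    simpa using ((hasDerivAt_id (0 : ℝ)).smul_const w).const_add z
  have h2 : HasFDerivAt (gauge K) (fderiv ℝ (gauge K) z) (z + (0 : ℝ) • w) := by
    simpa using hK.hasFDerivAt_gauge hα hk hz
  have h3 := h2.comp_hasDerivAt 0 h1
  have h4 := (hasDerivAt_iff_tendsto_slope_zero.1 h3).mono_left (nhdsGT_le_nhdsNE 0)
  refine le_of_tendsto h4 ?_
  filter_upwards [self_mem_nhdsWithin] with a ha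
  have ha' : 0 < a := ha
  have h5 := hK.gauge_add_le z (a • w)
  rw [hK.gauge_smul ha'.le] at h5
  simp only [Function.comp_apply, zero_add, zero_smul, add_zero, smul_eq_mul]
  rw [inv_mul_le_iff₀ ha']
  linarith

theorem fderiv_gauge_ne_zero {z : Plane} (hz : z ≠ 0) : gradient (gauge K) z ≠ 0 := by
  intro h
  have h1 := inner_gradient (gauge K) z z
  rw [h, inner_zero_left, hK.fderiv_gauge_self hα hk hz] at h1
  exact (hK.gauge_pos_iff.2 hz).ne h1

end GaugeDerivatives

section Support

variable (hK : AdmissibleBody k α K)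
include hK

theorem exists_support (ν : Plane) : ∃ p ∈ K, ∀ z ∈ K, ⟪ν, z⟫_ℝ ≤ ⟪ν, p⟫_ℝ :=
  hK.compact.exists_isMaxOn (f := fun z => ⟪ν, z⟫_ℝ) ⟨0, hK.zero_mem⟩ (by fun_prop)

theorem support_pos {ν p : Plane} (hν : ν ≠ 0) (hp : ∀ z ∈ K, ⟪ν, z⟫_ℝ ≤ ⟪ν, p⟫_ℝ) :
    0 < ⟪ν, p⟫_ℝ := by
  obtain ⟨ρ, hρ, hρK⟩ := Metric.mem_nhds_iff.1 hK.mem_nhds_zero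
  have h1 : (ρ / (2 * ‖ν‖)) • ν ∈ K := by
    refine hρK ?_
    have := norm_pos_iff.2 hν
    rw [mem_ball_zero_iff, norm_smul, Real.norm_of_nonneg (by positivity)]
    field_simp
    linarith
  refine lt_of_lt_of_le ?_ (hp _ h1)
  rw [real_inner_smul_right, real_inner_self_eq_norm_sq]
  have := norm_pos_iff.2 hν
  positivity

/-- A multiple `r⁻¹ ν` lies in the polar exactly when `r` is at least the maximum of `ν` on `K`: the
gauge of the polar is the support function. -/
theorem polarGauge_eq {ν p : Plane} (hν : ν ≠ 0) (hpK : p ∈ K)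
    (hp : ∀ z ∈ K, ⟪ν, z⟫_ℝ ≤ ⟪ν, p⟫_ℝ) : polarGauge K ν = ⟪ν, p⟫_ℝ := by
  have hpos := hK.support_pos hν hp
  have hset : {r ∈ Ioi (0 : ℝ) | r⁻¹ • ν ∈ polarBody K} = Ici ⟪ν, p⟫_ℝ := by
    ext r
    simp only [polarBody, mem_ofPred_eq, mem_Ioi, mem_Ici, real_inner_smul_left]
    constructor
    · rintro ⟨hr, h⟩
      have := h p hpK
      rwa [inv_mul_le_iff₀ hr, mul_one] at this
    · intro hr
      have hr0 : 0 < r := lt_of_lt_of_le hpos hr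
      refine ⟨hr0, fun y hy => ?_⟩
      rw [inv_mul_le_iff₀ hr0, mul_one]
      exact (hp y hy).trans hr
  rw [polarGauge, gauge_def', hset, csInf_Ici]

/-- The midpoint of two maximizers would be an interior maximizer by strict convexity, and moving
from it along `ν` increases the functional. -/
theorem support_unique {ν p q : Plane} (hν : ν ≠ 0) (hpK : p ∈ K)
    (hp : ∀ z ∈ K, ⟪ν, z⟫_ℝ ≤ ⟪ν, p⟫_ℝ) (hqK : q ∈ K)
    (hq : ∀ z ∈ K, ⟪ν, z⟫_ℝ ≤ ⟪ν, q⟫_ℝ) : p = q := by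
  by_contra hne
  have hm := hK.strictConvex hpK hqK hne (a := 1 / 2) (b := 1 / 2) (by norm_num) (by norm_num)
    (by norm_num)
  set m := (1 / 2 : ℝ) • p + (1 / 2 : ℝ) • q
  have hνm : ⟪ν, m⟫_ℝ = ⟪ν, p⟫_ℝ := by
    have := le_antisymm (hp q hqK) (hq p hpK)
    rw [inner_add_right, real_inner_smul_right, real_inner_smul_right, this]; ring
  have ht : Tendsto (fun ε : ℝ => m + ε • ν) (𝓝[>] 0) (𝓝 m) :=
    tendsto_nhdsWithin_of_tendsto_nhds (Continuous.tendsto' (by fun_prop) _ _ (by simp))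
  obtain ⟨ε, h1, h2⟩ := ((ht.eventually (mem_interior_iff_mem_nhds.1 hm)).and
    self_mem_nhdsWithin).exists
  have h3 := hp _ h1
  rw [inner_add_right, hνm, real_inner_smul_right, real_inner_self_eq_norm_sq] at h3
  have h4 : 0 < ε * ‖ν‖ ^ 2 := mul_pos h2 (by positivity)
  linarith

end Support

/-- The point of `K` at which a linear functional is maximal. -/
noncomputable def supportPoint (hK : AdmissibleBody k α K) (ν : Plane) : Plane :=
  (hK.exists_support ν).choose

section SupportPoint

variable (hK : AdmissibleBody k α K)
include hK

theorem supportPoint_mem (ν : Plane) : hK.supportPoint ν ∈ K := (hK.exists_support ν).choose_spec.1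

theorem inner_le_supportPoint (ν : Plane) {z : Plane} (hz : z ∈ K) :
    ⟪ν, z⟫_ℝ ≤ ⟪ν, hK.supportPoint ν⟫_ℝ := (hK.exists_support ν).choose_spec.2 z hz

theorem polarGauge_eq_inner {ν : Plane} (hν : ν ≠ 0) :
    polarGauge K ν = ⟪ν, hK.supportPoint ν⟫_ℝ :=
  hK.polarGauge_eq hν (hK.supportPoint_mem ν) fun _ hz => hK.inner_le_supportPoint ν hz

theorem polarGauge_pos {ν : Plane} (hν : ν ≠ 0) : 0 < polarGauge K ν := by
  rw [hK.polarGauge_eq_inner hν]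
  exact hK.support_pos hν fun _ hz => hK.inner_le_supportPoint ν hz

theorem supportPoint_eq {ν p : Plane} (hν : ν ≠ 0) (hpK : p ∈ K)
    (hp : ∀ z ∈ K, ⟪ν, z⟫_ℝ ≤ ⟪ν, p⟫_ℝ) : hK.supportPoint ν = p :=
  hK.support_unique hν (hK.supportPoint_mem ν) (fun _ hz => hK.inner_le_supportPoint ν hz) hpK hp

theorem inner_le_gauge_mul {ν : Plane} (hν : ν ≠ 0) (z : Plane) :
    ⟪ν, z⟫_ℝ ≤ gauge K z * polarGauge K ν := by
  rcases eq_or_ne z 0 with rfl | hz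
  · simp
  · have h := hK.gauge_pos_iff.2 hz
    have h1 := hK.inner_le_supportPoint ν
      (hK.compact.isClosed.frontier_subset (hK.inv_gauge_smul_mem_frontier hz))
    rw [← hK.polarGauge_eq_inner hν, real_inner_smul_right, inv_mul_le_iff₀ h] at h1
    exact h1

theorem gauge_supportPoint {ν : Plane} (hν : ν ≠ 0) : gauge K (hK.supportPoint ν) = 1 := by
  refine le_antisymm (hK.gauge_le_one_iff.2 (hK.supportPoint_mem ν)) ?_
  have h := hK.inner_le_gauge_mul hν (hK.supportPoint ν)
  rw [← hK.polarGauge_eq_inner hν] at h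
  have := hK.polarGauge_pos hν
  by_contra hc
  push Not at hc
  nlinarith

theorem supportPoint_mem_frontier {ν : Plane} (hν : ν ≠ 0) : hK.supportPoint ν ∈ frontier K :=
  hK.gauge_eq_one_iff.1 (hK.gauge_supportPoint hν)

theorem supportPoint_ne_zero {ν : Plane} (hν : ν ≠ 0) : hK.supportPoint ν ≠ 0 :=
  hK.ne_zero_of_mem_frontier (hK.supportPoint_mem_frontier hν)

/-- By compactness it suffices to identify cluster points. Maximality passes to the limit, and the
maximizer is unique. -/
theorem continuousAt_supportPoint {ν : Plane} (hν : ν ≠ 0) :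
    ContinuousAt hK.supportPoint ν := by
  refine hK.compact.tendsto_nhds_of_unique_mapClusterPt
    (Eventually.of_forall hK.supportPoint_mem) fun y hy hcl => ?_
  refine (hK.supportPoint_eq hν hy fun z hz => ?_).symm
  obtain ⟨R, hR⟩ := hK.compact.isBounded.exists_norm_le
  have h1 : ∀ w, ⟪ν, z⟫_ℝ - 2 * R * ‖w - ν‖ ≤ ⟪ν, hK.supportPoint w⟫_ℝ := by
    intro w
    have h2 := hK.inner_le_supportPoint w hz
    have h3 : |⟪w - ν, z⟫_ℝ| ≤ ‖w - ν‖ * R :=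
      (abs_real_inner_le_norm _ _).trans (by gcongr; exact hR z hz)
    have h4 : |⟪w - ν, hK.supportPoint w⟫_ℝ| ≤ ‖w - ν‖ * R :=
      (abs_real_inner_le_norm _ _).trans (by gcongr; exact hR _ (hK.supportPoint_mem w))
    rw [inner_sub_left, abs_le] at h3 h4
    linarith [h3.1, h4.2]
  have h5 : MapClusterPt ⟪ν, y⟫_ℝ (𝓝 ν) fun w => ⟪ν, hK.supportPoint w⟫_ℝ :=
    hcl.continuousAt_comp (f := fun p => ⟪ν, p⟫_ℝ) (by fun_prop)
  have h6 : Tendsto (fun w => ⟪ν, z⟫_ℝ - 2 * R * ‖w - ν‖) (𝓝 ν) (𝓝 ⟪ν, z⟫_ℝ) :=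
    Continuous.tendsto' (by fun_prop) _ _ (by simp)
  by_contra hlt
  push Not at hlt
  obtain ⟨c, hc1, hc2⟩ := exists_between hlt
  obtain ⟨w, hw1, hw2⟩ := ((h5.frequently (gt_mem_nhds hc1)).and_eventually
    (h6.eventually (lt_mem_nhds hc2))).exists
  linarith [h1 w]

/-- With `P` the support point, comparing maximizers gives `⟪w - ν, P ν⟫ ≤ γ°(w) - γ°(ν) ≤ ⟪w - ν, P
w⟫`, and `P` is continuous. -/
theorem hasGradientAt_polarGauge {ν : Plane} (hν : ν ≠ 0) :
    HasGradientAt (polarGauge K) (hK.supportPoint ν) ν := by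
  rw [hasGradientAt_iff_isLittleO, Asymptotics.isLittleO_iff]
  intro c hc
  have h1 : ∀ᶠ w in 𝓝 ν, ‖hK.supportPoint w - hK.supportPoint ν‖ < c := by
    have := (hK.continuousAt_supportPoint hν).eventually (Metric.ball_mem_nhds _ hc)
    simpa only [Metric.mem_ball, dist_eq_norm] using this
  filter_upwards [h1, isOpen_ne.mem_nhds hν] with w hw hw0
  rw [hK.polarGauge_eq_inner hν, hK.polarGauge_eq_inner hw0]
  have h2 := hK.inner_le_supportPoint w (hK.supportPoint_mem ν)
  have h3 := hK.inner_le_supportPoint ν (hK.supportPoint_mem w)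
  have h4 : ⟪w - ν, hK.supportPoint w - hK.supportPoint ν⟫_ℝ ≤ c * ‖w - ν‖ := by
    refine (real_inner_le_norm _ _).trans ?_
    rw [mul_comm]
    gcongr
  simp only [inner_sub_left, inner_sub_right] at h4
  rw [Real.norm_eq_abs, abs_le, real_inner_comm _ (hK.supportPoint ν), inner_sub_left]
  have := mul_nonneg hc.le (norm_nonneg (w - ν))
  constructor <;> linarith

theorem gradient_polarGauge {ν : Plane} (hν : ν ≠ 0) :
    gradient (polarGauge K) ν = hK.supportPoint ν := (hK.hasGradientAt_polarGauge hν).gradient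

theorem supportPoint_smul {a : ℝ} (ha : 0 < a) {ν : Plane} (hν : ν ≠ 0) :
    hK.supportPoint (a • ν) = hK.supportPoint ν := by
  refine hK.supportPoint_eq (smul_ne_zero ha.ne' hν) (hK.supportPoint_mem ν) fun z hz => ?_
  rw [real_inner_smul_left, real_inner_smul_left]
  exact mul_le_mul_of_nonneg_left (hK.inner_le_supportPoint ν hz) ha.le

theorem polarGauge_smul {a : ℝ} (ha : 0 < a) {ν : Plane} (hν : ν ≠ 0) :
    polarGauge K (a • ν) = a * polarGauge K ν := by
  rw [hK.polarGauge_eq_inner (smul_ne_zero ha.ne' hν), hK.supportPoint_smul ha hν,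
    real_inner_smul_left, hK.polarGauge_eq_inner hν]

end SupportPoint

section Curvature

variable (hK : AdmissibleBody k α K) (hα : α ≤ 1) (hk : 2 ≤ k)
include hK hα hk

/-- The function `γ°(ν) γ(z) - ⟪ν, z⟫` is nonnegative and vanishes at the support point, so that
point is critical. -/
theorem fderiv_gauge_supportPoint {ν : Plane} (hν : ν ≠ 0) :
    fderiv ℝ (gauge K) (hK.supportPoint ν) = (polarGauge K ν)⁻¹ • innerSL ℝ ν := by
  have hh := hK.polarGauge_pos hν
  have h1 : HasFDerivAt (fun z => polarGauge K ν * gauge K z - innerSL ℝ ν z)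
      (polarGauge K ν • fderiv ℝ (gauge K) (hK.supportPoint ν) - innerSL ℝ ν)
      (hK.supportPoint ν) :=
    ((hK.hasFDerivAt_gauge hα hk (hK.supportPoint_ne_zero hν)).const_mul _).sub
      (innerSL ℝ ν).hasFDerivAt
  have h2 : IsLocalMin (fun z => polarGauge K ν * gauge K z - innerSL ℝ ν z)
      (hK.supportPoint ν) := by
    refine Eventually.of_forall fun z => ?_
    simp only [innerSL_apply_apply, hK.gauge_supportPoint hν, ← hK.polarGauge_eq_inner hν]
    have := hK.inner_le_gauge_mul hν z
    linarith
  have h3 := sub_eq_zero.1 (h2.hasFDerivAt_eq_zero h1)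
  rw [← h3, smul_smul, inv_mul_cancel₀ hh.ne', one_smul]

/-- A vector at which the derivative of the gauge is a positive multiple of `ν` is a positive
multiple of the support point. -/
theorem eq_smul_supportPoint {q ν : Plane} {c : ℝ} (hq : q ≠ 0) (hν : ν ≠ 0) (hc : 0 < c)
    (h : fderiv ℝ (gauge K) q = c • innerSL ℝ ν) :
    q = gauge K q • hK.supportPoint ν ∧ c = (polarGauge K ν)⁻¹ := by
  have hpos := hK.gauge_pos_iff.2 hq
  have h1 : ∀ z, c * ⟪ν, z⟫_ℝ ≤ gauge K z := fun z => by
    simpa [h] using hK.fderiv_gauge_le hα hk hq z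
  have h2 : c * ⟪ν, q⟫_ℝ = gauge K q := by simpa [h] using hK.fderiv_gauge_self hα hk hq
  have h3 : hK.supportPoint ν = (gauge K q)⁻¹ • q := by
    refine hK.supportPoint_eq hν (hK.compact.isClosed.frontier_subset
      (hK.inv_gauge_smul_mem_frontier hq)) fun z hz => ?_
    rw [real_inner_smul_right]
    have h4 := (h1 z).trans (hK.gauge_le_one_iff.2 hz)
    have h5 : c * ((gauge K q)⁻¹ * ⟪ν, q⟫_ℝ) = 1 := by
      rw [mul_left_comm, h2, inv_mul_cancel₀ hpos.ne']
    exact le_of_mul_le_mul_left (h4.trans h5.ge) hc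
  refine ⟨by rw [h3, smul_smul, mul_inv_cancel₀ hpos.ne', one_smul], ?_⟩
  rw [hK.polarGauge_eq_inner hν, h3, real_inner_smul_right, mul_inv, inv_inv, ← h2]
  have : ⟪ν, q⟫_ℝ ≠ 0 := by rintro h0; rw [h0, mul_zero] at h2; exact hpos.ne h2
  field_simp

/-- The map `M = γ Dγ` sends the support point of `w` to `w / γ°(w)`. Unlike `Dγ`, it has an
invertible derivative: the radial direction is seen by `Dγ ⊗ Dγ` and the tangential one by `D²γ`. So
the support point is a local inverse of `M` applied to a differentiable map. -/
theorem differentiableAt_supportPoint {ν : Plane} (hν : ν ≠ 0)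
    (hB : fderiv ℝ (fderiv ℝ (gauge K)) (hK.supportPoint ν) (perp ν) (perp ν) ≠ 0) :
    DifferentiableAt ℝ hK.supportPoint ν := by
  set P := hK.supportPoint ν with hP
  have hP0 := hK.supportPoint_ne_zero hν
  have hg := hK.contDiffAt_gauge hα hk hP0
  set M : Plane → (Plane →L[ℝ] ℝ) := fun q => gauge K q • fderiv ℝ (gauge K) q with hM
  have hMs : ContDiffAt ℝ 1 M P := (hg.of_le (by norm_num)).smul (hg.fderiv_right (by norm_num))
  have hMd : HasFDerivAt M _ P :=
    (hK.hasFDerivAt_gauge hα hk hP0).smul (hK.hasFDerivAt_fderiv_gauge hα hk hP0)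
  have hM' : ∀ v w, fderiv ℝ M P v w = fderiv ℝ (gauge K) P v * fderiv ℝ (gauge K) P w +
      fderiv ℝ (fderiv ℝ (gauge K)) P v w := by
    intro v w
    rw [hMd.fderiv]
    simp [hP, hK.gauge_supportPoint hν]
    ring
  have hinj : Function.Injective (fderiv ℝ M P).toLinearMap := by
    rw [← LinearMap.ker_eq_bot, LinearMap.ker_eq_bot']
    intro v hv
    have hv' : ∀ w, fderiv ℝ M P v w = 0 := fun w => by
      have : fderiv ℝ M P v = 0 := hv
      rw [this]; rfl
    have h1 := hv' P
    rw [hM', hK.fderiv_gauge_self hα hk hP0, hK.fderiv2_gauge_apply_self hα hk hP0,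
      hK.gauge_supportPoint hν, mul_one, add_zero, hK.fderiv_gauge_supportPoint hα hk hν] at h1
    have h2 : ⟪v, ν⟫_ℝ = 0 := by
      simp only [smul_apply, innerSL_apply_apply, smul_eq_mul, mul_eq_zero, inv_eq_zero,
        (hK.polarGauge_pos hν).ne', false_or] at h1
      rw [real_inner_comm]; exact h1
    have h3 := eq_smul_perp_of_inner_eq_zero hν h2
    have h4 := hv' (perp ν)
    rw [hM', hK.fderiv_gauge_supportPoint hα hk hν, h3] at h4
    simp only [map_smul, smul_apply, innerSL_apply_apply, inner_self_perp, smul_eq_mul, mul_zero,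
      zero_add, mul_eq_zero, hB, or_false] at h4
    rw [h3, h4, zero_smul]
  have hfin : Module.finrank ℝ Plane = Module.finrank ℝ (Plane →L[ℝ] ℝ) := by
    rw [← (LinearMap.toContinuousLinearMap : (Plane →ₗ[ℝ] ℝ) ≃ₗ[ℝ] _).finrank_eq]
    exact Subspace.dual_finrank_eq.symm
  set e := (LinearEquiv.ofInjectiveOfFinrankEq (fderiv ℝ M P).toLinearMap hinj
    hfin).toContinuousLinearEquiv with he
  have hMe : HasStrictFDerivAt M (e : Plane →L[ℝ] (Plane →L[ℝ] ℝ)) P := by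
    have : (e : Plane →L[ℝ] (Plane →L[ℝ] ℝ)) = fderiv ℝ M P := by ext v w; rfl
    rw [this]
    exact hMs.hasStrictFDerivAt (by norm_num)
  have hN := hMe.to_localInverse
  have hMP : ∀ w ≠ 0, M (hK.supportPoint w) = (polarGauge K w)⁻¹ • innerSL ℝ w := by
    intro w hw
    simp only [hM, hK.gauge_supportPoint hw, one_smul, hK.fderiv_gauge_supportPoint hα hk hw]
  have hev : hK.supportPoint =ᶠ[𝓝 ν]
      fun w => hMe.localInverse M e P ((polarGauge K w)⁻¹ • innerSL ℝ w) := by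
    filter_upwards [isOpen_ne.mem_nhds hν,
      (hK.continuousAt_supportPoint hν).eventually hMe.eventually_left_inverse] with w hw h1
    rw [← hMP w hw, h1]
  have hdiff : DifferentiableAt ℝ (fun w => (polarGauge K w)⁻¹ • innerSL ℝ w) ν :=
    ((hK.hasGradientAt_polarGauge hν).differentiableAt.inv (hK.polarGauge_pos hν).ne').smul
      (innerSL ℝ).differentiableAt
  refine DifferentiableAt.congr_of_eventuallyEq ?_ hev
  refine DifferentiableAt.comp (g := hMe.localInverse M e P) ν ?_ hdiff
  rw [← hMP ν hν]
  exact hN.hasFDerivAt.differentiableAt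

/-- Differentiate `Dγ(P(w)) = w / γ°(w)` and test with `perp ν`, which kills the derivative of the
scalar factor. Since `γ(P) = 1`, the derivative of `P` is tangential and is determined by this one
number. -/
theorem fderiv2_polarGauge {ν : Plane} (hν : ν ≠ 0)
    (hB : fderiv ℝ (fderiv ℝ (gauge K)) (hK.supportPoint ν) (perp ν) (perp ν) ≠ 0) (w : Plane) :
    fderiv ℝ (fderiv ℝ (polarGauge K)) ν w (perp ν) = ⟪w, perp ν⟫_ℝ * ‖ν‖ ^ 2 /
      (polarGauge K ν * fderiv ℝ (fderiv ℝ (gauge K)) (hK.supportPoint ν) (perp ν) (perp ν)) := by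
  set P := hK.supportPoint ν with hP
  have hP0 := hK.supportPoint_ne_zero hν
  have hh := hK.polarGauge_pos hν
  have hn : ‖ν‖ ^ 2 ≠ 0 := by positivity
  have hPd := (hK.differentiableAt_supportPoint hα hk hν hB).hasFDerivAt
  set P' := fderiv ℝ hK.supportPoint ν
  have hfd : fderiv ℝ (polarGauge K) =ᶠ[𝓝 ν] fun w => innerSL ℝ (hK.supportPoint w) := by
    filter_upwards [isOpen_ne.mem_nhds hν] with w hw
    exact (hK.hasGradientAt_polarGauge hw).hasFDerivAt.fderiv
  have h1 : HasFDerivAt (fun w => innerSL ℝ (hK.supportPoint w)) ((innerSL ℝ).comp P') ν :=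
    (innerSL ℝ).hasFDerivAt.comp ν hPd
  rw [hfd.fderiv_eq, h1.fderiv]
  change ⟪P' w, perp ν⟫_ℝ = _
  have h2 : ⟪P' w, ν⟫_ℝ = 0 := by
    have e1 : HasFDerivAt (fun w => gauge K (hK.supportPoint w))
        ((fderiv ℝ (gauge K) P).comp P') ν := (hK.hasFDerivAt_gauge hα hk hP0).comp ν hPd
    have e2 := e1.unique ((hasFDerivAt_const (1 : ℝ) ν).congr_of_eventuallyEq (by
      filter_upwards [isOpen_ne.mem_nhds hν] with w hw using hK.gauge_supportPoint hw))
    have e3 := DFunLike.congr_fun e2 w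
    rw [ContinuousLinearMap.comp_apply, hP, hK.fderiv_gauge_supportPoint hα hk hν] at e3
    simp only [smul_apply, innerSL_apply_apply, smul_eq_mul, zero_apply, mul_eq_zero, inv_eq_zero,
      hh.ne', false_or] at e3
    rw [real_inner_comm]; exact e3
  have h3 : fderiv ℝ (fderiv ℝ (gauge K)) P (P' w) (perp ν) =
      (polarGauge K ν)⁻¹ * ⟪w, perp ν⟫_ℝ := by
    have e1 : HasFDerivAt (fun w => fderiv ℝ (gauge K) (hK.supportPoint w))
        ((fderiv ℝ (fderiv ℝ (gauge K)) P).comp P') ν :=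
      (hK.hasFDerivAt_fderiv_gauge hα hk hP0).comp ν hPd
    have e2 := ((hasDerivAt_inv hh.ne').comp_hasFDerivAt ν
      (hK.hasGradientAt_polarGauge hν).hasFDerivAt).smul
      (innerSL ℝ (E := Plane)).hasFDerivAt
    have e3 := e1.unique (e2.congr_of_eventuallyEq (by
      filter_upwards [isOpen_ne.mem_nhds hν] with w hw
        using hK.fderiv_gauge_supportPoint hα hk hw))
    have e4 := DFunLike.congr_fun (DFunLike.congr_fun e3 w) (perp ν)
    have e5 : innerSL ℝ ν (perp ν) = 0 := inner_self_perp ν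
    have e6 : innerSL ℝ w (perp ν) = ⟪w, perp ν⟫_ℝ := rfl
    rw [← e6]
    simp only [ContinuousLinearMap.comp_apply, add_apply, smul_apply,
      ContinuousLinearMap.smulRight_apply, smul_eq_mul] at e4
    erw [e5, mul_zero, add_zero] at e4
    exact e4
  rw [eq_smul_perp_of_inner_eq_zero hν h2, map_smul, smul_apply, smul_eq_mul] at h3
  field_simp at h3 ⊢
  linear_combination h3

theorem normalK_eq (c : ℝ → Plane) {t : ℝ} (hν : leftNormal c t ≠ 0) :
    normalK K c t = hK.supportPoint (leftNormal c t) := hK.gradient_polarGauge hν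

/-- At the support point the gradient of `γ` is a positive multiple of `ν`, so up to positive
factors the curvature there is the Hessian of `γ` in direction `perp ν`. -/
theorem mem_flatNormals_iff {ν : Plane} (hν : ν ≠ 0) : ‖ν‖⁻¹ • ν ∈ flatNormals K ↔
    fderiv ℝ (fderiv ℝ (gauge K)) (hK.supportPoint ν) (perp ν) (perp ν) = 0 := by
  have hn : 0 < ‖ν‖ := norm_pos_iff.2 hν
  have hh := hK.polarGauge_pos hν
  have hgr : gradient (gauge K) (hK.supportPoint ν) = (polarGauge K ν)⁻¹ • ν := by
    refine ext_inner_right ℝ fun v => ?_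
    rw [inner_gradient, hK.fderiv_gauge_supportPoint hα hk hν]
    simp [real_inner_smul_left]
  have hcurv : bodyCurvature K (hK.supportPoint ν) = 0 ↔
      fderiv ℝ (fderiv ℝ (gauge K)) (hK.supportPoint ν) (perp ν) (perp ν) = 0 := by
    rw [bodyCurvature, levelCurvature, hgr, perp_smul, norm_smul]
    simp [hn.ne', hh.ne']
  rw [← hcurv]
  constructor
  · rintro ⟨-, p, hp, hp0, hmax⟩
    have : hK.supportPoint ν = p := by
      refine hK.supportPoint_eq hν (hK.compact.isClosed.frontier_subset hp) fun z hz => ?_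
      have := hmax z hz
      rw [real_inner_smul_left, inner_sub_right] at this
      have h2 := nonpos_of_mul_nonpos_right this (inv_pos.2 hn)
      linarith
    rwa [this]
  · intro h
    refine ⟨by rw [norm_smul, norm_inv, norm_norm, inv_mul_cancel₀ hn.ne'], hK.supportPoint ν,
      hK.supportPoint_mem_frontier hν, h, fun z hz => ?_⟩
    rw [real_inner_smul_left, inner_sub_right]
    have := hK.inner_le_supportPoint ν hz
    exact mul_nonpos_of_nonneg_of_nonpos (by positivity) (by linarith)

end Curvature

end AdmissibleBody

/-! ### Foot points on curves and one-sided projections. -/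

/-- The derivative of `u ↦ γ (z - e u)`. -/
noncomputable def distSlope (K : Set Plane) (e : ℝ → Plane) (z : Plane) (u : ℝ) : ℝ :=
  -(fderiv ℝ (gauge K) (z - e u) (deriv e u))

/-- `s z` is the parameter of the foot point of `z` on the curve `e`, for `z` near `x`. -/
def HasFoot (K : Set Plane) (e : ℝ → Plane) (x : Plane) (s : Plane → ℝ) : Prop :=
  s x = 0 ∧ ∃ δ > 0, ∀ᶠ z in 𝓝 x, ∀ u, |u| < δ →
    (u < s z → distSlope K e z u < 0) ∧ (s z < u → 0 < distSlope K e z u)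

/-- A locally Lipschitz projection, near `x`, to the part `S` of the curve `A` starting at `y` in
direction `v`. -/
def HasHalfProjection (K A S : Set Plane) (x y v : Plane) : Prop :=
  ∃ q : Plane → Plane, q x = y ∧
    ((fun p : Plane × Plane => q p.1 - q p.2) =O[𝓝 (x, x)] fun p => p.1 - p.2) ∧
    ∃ r > 0, ∀ᶠ z in 𝓝 x, q z ∈ A ∧
      (∀ w ∈ S ∩ Metric.ball y r, gauge K (z - q z) ≤ gauge K (z - w)) ∧
      (q z ≠ y → 0 < fderiv ℝ (gauge K) (z - y) v)

/-- The function decreases before `s` and increases after it, so it grows when moving away from `s`.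
The point `a` need not be `s`: this covers minimization over a half curve, whose minimizer is a
truncation of `s`. -/
theorem le_of_slope_sign {φ G : ℝ → ℝ} {s δ : ℝ} (hφ : ∀ u, |u| < δ → HasDerivAt φ (G u) u)
    (h1 : ∀ u, |u| < δ → u < s → G u ≤ 0) (h2 : ∀ u, |u| < δ → s < u → 0 ≤ G u) {a u : ℝ}
    (ha : |a| < δ) (hu : |u| < δ) (h : s ≤ a ∧ a ≤ u ∨ u ≤ a ∧ a ≤ s) : φ a ≤ φ u := by
  rw [abs_lt] at ha hu
  rcases h with ⟨hs, hau⟩ | ⟨hau, hs⟩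
  · have hin : ∀ w ∈ Icc a u, |w| < δ := fun w hw => by
      rw [abs_lt]; constructor <;> linarith [hw.1, hw.2]
    refine monotoneOn_of_deriv_nonneg (convex_Icc a u)
      (fun w hw => (hφ w (hin w hw)).continuousAt.continuousWithinAt) ?_ ?_
      (left_mem_Icc.2 hau) (right_mem_Icc.2 hau) hau
    · intro w hw
      rw [interior_Icc] at hw
      exact (hφ w (hin w (Ioo_subset_Icc_self hw))).differentiableAt.differentiableWithinAt
    · intro w hw
      rw [interior_Icc] at hw
      rw [(hφ w (hin w (Ioo_subset_Icc_self hw))).deriv]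
      exact h2 w (hin w (Ioo_subset_Icc_self hw)) (by linarith [hw.1])
  · have hin : ∀ w ∈ Icc u a, |w| < δ := fun w hw => by
      rw [abs_lt]; constructor <;> linarith [hw.1, hw.2]
    refine antitoneOn_of_deriv_nonpos (convex_Icc u a)
      (fun w hw => (hφ w (hin w hw)).continuousAt.continuousWithinAt) ?_ ?_
      (left_mem_Icc.2 hau) (right_mem_Icc.2 hau) hau
    · intro w hw
      rw [interior_Icc] at hw
      exact (hφ w (hin w (Ioo_subset_Icc_self hw))).differentiableAt.differentiableWithinAt
    · intro w hw
      rw [interior_Icc] at hw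
      rw [(hφ w (hin w (Ioo_subset_Icc_self hw))).deriv]
      exact h1 w (hin w (Ioo_subset_Icc_self hw)) (by linarith [hw.2])

namespace AdmissibleBody

variable {k : WithTop ℕ∞} {α : ℝ≥0} {K : Set Plane}
variable (hK : AdmissibleBody k α K) (hα : α ≤ 1) (hk : 2 ≤ k)
include hK hα hk

theorem hasDerivAt_gauge_sub {e : ℝ → Plane} {z : Plane} {u : ℝ} (he : DifferentiableAt ℝ e u)
    (hz : z - e u ≠ 0) : HasDerivAt (fun u => gauge K (z - e u)) (distSlope K e z u) u := by
  have := (hK.hasFDerivAt_gauge hα hk hz).comp_hasDerivAt u (he.hasDerivAt.const_sub z)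
  exact this.congr_deriv (by simp [distSlope])

theorem hasDerivAt_distSlope {e : ℝ → Plane} {z : Plane} {u : ℝ} (he : ContDiffAt ℝ 2 e u)
    (hz : z - e u ≠ 0) : HasDerivAt (fun u => distSlope K e z u)
      (fderiv ℝ (fderiv ℝ (gauge K)) (z - e u) (deriv e u) (deriv e u) -
        fderiv ℝ (gauge K) (z - e u) (deriv (deriv e) u)) u := by
  have h1 : HasDerivAt (fun u => z - e u) (-deriv e u) u :=
    (he.differentiableAt (by norm_num)).hasDerivAt.const_sub z
  have h2 := (hK.hasFDerivAt_fderiv_gauge hα hk hz).comp_hasDerivAt u h1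
  have h3 : HasDerivAt (deriv e) (deriv (deriv e) u) u := by
    have : ContDiffAt ℝ 1 (deriv e) u := by
      have h4 : ContDiffAt ℝ 1 (fderiv ℝ e) u := he.fderiv_right (by norm_num)
      exact h4.clm_apply contDiffAt_const
    exact (this.differentiableAt (by norm_num)).hasDerivAt
  have h4 := (h2.clm_apply h3).neg
  refine h4.congr_deriv ?_
  simp
  ring

theorem ckAlphaAround_distSlope {j : WithTop ℕ∞} (hj : 1 ≤ j) (hkj : k = j + 1) {e : ℝ → Plane}
    {x : Plane} {t : ℝ} (he : CkAlphaAround k α e t) (hx : x - e t ≠ 0) :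
    CkAlphaAround j α (fun p : Plane × ℝ => distSlope K e p.1 p.2) (x, t) := by
  subst hkj
  have hg := (hK.ckAlphaAround_gauge hα (le_trans (by norm_num) hk) hx).fderiv
  have hsnd : CkAlphaAround j α (fun p : Plane × ℝ => p.2) (x, t) :=
    CkAlphaAround.of_contDiff hα contDiff_snd
  have hfst : CkAlphaAround j α (fun p : Plane × ℝ => p.1) (x, t) :=
    CkAlphaAround.of_contDiff hα contDiff_fst
  have he1 : CkAlphaAround j α (fun p : Plane × ℝ => e p.2) (x, t) :=
    CkAlphaAround.comp (g := e) hα hj (he.of_le_one hα) hsnd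
  have hsub : CkAlphaAround j α (fun p : Plane × ℝ => p.1 - e p.2) (x, t) :=
    (hfst.add (he1.clm_comp hα (-ContinuousLinearMap.id ℝ Plane))).congr
      (Eventually.of_forall fun p => by simp [sub_eq_add_neg])
  have h1 : CkAlphaAround j α (fun p : Plane × ℝ => fderiv ℝ (gauge K) (p.1 - e p.2)) (x, t) :=
    CkAlphaAround.comp (g := fderiv ℝ (gauge K)) (f := fun p : Plane × ℝ => p.1 - e p.2) hα hj
      hg hsub
  have h2 : CkAlphaAround j α (fun p : Plane × ℝ => deriv e p.2) (x, t) := by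
    have h3 : CkAlphaAround j α (fun p : Plane × ℝ => fderiv ℝ e p.2) (x, t) :=
      CkAlphaAround.comp (g := fderiv ℝ e) hα hj he.fderiv hsnd
    exact h3.clm_comp hα (ContinuousLinearMap.apply ℝ Plane (1 : ℝ))
  exact (CkAlphaAround.bilin hα (-ContinuousLinearMap.id ℝ (Plane →L[ℝ] ℝ)) h1 h2).congr
    (Eventually.of_forall fun p => by simp [distSlope])

/-- The foot point on a curve at which the distance is nondegenerate. -/
theorem exists_foot {j : WithTop ℕ∞} (hj : 1 ≤ j) (hkj : k = j + 1) {e : ℝ → Plane} {x : Plane}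
    (he : CkAlphaAround k α e 0) (hx : x - e 0 ≠ 0) (h0 : distSlope K e x 0 = 0)
    (hpos : 0 < fderiv ℝ (fderiv ℝ (gauge K)) (x - e 0) (deriv e 0) (deriv e 0) -
      fderiv ℝ (gauge K) (x - e 0) (deriv (deriv e) 0)) :
    ∃ s : Plane → ℝ, CkAlphaAround j α s x ∧ HasFoot K e x s ∧
      ∀ᶠ z in 𝓝 x, distSlope K e z (s z) = 0 := by
  have hG := hK.ckAlphaAround_distSlope hα hk hj hkj he hx
  set G : Plane × ℝ → ℝ := fun p => distSlope K e p.1 p.2 with hGdef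
  have hG1 : ContDiffAt ℝ 1 G (x, 0) := hG.contDiffAt.of_le hj
  have hpart : ∀ p : Plane × ℝ, DifferentiableAt ℝ G p →
      HasDerivAt (fun u => distSlope K e p.1 u) (fderiv ℝ G p (0, 1)) p.2 := by
    intro p hp
    have h1 : HasDerivAt (fun u : ℝ => (p.1, u)) ((0 : Plane), (1 : ℝ)) p.2 :=
      (hasDerivAt_const p.2 p.1).prodMk (hasDerivAt_id p.2)
    exact HasFDerivAt.comp_hasDerivAt (f := fun u : ℝ => (p.1, u)) p.2 hp.hasFDerivAt h1
  -- The derivative of the slope in the parameter is the second derivative of the distance along the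
  -- curve, positive by assumption. It stays positive nearby, so the slope is strictly increasing in
  -- the parameter and changes sign only at the foot point.
  have hd : 0 < fderiv ℝ G (x, 0) (0, 1) := by
    have h1 := hpart (x, 0) (hG1.differentiableAt (by norm_num))
    rwa [h1.unique (hK.hasDerivAt_distSlope hα hk (he.contDiffAt.of_le hk) hx)]
  obtain ⟨s, hs0, hs, hGs⟩ := CkAlphaAround.exists_implicit hα hj hG hd.ne' h0
  refine ⟨s, hs, ⟨hs0, ?_⟩, hGs⟩
  have hdc : ContinuousAt (fun p => fderiv ℝ G p (0, 1)) (x, 0) :=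
    ((hG1.fderiv_right (m := 0) (by simp)).continuousAt).clm_apply continuousAt_const
  have hev : ∀ᶠ p in 𝓝 (x, (0 : ℝ)), 0 < fderiv ℝ G p (0, 1) ∧ DifferentiableAt ℝ G p :=
    (hdc.eventually (lt_mem_nhds hd)).and
      ((hG1.eventually (by simp)).mono fun p hp => hp.differentiableAt (by norm_num))
  obtain ⟨δ, hδ, hball⟩ := Metric.eventually_nhds_iff_ball.1 hev
  have hsc : ∀ᶠ z in 𝓝 x, |s z| < δ := by
    have := hs.contDiffAt.continuousAt.eventually (Metric.ball_mem_nhds (s x) hδ)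
    simpa [hs0, Metric.mem_ball, Real.dist_eq] using this
  refine ⟨δ, hδ, ?_⟩
  filter_upwards [hsc, hGs, Metric.ball_mem_nhds x hδ] with z h1 h2 h3 u hu
  have hmem : ∀ w ∈ Ioo (-δ) δ, (z, w) ∈ Metric.ball (x, (0 : ℝ)) δ := fun w hw => by
    rw [← ball_prod_same]
    exact ⟨h3, by simpa [Metric.mem_ball, Real.dist_eq, abs_lt] using hw⟩
  have hmono : StrictMonoOn (fun u => distSlope K e z u) (Ioo (-δ) δ) := by
    refine strictMonoOn_of_deriv_pos (convex_Ioo _ _) (fun w hw => ?_) fun w hw => ?_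
    · exact (hpart (z, w) (hball _ (hmem w hw)).2).continuousAt.continuousWithinAt
    · rw [interior_Ioo] at hw
      rw [(hpart (z, w) (hball _ (hmem w hw)).2).deriv]
      exact (hball _ (hmem w hw)).1
  constructor
  · intro h
    have h4 : distSlope K e z u < distSlope K e z (s z) := hmono (abs_lt.1 hu) (abs_lt.1 h1) h
    rwa [show distSlope K e z (s z) = 0 from h2] at h4
  · intro h
    have h4 : distSlope K e z (s z) < distSlope K e z u := hmono (abs_lt.1 h1) (abs_lt.1 hu) h
    rwa [show distSlope K e z (s z) = 0 from h2] at h4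

/-- The foot point on a line. -/
theorem exists_foot_line {j : WithTop ℕ∞} {x y v : Plane} (hx : x - y ≠ 0)
    (hv : v ≠ 0) (h0 : fderiv ℝ (gauge K) (x - y) v = 0) :
    ∃ s : Plane → ℝ, CkAlphaAround j α s x ∧ HasFoot K (fun u => y + u • v) x s := by
  set X := x - y with hX
  have hγX := hK.gauge_pos_iff.2 hx
  have hne : ⟪v, perp X⟫_ℝ ≠ 0 := by
    intro h
    have h1 := eq_smul_of_inner_perp_eq_zero hx h
    rw [h1, map_smul, hK.fderiv_gauge_self hα hk hx, smul_eq_mul, mul_eq_zero] at h0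
    rcases h0 with h0 | h0
    · rw [h0, zero_smul] at h1; exact hv h1
    · exact hγX.ne' h0
  -- Coordinate along `v` in the basis `X`, `v`. It is the foot parameter of every `z` for which `z
  -- - y` has a positive `X`-coordinate, so the radius `1` below is arbitrary.
  set L : Plane →L[ℝ] ℝ := (⟪v, perp X⟫_ℝ)⁻¹ • innerSL ℝ (perp X) with hL
  have hLv : L v = 1 := by
    simp only [hL, smul_apply, innerSL_apply_apply, smul_eq_mul, real_inner_comm v]
    exact inv_mul_cancel₀ hne
  have hLX : L X = 0 := by simp [hL]
  have hdec : ∀ w : Plane, w = (fderiv ℝ (gauge K) X w / gauge K X) • X + L w • v := by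
    intro w
    have h1 : ⟪w - L w • v, perp X⟫_ℝ = 0 := by
      rw [inner_sub_left, real_inner_smul_left]
      simp only [hL, smul_apply, innerSL_apply_apply, smul_eq_mul, real_inner_comm w]
      field_simp
      ring
    have h2 := eq_smul_of_inner_perp_eq_zero hx h1
    set b := ⟪w - L w • v, X⟫_ℝ / ‖X‖ ^ 2
    have h3 : w = b • X + L w • v := by rw [← h2]; abel
    have h4 : fderiv ℝ (gauge K) X w = b * gauge K X := by
      rw [h3, map_add, map_smul, map_smul, h0, hK.fderiv_gauge_self hα hk hx]; simp
    rw [h4, mul_div_cancel_right₀ _ hγX.ne']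
    exact h3
  refine ⟨fun z => L (z - y), CkAlphaAround.of_contDiff hα
    (L.contDiff.comp (contDiff_id.sub contDiff_const)), hLX, 1, one_pos, ?_⟩
  · have hapos : ∀ᶠ z in 𝓝 x, 0 < fderiv ℝ (gauge K) X (z - y) := by
      have hc : ContinuousAt (fun z => fderiv ℝ (gauge K) X (z - y)) x := by fun_prop
      refine hc.eventually (lt_mem_nhds ?_)
      change 0 < fderiv ℝ (gauge K) X X
      rw [hK.fderiv_gauge_self hα hk hx]; exact hγX
    filter_upwards [hapos] with z hz u _
    set a := fderiv ℝ (gauge K) X (z - y) / gauge K X with ha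
    have ha0 : 0 < a := div_pos hz hγX
    set w := L (z - y) - u with hw
    have hq : z - (y + u • v) = a • X + w • v := by
      have := hdec (z - y)
      rw [← ha] at this
      calc z - (y + u • v) = (z - y) - u • v := by abel
        _ = a • X + L (z - y) • v - u • v := by rw [← this]
        _ = _ := by rw [hw]; module
    have hder : deriv (fun u : ℝ => y + u • v) u = v := by
      have : HasDerivAt (fun u : ℝ => y + u • v) v u := by
        simpa using ((hasDerivAt_id u).smul_const v).const_add y
      exact this.deriv
    have hDq : fderiv ℝ (gauge K) X (a • X + w • v) = a * gauge K X := by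
      rw [map_add, map_smul, map_smul, h0, hK.fderiv_gauge_self hα hk hx]; simp
    have hq0 : a • X + w • v ≠ 0 := by
      intro h
      rw [h, map_zero] at hDq
      exact (mul_pos ha0 hγX).ne hDq
    -- Along the line through `a • X` in direction `v` the gauge is convex with minimum at `w = 0`.
    -- Were the minimum attained twice, two points of `K` would maximize the functional `Dγ(X)`,
    -- against strict convexity. No second derivative enters, so flat points are allowed.
    have key : w ≠ 0 → 0 < w * fderiv ℝ (gauge K) (a • X + w • v) v := by
      intro hw0
      have h1 := hK.fderiv_gauge_le hα hk hq0 (a • X)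
      have h2 : a • X = (a • X + w • v) - w • v := by abel
      nth_rewrite 2 [h2] at h1
      rw [map_sub, hK.fderiv_gauge_self hα hk hq0, map_smul, smul_eq_mul,
        hK.gauge_smul ha0.le] at h1
      have h3 := hK.fderiv_gauge_le hα hk hx (a • X + w • v)
      rw [hDq] at h3
      have h4 : a * gauge K X ≠ gauge K (a • X + w • v) := by
        intro heq
        have hpos : 0 < a * gauge K X := mul_pos ha0 hγX
        have hsup : ∀ p : Plane, p ≠ 0 → fderiv ℝ (gauge K) X p = gauge K p →
            ∀ z ∈ K, ⟪gradient (gauge K) X, z⟫_ℝ ≤ ⟪gradient (gauge K) X, (gauge K p)⁻¹ • p⟫_ℝ := by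
          intro p hp0 hp z hz
          rw [inner_gradient, inner_gradient, map_smul, hp, smul_eq_mul,
            inv_mul_cancel₀ (hK.gauge_pos_iff.2 hp0).ne']
          exact (hK.fderiv_gauge_le hα hk hx z).trans (hK.gauge_le_one_iff.2 hz)
        have hmem : ∀ p : Plane, p ≠ 0 → (gauge K p)⁻¹ • p ∈ K := fun p hp =>
          hK.compact.isClosed.frontier_subset (hK.inv_gauge_smul_mem_frontier hp)
        have h5 := hK.support_unique (hK.fderiv_gauge_ne_zero hα hk hx) (hmem X hx)
          (hsup X hx (hK.fderiv_gauge_self hα hk hx)) (hmem _ hq0)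
          (hsup _ hq0 (by rw [hDq, heq]))
        have h6 := congrArg L h5
        rw [map_smul, map_smul, map_add, map_smul, map_smul, hLX, hLv] at h6
        simp [hw0, (hK.gauge_pos_iff.2 hq0).ne'] at h6
      have h7 := lt_of_le_of_ne h3 h4
      linarith
    unfold distSlope
    rw [hder, hq]
    constructor
    · intro h
      have hw0 : 0 < w := by rw [hw]; linarith
      have := (pos_iff_pos_of_mul_pos (key hw0.ne')).1 hw0
      linarith
    · intro h
      have hw0 : w < 0 := by rw [hw]; linarith
      have := (neg_iff_neg_of_mul_pos (key hw0.ne)).1 hw0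
      linarith

/-- Closeness of the curve to its value at `0` makes the distance along it differentiable. -/
theorem eventually_hasDerivAt_gauge_sub {e : ℝ → Plane} {x : Plane} (he : ContDiffAt ℝ 1 e 0)
    (hx : x - e 0 ≠ 0) : ∃ δ > 0, ∀ᶠ z in 𝓝 x, ∀ u, |u| < δ →
      HasDerivAt (fun u => gauge K (z - e u)) (distSlope K e z u) u := by
  have h1 : ∀ᶠ u in 𝓝 (0 : ℝ), DifferentiableAt ℝ e u :=
    (he.eventually (by simp)).mono fun u hu => hu.differentiableAt (by norm_num)
  have hc : ContinuousAt (fun p : Plane × ℝ => p.1 - e p.2) (x, 0) :=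
    continuousAt_fst.sub (ContinuousAt.comp (g := e) he.continuousAt continuousAt_snd)
  have h2 : ∀ᶠ p in 𝓝 (x, (0 : ℝ)), p.1 - e p.2 ≠ 0 ∧ DifferentiableAt ℝ e p.2 :=
    (hc.eventually (isOpen_ne.mem_nhds hx)).and (continuousAt_snd.eventually h1)
  obtain ⟨δ, hδ, hball⟩ := Metric.eventually_nhds_iff_ball.1 h2
  refine ⟨δ, hδ, ?_⟩
  filter_upwards [Metric.ball_mem_nhds x hδ] with z hz u hu
  have hmem : (z, u) ∈ Metric.ball (x, (0 : ℝ)) δ := by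
    rw [← ball_prod_same]
    exact ⟨hz, by simpa [Metric.mem_ball, Real.dist_eq] using hu⟩
  exact hK.hasDerivAt_gauge_sub hα hk (hball _ hmem).2 (hball _ hmem).1

theorem _root_.HasFoot.le {e : ℝ → Plane} {x : Plane} {s : Plane → ℝ} (h : HasFoot K e x s)
    (he : ContDiffAt ℝ 1 e 0) (hx : x - e 0 ≠ 0) :
    ∃ δ > 0, ∀ᶠ z in 𝓝 x, ∀ a u, |a| < δ → |u| < δ → (s z ≤ a ∧ a ≤ u ∨ u ≤ a ∧ a ≤ s z) →
      gauge K (z - e a) ≤ gauge K (z - e u) := by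
  obtain ⟨-, δ₁, hδ₁, h1⟩ := h
  obtain ⟨δ₂, hδ₂, h2⟩ := hK.eventually_hasDerivAt_gauge_sub hα hk he hx
  refine ⟨min δ₁ δ₂, lt_min hδ₁ hδ₂, ?_⟩
  filter_upwards [h1, h2] with z h1 h2 a u ha hu hau
  exact le_of_slope_sign (fun u hu => h2 u (hu.trans_le (min_le_right _ _)))
    (fun u hu h => ((h1 u (hu.trans_le (min_le_left _ _))).1 h).le)
    (fun u hu h => ((h1 u (hu.trans_le (min_le_left _ _))).2 h).le) ha hu hau

/-- The foot parameter on the half curve is `max (s z) 0`, and truncation keeps it Lipschitz. If it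
is positive, the slope at `0` is negative, that is `Dγ(z - y) v > 0`; at a corner this clause
prevents both arcs from moving the foot point. -/
theorem hasHalfProjection_of_foot {e : ℝ → Plane} {x y v : Plane} {s : Plane → ℝ} {A S : Set Plane}
    (h : HasFoot K e x s) (he : ContDiffAt ℝ 1 e 0) (hey : e 0 = y) (hx : x ≠ y)
    (hs : ContDiffAt ℝ 1 s x) (hA : ∀ᶠ u in 𝓝[≥] (0 : ℝ), e u ∈ A)
    (hS : ∀ δ > 0, ∃ r > 0, ∀ w ∈ S ∩ Metric.ball y r, ∃ u ∈ Ico 0 δ, w = e u)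
    {c : ℝ} (hc : 0 < c) (hv : deriv e 0 = c • v) : HasHalfProjection K A S x y v := by
  subst hey
  have hx' : x - e 0 ≠ 0 := sub_ne_zero.2 hx
  obtain ⟨δ, hδ, hle⟩ := h.le hK hα hk he hx'
  obtain ⟨hs0, δ₁, hδ₁, hsign⟩ := h
  obtain ⟨r, hr, hSr⟩ := hS δ hδ
  have hmax : Tendsto (fun z => max (s z) 0) (𝓝 x) (𝓝 0) := by
    have := hs.continuousAt.max (continuousAt_const (y := (0 : ℝ)))
    simpa [ContinuousAt, hs0] using this
  refine ⟨fun z => e (max (s z) 0), by simp [hs0], ?_, r, hr, ?_⟩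
  · have h1 : Tendsto (fun p : Plane × Plane => (max (s p.1) 0, max (s p.2) 0)) (𝓝 (x, x))
        (𝓝 ((0 : ℝ), (0 : ℝ))) :=
      (hmax.comp (tendsto_fst_nhds_diag x)).prodMk_nhds (hmax.comp (tendsto_snd_nhds_diag x))
    refine ((he.isBigO_sub_diag le_rfl).comp_tendsto h1).trans ?_
    refine (Asymptotics.IsBigO.of_bound 1 (Eventually.of_forall fun p => ?_)).trans
      (hs.isBigO_sub_diag le_rfl)
    simp only [Function.comp_apply, one_mul, Real.norm_eq_abs]
    exact abs_max_sub_max_le_abs _ _ _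
  · have hmax' : Tendsto (fun z => max (s z) 0) (𝓝 x) (𝓝[≥] 0) :=
      tendsto_nhdsWithin_iff.2 ⟨hmax, Eventually.of_forall fun z => mem_Ici.2 (le_max_right _ _)⟩
    have hsm : ∀ᶠ z in 𝓝 x, |max (s z) 0| < δ := by
      have := hmax.eventually (Metric.ball_mem_nhds (0 : ℝ) hδ)
      simpa [Metric.mem_ball, Real.dist_eq] using this
    filter_upwards [hmax'.eventually hA, hle, hsm, hsign] with z h1 h2 h3 h4
    refine ⟨h1, fun w hw => ?_, fun hne => ?_⟩
    · obtain ⟨u, hu, rfl⟩ := hSr w hw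
      refine h2 _ _ h3 (by rw [abs_of_nonneg hu.1]; exact hu.2) ?_
      rcases le_total (s z) 0 with hs | hs
      · left; rw [max_eq_right hs]; exact ⟨hs, hu.1⟩
      · rw [max_eq_left hs]
        rcases le_total (s z) u with h | h
        · left; exact ⟨le_rfl, h⟩
        · right; exact ⟨h, le_rfl⟩
    · have hsz : 0 < s z := by
        by_contra hcon
        exact hne (by rw [max_eq_right (not_lt.1 hcon)])
      have h5 := (h4 0 (by simpa using hδ₁)).1 hsz
      unfold distSlope at h5
      rw [hv, map_smul, smul_eq_mul] at h5
      have h6 : 0 < c * fderiv ℝ (gauge K) (z - e 0) v := by linarith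
      exact (pos_iff_pos_of_mul_pos h6).1 hc

/-- Here the distance has a positive slope at `y` along the half curve. By continuity the slope is
positive for nearby points and parameters, so `y` itself is the projection. -/
theorem hasHalfProjection_of_neg {e : ℝ → Plane} {x y v : Plane} {A S : Set Plane}
    (he : ContDiffAt ℝ 1 e 0) (hey : e 0 = y) (hx : x ≠ y) (hA : y ∈ A)
    (hS : ∀ δ > 0, ∃ r > 0, ∀ w ∈ S ∩ Metric.ball y r, ∃ u ∈ Ico 0 δ, w = e u)
    {c : ℝ} (hc : 0 < c) (hv : deriv e 0 = c • v) (hneg : fderiv ℝ (gauge K) (x - y) v < 0) :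
    HasHalfProjection K A S x y v ∧ ∃ r > 0, ∀ᶠ z in 𝓝 x, ∀ w ∈ S ∩ Metric.ball y r,
      gauge K (z - y) ≤ gauge K (z - w) := by
  subst hey
  have hx' : x - e 0 ≠ 0 := sub_ne_zero.2 hx
  suffices h : ∃ r > 0, ∀ᶠ z in 𝓝 x, ∀ w ∈ S ∩ Metric.ball (e 0) r,
      gauge K (z - e 0) ≤ gauge K (z - w) by
    refine ⟨⟨fun _ => e 0, rfl, ?_, ?_⟩, h⟩
    · simp only [sub_self]; exact Asymptotics.isBigO_zero _ _
    · obtain ⟨r, hr, h⟩ := h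
      exact ⟨r, hr, h.mono fun z hz => ⟨hA, hz, fun h => (h rfl).elim⟩⟩
  obtain ⟨δ₁, hδ₁, hder⟩ := hK.eventually_hasDerivAt_gauge_sub hα hk he hx'
  have hcont : ContinuousAt (fun p : Plane × ℝ => distSlope K e p.1 p.2) (x, 0) := by
    have hfc : ContinuousAt (fderiv ℝ (gauge K)) (x - e 0) :=
      (hK.hasFDerivAt_fderiv_gauge hα hk hx').continuousAt
    have hdc : ContinuousAt (deriv e) 0 :=
      ((he.fderiv_right (m := 0) (by simp)).continuousAt).clm_apply continuousAt_const
    have h1 : ContinuousAt (fun p : Plane × ℝ => p.1 - e p.2) (x, 0) :=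
      continuousAt_fst.sub (ContinuousAt.comp (g := e) he.continuousAt continuousAt_snd)
    have h2 : ContinuousAt (fun p : Plane × ℝ => fderiv ℝ (gauge K) (p.1 - e p.2)) (x, 0) :=
      ContinuousAt.comp (g := fderiv ℝ (gauge K)) (f := fun p : Plane × ℝ => p.1 - e p.2) hfc h1
    exact (h2.clm_apply (ContinuousAt.comp (g := deriv e) hdc continuousAt_snd)).neg
  have hpos : 0 < distSlope K e x 0 := by
    unfold distSlope
    rw [hv, map_smul, smul_eq_mul]
    have := mul_neg_of_pos_of_neg hc hneg
    linarith
  obtain ⟨δ₂, hδ₂, hball⟩ := Metric.eventually_nhds_iff_ball.1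
    (hcont.eventually (lt_mem_nhds hpos))
  obtain ⟨r, hr, hSr⟩ := hS (min δ₁ δ₂) (lt_min hδ₁ hδ₂)
  refine ⟨r, hr, ?_⟩
  filter_upwards [hder, Metric.ball_mem_nhds x hδ₂] with z h1 h2 w hw
  obtain ⟨u, hu, rfl⟩ := hSr w hw
  -- With `s` at the left end of the interval of parameters, the condition before `s` is vacuous.
  refine le_of_slope_sign (s := -(min δ₁ δ₂)) (δ := min δ₁ δ₂)
    (fun u hu => h1 u (hu.trans_le (min_le_left _ _)))
    (fun u hu h => absurd (abs_lt.1 hu).1 (not_lt.2 h.le)) (fun u hu _ => ?_)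
    (by simpa using ⟨hδ₁, hδ₂⟩) (by rw [abs_of_nonneg hu.1]; exact hu.2)
    (Or.inl ⟨by simpa using ⟨hδ₁.le, hδ₂.le⟩, hu.1⟩)
  have hmem : (z, u) ∈ Metric.ball (x, (0 : ℝ)) δ₂ := by
    rw [← ball_prod_same]
    exact ⟨h2, by simpa [Metric.mem_ball, Real.dist_eq] using hu.trans_le (min_le_right _ _)⟩
  exact (hball _ hmem).le

end AdmissibleBody

/-- Half projections on the two sides of a corner combine to a projection. -/
theorem HasHalfProjection.combine {K A S₁ S₂ : Set Plane} {x y v₁ v₂ : Plane}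
    (h₁ : HasHalfProjection K A S₁ x y v₁) (h₂ : HasHalfProjection K A S₂ x y v₂)
    (hA : ∃ r > 0, A ∩ Metric.ball y r ⊆ S₁ ∪ S₂) (hy₁ : y ∈ S₁) (hy₂ : y ∈ S₂)
    (hex : ∀ᶠ z in 𝓝 x, ¬ (0 < fderiv ℝ (gauge K) (z - y) v₁ ∧
      0 < fderiv ℝ (gauge K) (z - y) v₂)) :
    ∃ q : Plane → Plane, q x = y ∧
      ((fun p : Plane × Plane => q p.1 - q p.2) =O[𝓝 (x, x)] fun p => p.1 - p.2) ∧
      ∃ r > 0, ∀ᶠ z in 𝓝 x, q z ∈ A ∧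
        ∀ w ∈ A ∩ Metric.ball y r, gauge K (z - q z) ≤ gauge K (z - w) := by
  obtain ⟨q₁, hq₁, hL₁, r₁, hr₁, h₁⟩ := h₁
  obtain ⟨q₂, hq₂, hL₂, r₂, hr₂, h₂⟩ := h₂
  obtain ⟨r, hr, hA⟩ := hA
  -- One of the two projections is always `y`, so the sum is the other one; written as a sum it is
  -- Lipschitz without a case distinction in `z`.
  refine ⟨fun z => q₁ z + q₂ z - y, by simp [hq₁, hq₂], ?_, min r (min r₁ r₂),
    lt_min hr (lt_min hr₁ hr₂), ?_⟩
  · refine (hL₁.add hL₂).congr_left fun p => ?_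
    simp only; abel
  · filter_upwards [h₁, h₂, hex] with z e₁ e₂ hz
    have hcase : q₁ z = y ∨ q₂ z = y := by
      by_contra hcon
      push Not at hcon
      exact hz ⟨e₁.2.2 hcon.1, e₂.2.2 hcon.2⟩
    have hw₁ : ∀ w ∈ A ∩ Metric.ball y (min r (min r₁ r₂)), w ∈ S₁ ∩ Metric.ball y r₁ ∨
        w ∈ S₂ ∩ Metric.ball y r₂ := by
      intro w hw
      have hb := Metric.mem_ball.1 hw.2
      rw [lt_min_iff, lt_min_iff] at hb
      exact (hA ⟨hw.1, Metric.mem_ball.2 hb.1⟩).imp (fun h => ⟨h, Metric.mem_ball.2 hb.2.1⟩)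
        fun h => ⟨h, Metric.mem_ball.2 hb.2.2⟩
    have hy₁' : y ∈ S₁ ∩ Metric.ball y r₁ := ⟨hy₁, Metric.mem_ball_self hr₁⟩
    have hy₂' : y ∈ S₂ ∩ Metric.ball y r₂ := ⟨hy₂, Metric.mem_ball_self hr₂⟩
    rcases hcase with h | h
    · have hq : q₁ z + q₂ z - y = q₂ z := by rw [h]; abel
      rw [hq]
      refine ⟨e₂.1, fun w hw => ?_⟩
      rcases hw₁ w hw with hw | hw
      · refine (e₂.2.1 y hy₂').trans ?_
        have := e₁.2.1 w hw
        rwa [h] at this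
      · exact e₂.2.1 w hw
    · have hq : q₁ z + q₂ z - y = q₁ z := by rw [h]; abel
      rw [hq]
      refine ⟨e₁.1, fun w hw => ?_⟩
      rcases hw₁ w hw with hw | hw
      · exact e₁.2.1 w hw
      · refine (e₁.2.1 y hy₁').trans ?_
        have := e₂.2.1 w hw
        rwa [h] at this

/-- A local projection near the unique closest point is a global one. -/
theorem AdmissibleBody.eventually_distK_eq {k : WithTop ℕ∞} {α : ℝ≥0} {K U : Set Plane}
    (hK : AdmissibleBody k α K) (hU : Bornology.IsBounded U) {x y : Plane}
    (hcl : IsClosestPoint K U x y) (huniq : ∀ w, IsClosestPoint K U x w → w = y)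
    {q : Plane → Plane} (hqx : q x = y) (hq : ContinuousAt q x) {r : ℝ} (hr : 0 < r)
    (h : ∀ᶠ z in 𝓝 x, q z ∈ frontier U ∧
      ∀ w ∈ frontier U ∩ Metric.ball y r, gauge K (z - q z) ≤ gauge K (z - w)) :
    ∀ᶠ z in 𝓝 x, distK K U z = gauge K (z - q z) ∧ q z ∈ frontier U ∧
      ∀ w ∈ frontier U, gauge K (z - q z) ≤ gauge K (z - w) := by
  have hcomp : IsCompact (frontier U \ Metric.ball y r) :=
    (Metric.isCompact_of_isClosed_isBounded isClosed_frontier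
      (hU.closure.subset frontier_subset_closure)).diff Metric.isOpen_ball
  -- Away from `y` the boundary is compact and contains no closest point, which leaves a gap. The
  -- gap persists for `z` near `x` by `γ(x - w) ≤ γ(x - z) + γ(z - w)`; `γ` need not be symmetric,
  -- so the order of `x` and `z` matters.
  have hm : ∃ m, gauge K (x - y) < m ∧ ∀ w ∈ frontier U \ Metric.ball y r,
      m ≤ gauge K (x - w) := by
    rcases (frontier U \ Metric.ball y r).eq_empty_or_nonempty with he | hne
    · exact ⟨gauge K (x - y) + 1, by linarith, by simp [he]⟩
    · obtain ⟨w, hw, hmin⟩ := hcomp.exists_isMinOn hne (f := fun w => gauge K (x - w))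
        (hK.continuous_gauge.comp (continuous_const.sub continuous_id)).continuousOn
      refine ⟨gauge K (x - w), lt_of_le_of_ne (hcl.2 w hw.1) fun heq => ?_, fun w' hw' => hmin hw'⟩
      have : w = y := huniq w ⟨hw.1, fun w' hw' => heq ▸ hcl.2 w' hw'⟩
      exact hw.2 (this ▸ Metric.mem_ball_self hr)
  obtain ⟨m, hm1, hm2⟩ := hm
  have ht : Tendsto (fun z => gauge K (z - q z) + gauge K (x - z)) (𝓝 x)
      (𝓝 (gauge K (x - y))) := by
    have : ContinuousAt (fun z => gauge K (z - q z) + gauge K (x - z)) x :=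
      (ContinuousAt.comp (g := gauge K) hK.continuous_gauge.continuousAt
        (continuousAt_id.sub hq)).add (ContinuousAt.comp (g := gauge K)
        hK.continuous_gauge.continuousAt (continuousAt_const.sub continuousAt_id))
    simpa [ContinuousAt, hqx] using this
  filter_upwards [h, ht.eventually (gt_mem_nhds hm1)] with z h1 h2
  have hall : ∀ w ∈ frontier U, gauge K (z - q z) ≤ gauge K (z - w) := by
    intro w hw
    by_cases hwb : w ∈ Metric.ball y r
    · exact h1.2 w ⟨hw, hwb⟩
    · have h3 := hm2 w ⟨hw, hwb⟩
      have h4 := hK.gauge_add_le (x - z) (z - w)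
      rw [sub_add_sub_cancel] at h4
      linarith
  refine ⟨?_, h1.1, hall⟩
  refine IsLeast.csInf_eq ⟨⟨q z, h1.1, rfl⟩, ?_⟩
  rintro _ ⟨w, hw, rfl⟩
  exact hall w hw

/-! ### First and second variation at a closest point. -/

theorem IsPreconnected.subset_of_disjoint_frontier {X : Type} [TopologicalSpace X] {U S : Set X}
    (hU : IsOpen U) (hS : IsPreconnected S) (hd : ∀ z ∈ S, z ∉ frontier U)
    (hx : (S ∩ U).Nonempty) : S ⊆ U := by
  refine hS.subset_left_of_subset_union hU isClosed_closure.isOpen_compl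
    (disjoint_compl_right.mono_left subset_closure |>.mono_right le_rfl) (fun z hz => ?_) hx
  by_cases h : z ∈ U
  · exact Or.inl h
  · refine Or.inr fun hc => hd z hz ?_
    rw [hU.frontier_eq]
    exact ⟨hc, h⟩

/-- A one-sided minimum is enough because the first derivative vanishes: if `c` were negative, `G`
would be negative and `φ` strictly decreasing to the right of `0`. One-sidedness is what makes it
applicable at corners. -/
theorem second_deriv_nonneg_of_min {φ G : ℝ → ℝ} {c : ℝ}
    (hφ : ∀ᶠ u in 𝓝 0, HasDerivAt φ (G u) u) (hG0 : G 0 = 0) (hG : HasDerivAt G c 0)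
    (hmin : ∀ᶠ u in 𝓝[>] 0, φ 0 ≤ φ u) : 0 ≤ c := by
  by_contra hc
  push Not at hc
  have h1 := (hasDerivAt_iff_tendsto_slope_zero.1 hG).mono_left (nhdsGT_le_nhdsNE 0)
  have h2 : ∀ᶠ u in 𝓝[>] (0 : ℝ), G u < 0 := by
    filter_upwards [h1.eventually (gt_mem_nhds hc), self_mem_nhdsWithin] with u h2 h3
    simp only [zero_add, hG0, sub_zero, smul_eq_mul] at h2
    exact neg_of_mul_neg_right h2 (inv_nonneg.2 (le_of_lt h3))
  obtain ⟨δ₁, hδ₁, h3⟩ := Metric.eventually_nhds_iff_ball.1 hφ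
  obtain ⟨δ₂, hδ₂, h4⟩ := mem_nhdsGT_iff_exists_Ioo_subset.1 (h2.and hmin)
  rw [mem_Ioi] at hδ₂
  set u := min δ₁ δ₂ / 2 with hu
  have hm : 0 < min δ₁ δ₂ := lt_min hδ₁ hδ₂
  have hu0 : 0 < u := by positivity
  have hu1 : u < δ₁ := by have := min_le_left δ₁ δ₂; linarith
  have hu2 : u < δ₂ := by have := min_le_right δ₁ δ₂; linarith
  have hd : ∀ w ∈ Icc 0 u, HasDerivAt φ (G w) w := fun w hw => h3 w (by
    rw [Metric.mem_ball, Real.dist_eq, sub_zero, abs_of_nonneg hw.1]; linarith [hw.2])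
  have := strictAntiOn_of_deriv_neg (convex_Icc 0 u)
    (fun w hw => (hd w hw).continuousAt.continuousWithinAt) (fun w hw => by
      rw [interior_Icc] at hw
      rw [(hd w (Ioo_subset_Icc_self hw)).deriv]
      exact (h4 ⟨hw.1, hw.2.trans hu2⟩).1) (left_mem_Icc.2 hu0.le) (right_mem_Icc.2 hu0.le) hu0
  exact absurd (h4 ⟨hu0, hu2⟩).2 (not_le.2 this)

theorem first_deriv_nonneg_of_min {φ : ℝ → ℝ} {c : ℝ} (hφ : HasDerivAt φ c 0)
    (hmin : ∀ᶠ u in 𝓝[>] 0, φ 0 ≤ φ u) : 0 ≤ c := by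
  have h1 := (hasDerivAt_iff_tendsto_slope_zero.1 hφ).mono_left (nhdsGT_le_nhdsNE 0)
  refine ge_of_tendsto h1 ?_
  filter_upwards [hmin, self_mem_nhdsWithin] with u h2 h3
  rw [smul_eq_mul, zero_add]
  exact mul_nonneg (inv_nonneg.2 (le_of_lt h3)) (sub_nonneg.2 h2)

section CurveNormals

variable {c : ℝ → Plane} {t : ℝ}

theorem deriv_leftNormal (hc : ContDiffAt ℝ 2 c t) :
    deriv (leftNormal c) t = perp (deriv (deriv c) t) := by
  have : ContDiffAt ℝ 1 (deriv c) t := by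
    have h4 : ContDiffAt ℝ 1 (fderiv ℝ c) t := hc.fderiv_right (by norm_num)
    exact h4.clm_apply contDiffAt_const
  exact (perpCLM.hasFDerivAt.comp_hasDerivAt t
    (this.differentiableAt (by norm_num)).hasDerivAt).deriv

theorem perp_leftNormal : perp (leftNormal c t) = -deriv c t := by simp [leftNormal]

theorem leftNormal_ne_zero (h : deriv c t ≠ 0) : leftNormal c t ≠ 0 := perp_ne_zero h

theorem curveCurvature_eq (hc : ContDiffAt ℝ 2 c t) :
    curveCurvature c t = ⟪deriv (deriv c) t, leftNormal c t⟫_ℝ / ‖leftNormal c t‖ ^ 3 := by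
  rw [curveCurvature, deriv_leftNormal hc, inner_perp_perp]

theorem contDiffAt_reparam {n : WithTop ℕ∞} {ε : ℝ} (hc : ContDiffAt ℝ n c t) :
    ContDiffAt ℝ n (fun u => c (t + ε * u)) 0 :=
  ContDiffAt.comp (g := c) (f := fun u : ℝ => t + ε * u) 0 (by simpa using hc)
    (contDiff_const.add (contDiff_const.mul contDiff_id)).contDiffAt

theorem hasDerivAt_reparam {ε u : ℝ} (hc : DifferentiableAt ℝ c (t + ε * u)) :
    HasDerivAt (fun u => c (t + ε * u)) (ε • deriv c (t + ε * u)) u := by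
  have h3 : HasDerivAt (fun u : ℝ => t + ε * u) ε u := by
    simpa using ((hasDerivAt_id u).const_mul ε).const_add t
  exact hc.hasDerivAt.scomp u h3

theorem deriv_reparam {ε : ℝ} (hc : DifferentiableAt ℝ c t) :
    deriv (fun u => c (t + ε * u)) 0 = ε • deriv c t := by
  simpa using (hasDerivAt_reparam (ε := ε) (u := 0) (t := t) (by simpa using hc)).deriv

/-- With `ε = 1` or `ε = -1` either end of an arc becomes the parameter `0` of a curve running into
the arc. Reversal changes the sign of the velocity, not of the acceleration. -/
theorem deriv_deriv_reparam {ε : ℝ} (hε : ε * ε = 1) (hc : ContDiffAt ℝ 2 c t) :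
    deriv (deriv fun u => c (t + ε * u)) 0 = deriv (deriv c) t := by
  have hde : (deriv fun u => c (t + ε * u)) =ᶠ[𝓝 0] fun u => ε • deriv c (t + ε * u) := by
    have ht : Tendsto (fun u : ℝ => t + ε * u) (𝓝 0) (𝓝 t) :=
      Continuous.tendsto' (by fun_prop) _ _ (by simp)
    filter_upwards [ht.eventually (hc.eventually (by simp))] with u hu
    exact (hasDerivAt_reparam (hu.differentiableAt (by norm_num))).deriv
  have h4 : ContDiffAt ℝ 1 (deriv c) t :=
    ContDiffAt.clm_apply (hc.fderiv_right (m := 1) (by norm_num)) contDiffAt_const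
  have h6 := (hasDerivAt_reparam (c := deriv c) (t := t) (ε := ε) (u := 0)
    (by simpa using h4.differentiableAt (by norm_num))).const_smul ε
  rw [hde.deriv_eq]
  refine (h6.congr_deriv ?_).deriv
  rw [smul_smul, hε, one_smul, mul_zero, add_zero]

end CurveNormals

namespace AdmissibleBody

variable {k : WithTop ℕ∞} {α : ℝ≥0} {K : Set Plane}
variable (hK : AdmissibleBody k α K) (hα : α ≤ 1) (hk : 2 ≤ k)
include hK hα hk

/-- The second derivative of the distance to `x` along the curve `c`. -/
theorem second_derivative_eq {c : ℝ → Plane} {t l : ℝ} {x : Plane} (hc : ContDiffAt ℝ 2 c t)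
    (hc0 : deriv c t ≠ 0) (hx : x - c t ≠ 0) (hl : 0 < l)
    (hp : fderiv ℝ (gauge K) (x - c t) = l • innerSL ℝ (leftNormal c t)) :
    (unitNormal c t ∉ flatNormals K →
      fderiv ℝ (fderiv ℝ (gauge K)) (x - c t) (deriv c t) (deriv c t) ≠ 0 ∧
      fderiv ℝ (fderiv ℝ (gauge K)) (x - c t) (deriv c t) (deriv c t) -
        fderiv ℝ (gauge K) (x - c t) (deriv (deriv c) t) =
      fderiv ℝ (fderiv ℝ (gauge K)) (x - c t) (deriv c t) (deriv c t) *
        (1 - curvatureK K c t * gauge K (x - c t))) ∧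
    (unitNormal c t ∈ flatNormals K →
      fderiv ℝ (fderiv ℝ (gauge K)) (x - c t) (deriv c t) (deriv c t) = 0 ∧
      fderiv ℝ (gauge K) (x - c t) (deriv (deriv c) t) =
        curveCurvature c t * ‖leftNormal c t‖ ^ 3 / polarGauge K (leftNormal c t)) := by
  set ν := leftNormal c t with hν
  have hν0 : ν ≠ 0 := leftNormal_ne_zero hc0
  have hn : ‖ν‖ ≠ 0 := norm_ne_zero_iff.2 hν0
  have hh := hK.polarGauge_pos hν0
  have hd := hK.gauge_pos_iff.2 hx
  obtain ⟨hxP, hl'⟩ := hK.eq_smul_supportPoint hα hk hx hν0 hl hp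
  set B := fderiv ℝ (fderiv ℝ (gauge K)) (hK.supportPoint ν) (perp ν) (perp ν) with hB
  -- The Hessian of `γ` is homogeneous of degree `-1`, and `x - c t` is `γ(x - c t)` times the
  -- support point.
  have hD2 : fderiv ℝ (fderiv ℝ (gauge K)) (x - c t) (deriv c t) (deriv c t) =
      B / gauge K (x - c t) := by
    have h1 := hK.fderiv2_gauge_smul hα hk hd (hK.supportPoint_ne_zero hν0)
    rw [← hxP] at h1
    rw [hB, ← h1, perp_leftNormal]
    simp
    field_simp
  have hD1 : fderiv ℝ (gauge K) (x - c t) (deriv (deriv c) t) =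
      ⟪deriv (deriv c) t, ν⟫_ℝ / polarGauge K ν := by
    rw [hp, hl', real_inner_comm]
    simp
    field_simp
  refine ⟨fun hflat => ?_, fun hflat => ?_⟩
  · have hB0 : B ≠ 0 := fun h => hflat ((hK.mem_flatNormals_iff hα hk hν0).2 h)
    have hκ : curvatureK K c t = ⟪deriv (deriv c) t, ν⟫_ℝ / (polarGauge K ν * B) := by
      rw [curvatureK, if_neg hflat, deriv_leftNormal hc, ← hν,
        hK.fderiv2_polarGauge hα hk hν0 hB0, inner_perp_perp, ← hB]
      field_simp
    rw [hD2, hD1, hκ]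
    refine ⟨div_ne_zero hB0 hd.ne', ?_⟩
    field_simp
  · have hB0 : B = 0 := (hK.mem_flatNormals_iff hα hk hν0).1 hflat
    rw [hD2, hB0, zero_div, hD1, curveCurvature_eq hc]
    refine ⟨rfl, ?_⟩
    rw [← hν]
    field_simp

/-- At a one-sided closest point the distance is nondegenerate, unless the normal is flat and the
curvature is nonpositive. -/
theorem second_derivative_pos_or_flat {c : ℝ → Plane} {t l ε : ℝ} {x : Plane}
    (hε : ε = 1 ∨ ε = -1) (hc : ContDiffAt ℝ 2 c t)
    (hc0 : deriv c t ≠ 0) (hx : x - c t ≠ 0) (hl : 0 < l)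
    (hp : fderiv ℝ (gauge K) (x - c t) = l • innerSL ℝ (leftNormal c t))
    (hmin : ∀ᶠ u in 𝓝[>] (0 : ℝ), gauge K (x - c t) ≤ gauge K (x - c (t + ε * u)))
    (hκ : curvatureK K c t * gauge K (x - c t) ≠ 1) :
    (unitNormal c t ∉ flatNormals K ∧
      0 < fderiv ℝ (fderiv ℝ (gauge K)) (x - c t) (deriv c t) (deriv c t) -
        fderiv ℝ (gauge K) (x - c t) (deriv (deriv c) t)) ∨
    (unitNormal c t ∈ flatNormals K ∧ curveCurvature c t ≤ 0) := by
  obtain ⟨h1, h2⟩ := hK.second_derivative_eq hα hk hc hc0 hx hl hp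
  set e : ℝ → Plane := fun u => c (t + ε * u) with he
  have hε2 : ε * ε = 1 := by rcases hε with rfl | rfl <;> norm_num
  have he0 : e 0 = c t := by simp [he]
  have hce : ContDiffAt ℝ 2 e 0 := contDiffAt_reparam hc
  have hde0 : deriv e 0 = ε • deriv c t := deriv_reparam (hc.differentiableAt (by norm_num))
  have hdde : deriv (deriv e) 0 = deriv (deriv c) t := deriv_deriv_reparam hε2 hc
  have hnn : 0 ≤ fderiv ℝ (fderiv ℝ (gauge K)) (x - c t) (deriv c t) (deriv c t) -
        fderiv ℝ (gauge K) (x - c t) (deriv (deriv c) t) := by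
    obtain ⟨δ, hδ, hder⟩ := hK.eventually_hasDerivAt_gauge_sub hα hk (x := x)
      (hce.of_le (by norm_num)) (by rwa [he0])
    refine second_deriv_nonneg_of_min (φ := fun u => gauge K (x - e u)) (G := distSlope K e x)
      ?_ ?_ ?_ (by simpa [he] using hmin)
    · filter_upwards [Metric.ball_mem_nhds (0 : ℝ) hδ] with u hu
      exact hder.self_of_nhds u (by simpa [Metric.mem_ball, Real.dist_eq] using hu)
    · rw [distSlope, he0, hde0, hp, map_smul, smul_apply, innerSL_apply_apply, leftNormal,
        inner_perp_self]
      simp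
    · refine (hK.hasDerivAt_distSlope hα hk hce (by rwa [he0])).congr_deriv ?_
      rw [he0, hde0, hdde]
      simp only [map_smul, smul_apply, smul_eq_mul]
      rw [← mul_assoc, hε2, one_mul]
  by_cases hflat : unitNormal c t ∈ flatNormals K
  · right
    obtain ⟨h3, h4⟩ := h2 hflat
    refine ⟨hflat, ?_⟩
    -- At a flat normal only the term with the acceleration of the curve survives, and its sign is
    -- opposite to that of the curvature.
    rw [h3, h4, zero_sub, neg_nonneg] at hnn
    have hn : 0 < ‖leftNormal c t‖ := norm_pos_iff.2 (leftNormal_ne_zero hc0)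
    have hh := hK.polarGauge_pos (leftNormal_ne_zero hc0)
    by_contra hcon
    push Not at hcon
    have : 0 < curveCurvature c t * ‖leftNormal c t‖ ^ 3 / polarGauge K (leftNormal c t) := by
      positivity
    linarith
  · left
    obtain ⟨h3, h4⟩ := h1 hflat
    refine ⟨hflat, lt_of_le_of_ne hnn fun h => ?_⟩
    rw [h4, eq_comm, mul_eq_zero, sub_eq_zero] at h
    rcases h with h | h
    · exact h3 h
    · exact hκ h.symm

omit hα hk in
/-- The open `γ`-ball around `x` that touches `∂U` lies in `U`. -/
theorem gauge_ball_subset {U : Set Plane} (hU : IsOpen U) {x y : Plane} (hxU : x ∈ U)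
    (hcl : IsClosestPoint K U x y) (hxy : x ≠ y) :
    {w | gauge K (x - w) < gauge K (x - y)} ⊆ U := by
  refine IsPreconnected.subset_of_disjoint_frontier hU (Convex.isPreconnected ?_)
    (fun z hz hzU => absurd (hcl.2 z hzU) (not_le.2 hz)) ⟨x, ?_, hxU⟩
  · intro v hv w hw a b ha hb hab
    have e : x - (a • v + b • w) = a • (x - v) + b • (x - w) := by
      rw [show x = a • x + b • x by rw [← add_smul, hab, one_smul]]
      have : a • x + b • x = x := by rw [← add_smul, hab, one_smul]
      rw [this]; nth_rewrite 1 [← this]; module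
    rw [mem_ofPred_eq] at *
    rw [e]
    refine (hK.gauge_add_le _ _).trans_lt ?_
    rw [hK.gauge_smul ha, hK.gauge_smul hb]
    rcases ha.eq_or_lt with rfl | ha'
    · rw [zero_add] at hab; subst hab; simpa using hw
    · calc a * gauge K (x - v) + b * gauge K (x - w)
          < a * gauge K (x - y) + b * gauge K (x - y) := by
            have := mul_lt_mul_of_pos_left hv ha'
            have := mul_le_mul_of_nonneg_left hw.le hb
            linarith
        _ = gauge K (x - y) := by rw [← add_mul, hab, one_mul]
  · simp only [mem_ofPred_eq, sub_self, gauge_zero]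
    exact hK.gauge_pos_iff.2 (sub_ne_zero.2 hxy)

end AdmissibleBody

/-! ### Angles and critical directions at a corner. -/

section Angles

variable {a b : Plane}

theorem pi_lt_ccwAngle_iff : π < ccwAngle a b ↔ ⟪perp a, b⟫_ℝ < 0 := by
  unfold ccwAngle
  split_ifs with h
  · have h1 := Complex.neg_pi_lt_arg ⟨⟪a, b⟫_ℝ, ⟪perp a, b⟫_ℝ⟩
    refine iff_of_true (by linarith) (Complex.arg_neg_iff.1 h)
  · refine iff_of_false (not_lt.2 (Complex.arg_le_pi _)) fun h1 => h (Complex.arg_neg_iff.2 h1)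

theorem ccwAngle_eq_pi_iff : ccwAngle a b = π ↔ ⟪a, b⟫_ℝ < 0 ∧ ⟪perp a, b⟫_ℝ = 0 := by
  rw [← Complex.arg_eq_pi_iff (z := ⟨⟪a, b⟫_ℝ, ⟪perp a, b⟫_ℝ⟩)]
  unfold ccwAngle
  split_ifs with h
  · have h1 := Complex.neg_pi_lt_arg ⟨⟪a, b⟫_ℝ, ⟪perp a, b⟫_ℝ⟩
    refine iff_of_false (by linarith) (by linarith [pi_pos])
  · rfl

theorem inner_perp_pos_of_ccwAngle_lt_pi (h : ccwAngle a b < π) (h0 : ccwAngle a b ≠ 0) :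
    0 < ⟪perp a, b⟫_ℝ := by
  rcases lt_trichotomy ⟪perp a, b⟫_ℝ 0 with h1 | h1 | h1
  · exact absurd (pi_lt_ccwAngle_iff.2 h1) h.not_gt
  · exfalso
    unfold ccwAngle at h h0
    rw [if_neg (by rw [Complex.arg_neg_iff]; exact h1.not_lt)] at h h0
    rcases lt_or_ge ⟪a, b⟫_ℝ 0 with h2 | h2
    · exact h.ne (Complex.arg_eq_pi_iff.2 ⟨h2, h1⟩)
    · exact h0 (Complex.arg_eq_zero_iff.2 ⟨h2, h1⟩)
  · exact h1

end Angles

section CornerVectors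

variable {a b g : Plane}

/-- The identity `h6` writes `⟪perp a, b⟫ ‖g‖²`, which is positive, as a sum of two nonpositive
products. -/
theorem no_critical_of_convex_corner (hg : g ≠ 0) (hD : 0 < ⟪perp a, b⟫_ℝ) (h1 : 0 ≤ ⟪g, a⟫_ℝ)
    (h2 : ⟪g, b⟫_ℝ ≤ 0) (h3 : 0 ≤ ⟪g, perp a⟫_ℝ) (h4 : 0 ≤ ⟪g, perp b⟫_ℝ) : False := by
  have h5 : 0 < ⟪perp a, b⟫_ℝ * ‖g‖ ^ 2 := by positivity
  have h6 : ⟪perp a, b⟫_ℝ * ‖g‖ ^ 2 =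
      -(⟪g, a⟫_ℝ * ⟪g, perp b⟫_ℝ) + ⟪g, b⟫_ℝ * ⟪g, perp a⟫_ℝ := by
    simp only [plane_norm_sq, plane_inner, perp_apply_zero, perp_apply_one]; ring
  have h7 := mul_nonneg h1 h4
  have h8 := mul_nonpos_of_nonpos_of_nonneg h2 h3
  linarith

/-- Here `b` is a positive multiple of `a`, so the two first order inequalities have opposite
directions and `g` is orthogonal to `a`. -/
theorem eq_smul_of_flat_corner (hg : g ≠ 0) (ha : a ≠ 0) (hD : ⟪perp a, b⟫_ℝ = 0)
    (hab : 0 < ⟪a, b⟫_ℝ) (h1 : 0 ≤ ⟪g, a⟫_ℝ) (h2 : ⟪g, b⟫_ℝ ≤ 0) (h3 : 0 ≤ ⟪g, perp a⟫_ℝ) :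
    (∃ l > (0 : ℝ), g = l • perp a) ∧ ∃ m > (0 : ℝ), b = m • a := by
  have hn : 0 < ‖a‖ ^ 2 := by positivity
  have hb := eq_smul_of_inner_perp_eq_zero (v := b) ha (by rw [real_inner_comm, hD])
  set m := ⟪b, a⟫_ℝ / ‖a‖ ^ 2 with hm
  have hm0 : 0 < m := by rw [hm, real_inner_comm]; positivity
  rw [hb, inner_smul_right] at h2
  have h4 : ⟪g, a⟫_ℝ = 0 := le_antisymm (nonpos_of_mul_nonpos_right h2 hm0) h1
  have h5 := eq_smul_perp_of_inner_eq_zero ha h4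
  refine ⟨⟨_, lt_of_le_of_ne (div_nonneg h3 (sq_nonneg _)) fun h => ?_, h5⟩, m, hm0, hb⟩
  rw [← h, zero_smul] at h5
  exact hg h5

/-- Orthogonality gives `g = l • perp a`, and the sign of `⟪g, b⟫` decides that of `l`. The strict
inequality means that only one of the two arcs can be critical. -/
theorem eq_smul_of_concave_corner (hg : g ≠ 0) (ha : a ≠ 0) (hD : ⟪perp a, b⟫_ℝ < 0)
    (h1 : ⟪g, a⟫_ℝ = 0) (h2 : ⟪g, b⟫_ℝ ≤ 0) :
    (∃ l > (0 : ℝ), g = l • perp a) ∧ ⟪g, b⟫_ℝ < 0 := by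
  have h5 := eq_smul_perp_of_inner_eq_zero ha h1
  set l := ⟪g, perp a⟫_ℝ / ‖a‖ ^ 2
  have hgb : ⟪g, b⟫_ℝ = l * ⟪perp a, b⟫_ℝ := by rw [h5, real_inner_smul_left]
  have hl0 : l ≠ 0 := fun h => hg (by rw [h5, h, zero_smul])
  have hl : 0 < l := by
    rcases hl0.lt_or_gt with h | h
    · have := mul_pos_of_neg_of_neg h hD
      linarith
    · exact h
  exact ⟨⟨l, hl, h5⟩, by rw [hgb]; exact mul_neg_of_pos_of_neg hl hD⟩

theorem eq_smul_of_concave_corner' (hg : g ≠ 0) (hb : b ≠ 0) (hD : ⟪perp a, b⟫_ℝ < 0)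
    (h1 : 0 ≤ ⟪g, a⟫_ℝ) (h2 : ⟪g, b⟫_ℝ = 0) :
    (∃ l > (0 : ℝ), g = l • perp b) ∧ 0 < ⟪g, a⟫_ℝ := by
  have h3 : ⟪perp b, -a⟫_ℝ < 0 := by
    rwa [inner_neg_right, inner_perp_left, neg_neg, real_inner_comm]
  obtain ⟨h4, h5⟩ := eq_smul_of_concave_corner hg hb h3 h2 (by rw [inner_neg_right]; linarith)
  exact ⟨h4, by rw [inner_neg_right] at h5; linarith⟩

/-- Take `u + N m`, with `N` large if `⟪m, c⟫ < 0` and `N = 1` otherwise. -/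
theorem exists_separating_vector {u m c : Plane} (hu : u ≠ 0) (hm : m ≠ 0) (hum : ⟪u, m⟫_ℝ = 0)
    (h : ⟪m, c⟫_ℝ < 0 ∨ ⟪m, c⟫_ℝ = 0 ∧ ⟪u, c⟫_ℝ < 0) :
    ∃ l : Plane, 0 < ⟪l, u⟫_ℝ ∧ 0 < ⟪l, m⟫_ℝ ∧ ⟪l, c⟫_ℝ < 0 := by
  have hu' := real_inner_self_pos.2 hu
  have hm' := real_inner_self_pos.2 hm
  have hmu : ⟪m, u⟫_ℝ = 0 := by rw [real_inner_comm, hum]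
  suffices h : ∃ N > (0 : ℝ), ⟪u, c⟫_ℝ + N * ⟪m, c⟫_ℝ < 0 by
    obtain ⟨N, hN, h⟩ := h
    refine ⟨u + N • m, ?_, ?_, ?_⟩ <;> rw [inner_add_left, real_inner_smul_left]
    · rw [hmu]; linarith
    · rw [hum, zero_add]; exact mul_pos hN hm'
    · exact h
  rcases h with h | ⟨h, h'⟩
  · refine ⟨(|⟪u, c⟫_ℝ| + 1) / -⟪m, c⟫_ℝ, div_pos (by positivity) (by linarith), ?_⟩
    have h1 : (|⟪u, c⟫_ℝ| + 1) / -⟪m, c⟫_ℝ * ⟪m, c⟫_ℝ = -(|⟪u, c⟫_ℝ| + 1) := by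
      rw [div_mul_eq_mul_div, div_eq_iff (neg_ne_zero.2 h.ne)]; ring
    rw [h1]
    linarith [le_abs_self ⟪u, c⟫_ℝ]
  · exact ⟨1, one_pos, by rw [h]; linarith⟩

end CornerVectors

/-! ### The touching ball cannot lie on the outer side of an arc. -/

theorem IsPreconnected.exists_mem_frontier {X : Type*} [TopologicalSpace X] {S U : Set X}
    (hS : IsPreconnected S) (hU : IsOpen U) (h1 : (S ∩ U).Nonempty) (h2 : (S \ closure U).Nonempty) :
    (S ∩ frontier U).Nonempty := by
  by_contra hcon
  rw [not_nonempty_iff_eq_empty] at hcon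
  obtain ⟨z, hz⟩ := hS U (closure U)ᶜ hU isClosed_closure.isOpen_compl (fun z hz => by
    by_contra h
    rw [mem_union, not_or, notMem_compl_iff] at h
    have : z ∈ S ∩ frontier U := ⟨hz, by rw [hU.frontier_eq]; exact ⟨h.2, h.1⟩⟩
    rw [hcon] at this
    exact this) h1 h2
  exact hz.2.2 (subset_closure hz.2.1)

section Crossing

variable {k : WithTop ℕ∞} {α : ℝ≥0} {K U : Set Plane}

/-- At a corner of angle at most `π`, a normal to one of the arcs cannot point into the `γ`-ball
that touches the boundary from the wrong side. -/
theorem AdmissibleBody.false_of_crossing (hK : AdmissibleBody k α K) (hα : α ≤ 1) (hk : 2 ≤ k)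
    (hU : IsOpen U) {x y a b l : Plane} {e₁ e₂ n : ℝ → Plane} (hxy : x ≠ y)
    (hE : {w | gauge K (x - w) < gauge K (x - y)} ⊆ U)
    (hcov : ∀ δ > 0, ∃ r > 0, ∀ w ∈ frontier U ∩ Metric.ball y r,
      ∃ u ∈ Ico (0 : ℝ) δ, w = e₁ u ∨ w = e₂ u)
    (h₁ : HasStrictDerivAt e₁ a 0) (h₂ : HasDerivAt e₂ b 0) (hy₁ : e₁ 0 = y) (hy₂ : e₂ 0 = y)
    (hn : ContinuousAt n 0) (ha : a ≠ 0) (hn0 : n 0 ≠ 0) (han : ⟪a, n 0⟫_ℝ = 0)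
    (hout : ∀ᶠ s in 𝓝[>] (0 : ℝ), ∀ᶠ σ in 𝓝[>] (0 : ℝ), e₁ s + σ • n s ∉ closure U)
    (hla : 0 < ⟪l, a⟫_ℝ) (hln : 0 < ⟪l, n 0⟫_ℝ) (hlb : ⟪l, b⟫_ℝ < 0)
    (hp : 0 < fderiv ℝ (gauge K) (x - y) (n 0)) : False := by
  have hna : 0 < ‖a‖ := norm_pos_iff.2 ha
  have hnn : 0 < ‖n 0‖ := norm_pos_iff.2 hn0
  set p := fderiv ℝ (gauge K) (x - y) with hpdef
  -- For large `M` the normal part dominates, so that from `y` the direction `a + M n(0)` leads into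
  -- the touching ball.
  obtain ⟨M, hM, hpM⟩ : ∃ M > (0 : ℝ), 0 < p (a + M • n 0) := by
    refine ⟨(|p a| + 1) / p (n 0), by positivity, ?_⟩
    rw [map_add, map_smul, smul_eq_mul, div_mul_cancel₀ _ hp.ne']
    linarith [neg_abs_le (p a)]
  -- the far end of the normal segment lies in the ball
  have hfar : ∀ᶠ s in 𝓝[>] (0 : ℝ), gauge K (x - (e₁ s + (M * s) • n s)) < gauge K (x - y) := by
    -- The normal field is only continuous, but multiplied by `s` it is differentiable at `0`.
    have hd1 : HasDerivAt (fun s : ℝ => s • n s) (n 0) 0 := by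
      rw [hasDerivAt_iff_tendsto_slope_zero]
      refine (hn.tendsto.mono_left nhdsWithin_le_nhds).congr' ?_
      filter_upwards [self_mem_nhdsWithin] with s hs
      have hs' : s ≠ 0 := hs
      simp [smul_smul, inv_mul_cancel₀ hs']
    have hd : HasDerivAt (fun s => x - (e₁ s + (M * s) • n s)) (-(a + M • n 0)) 0 := by
      have := (h₁.hasDerivAt.add (hd1.const_smul M)).const_sub x
      refine this.congr_of_eventuallyEq (Eventually.of_forall fun s => ?_)
      simp [smul_smul]
    have h3 : HasDerivAt (fun s => gauge K (x - (e₁ s + (M * s) • n s))) (-p (a + M • n 0)) 0 := by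
      have h4 : x - (e₁ 0 + (M * 0) • n 0) = x - y := by simp [hy₁]
      have h5 := hK.hasFDerivAt_gauge hα hk (z := x - (e₁ 0 + (M * 0) • n 0))
        (by rw [h4]; exact sub_ne_zero.2 hxy)
      refine (h5.comp_hasDerivAt 0 hd).congr_deriv ?_
      rw [h4, map_neg]
    have h4 := (hasDerivAt_iff_tendsto_slope_zero.1 h3).mono_left (nhdsGT_le_nhdsNE 0)
    filter_upwards [h4.eventually (gt_mem_nhds (neg_lt_zero.2 hpM)), self_mem_nhdsWithin] with s h5 h6
    have h7 := neg_of_mul_neg_right h5 (inv_nonneg.2 (le_of_lt h6))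
    simp only [zero_add, hy₁, mul_zero, zero_smul, add_zero] at h7
    linarith
  -- crossing points
  have hcross : ∀ᶠ s in 𝓝[>] (0 : ℝ), ∃ σ ∈ Ioc 0 (M * s), e₁ s + σ • n s ∈ frontier U := by
    filter_upwards [hfar, hout, self_mem_nhdsWithin] with s h3 h4 h5
    have h5' : 0 < s := h5
    obtain ⟨σ₀, h6, h7⟩ := (h4.and (Ioo_mem_nhdsGT (mul_pos hM h5'))).exists
    have hconn : IsPreconnected ((fun σ : ℝ => e₁ s + σ • n s) '' Ioc 0 (M * s)) :=
      isPreconnected_Ioc.image _ (by fun_prop)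
    obtain ⟨_, ⟨σ, hσ, rfl⟩, h8⟩ := hconn.exists_mem_frontier hU
      ⟨_, ⟨M * s, ⟨mul_pos hM h5', le_rfl⟩, rfl⟩, hE h3⟩ ⟨_, ⟨σ₀, ⟨h7.1, h7.2.le⟩, rfl⟩, h6⟩
    exact ⟨σ, hσ, h8⟩
  -- smallness conditions
  have hl1 : ∀ᶠ s in 𝓝[>] (0 : ℝ), 0 < ⟪l, e₁ s - y⟫_ℝ := by
    have h3 : HasDerivAt (fun s => ⟪l, e₁ s - y⟫_ℝ) ⟪l, a⟫_ℝ 0 :=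
      (innerSL ℝ l).hasFDerivAt.comp_hasDerivAt 0 (h₁.hasDerivAt.sub_const y)
    have h4 := (hasDerivAt_iff_tendsto_slope_zero.1 h3).mono_left (nhdsGT_le_nhdsNE 0)
    filter_upwards [h4.eventually (lt_mem_nhds hla), self_mem_nhdsWithin] with s h5 h6
    have h7 := pos_of_mul_pos_right h5 (inv_nonneg.2 (le_of_lt h6))
    simpa [hy₁] using h7
  have hl2 : ∃ δ > 0, ∀ u ∈ Ico (0 : ℝ) δ, ⟪l, e₂ u - y⟫_ℝ ≤ 0 := by
    have h3 : HasDerivAt (fun s => ⟪l, e₂ s - y⟫_ℝ) ⟪l, b⟫_ℝ 0 :=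
      (innerSL ℝ l).hasFDerivAt.comp_hasDerivAt 0 (h₂.sub_const y)
    have h4 := (hasDerivAt_iff_tendsto_slope_zero.1 h3).mono_left (nhdsGT_le_nhdsNE 0)
    obtain ⟨δ, hδ, h5⟩ := mem_nhdsGT_iff_exists_Ioo_subset.1 (h4.eventually (gt_mem_nhds hlb))
    refine ⟨δ, hδ, fun u hu => ?_⟩
    rcases hu.1.eq_or_lt with rfl | hu0
    · simp [hy₂]
    · have h6 : _ < (0 : ℝ) := h5 ⟨hu0, hu.2⟩
      have h7 := neg_of_mul_neg_right h6 (inv_nonneg.2 hu0.le)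
      simp only [zero_add, hy₂, sub_self, inner_zero_right, sub_zero] at h7
      exact h7.le
  obtain ⟨δ₂, hδ₂, hl2⟩ := hl2
  -- Strict differentiability makes all short chords of the first curve nearly parallel to `a`.
  have hstrict : ∃ δ > 0, ∀ s u : ℝ, |s| < δ → |u| < δ →
      ‖e₁ u - e₁ s - (u - s) • a‖ ≤ ‖a‖ / 2 * |u - s| := by
    have h3 := h₁.hasStrictFDerivAt.isLittleO.def (c := ‖a‖ / 2) (by positivity)
    obtain ⟨δ, hδ, h4⟩ := Metric.eventually_nhds_iff_ball.1 h3
    refine ⟨δ, hδ, fun s u hs hu => ?_⟩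
    have h5 : (u, s) ∈ Metric.ball ((0 : ℝ), (0 : ℝ)) δ := by
      rw [← ball_prod_same]; simpa using ⟨hu, hs⟩
    simpa using h4 _ h5
  obtain ⟨δ₁, hδ₁, hstrict⟩ := hstrict
  obtain ⟨r, hr, hcov⟩ := hcov (min δ₁ δ₂) (lt_min hδ₁ hδ₂)
  have hc1 : ContinuousAt (fun s => ⟪l, n s⟫_ℝ) 0 := continuousAt_const.inner hn
  have hc2 : ContinuousAt (fun s => ⟪n s, n 0⟫_ℝ) 0 := hn.inner continuousAt_const
  have hc3 : ContinuousAt (fun s => |⟪n s, a⟫_ℝ|) 0 := (hn.inner continuousAt_const).abs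
  have hc4 : Tendsto (fun s => ‖e₁ s - y‖ + M * |s| * ‖n s‖) (𝓝 0) (𝓝 0) := by
    have : ContinuousAt (fun s => ‖e₁ s - y‖ + M * |s| * ‖n s‖) 0 :=
      (h₁.hasDerivAt.continuousAt.sub continuousAt_const).norm.add
        ((continuousAt_const.mul continuous_abs.continuousAt).mul hn.norm)
    simpa [ContinuousAt, hy₁] using this
  have e3 : ∀ᶠ s in 𝓝[>] (0 : ℝ), 0 < ⟪l, n s⟫_ℝ :=
    nhdsWithin_le_nhds (hc1.eventually (lt_mem_nhds hln))
  have e4 : ∀ᶠ s in 𝓝[>] (0 : ℝ), ‖n 0‖ ^ 2 / 2 < ⟪n s, n 0⟫_ℝ :=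
    nhdsWithin_le_nhds (hc2.eventually (lt_mem_nhds (by
      show _ < ⟪n 0, n 0⟫_ℝ
      rw [real_inner_self_eq_norm_sq]; exact half_lt_self (by positivity))))
  have e5 : ∀ᶠ s in 𝓝[>] (0 : ℝ), |⟪n s, a⟫_ℝ| < ‖a‖ * ‖n 0‖ / 4 :=
    nhdsWithin_le_nhds (hc3.eventually (gt_mem_nhds (by
      show |⟪n 0, a⟫_ℝ| < _
      rw [real_inner_comm, han, abs_zero]; positivity)))
  have e6 : ∀ᶠ s in 𝓝[>] (0 : ℝ), ‖e₁ s - y‖ + M * |s| * ‖n s‖ < r :=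
    nhdsWithin_le_nhds (hc4.eventually (gt_mem_nhds hr))
  obtain ⟨s, ⟨σ, hσ, hfr⟩, e1, e3, e4, e5, e6, hsδ⟩ := (hcross.and (hl1.and (e3.and (e4.and (e5.and
    (e6.and (Ioo_mem_nhdsGT hδ₁))))))).exists
  have hs0 : 0 < s := hsδ.1
  have hball : e₁ s + σ • n s ∈ Metric.ball y r := by
    rw [Metric.mem_ball, dist_eq_norm]
    have h3 : e₁ s + σ • n s - y = (e₁ s - y) + σ • n s := by abel
    have h4 : ‖σ • n s‖ ≤ M * |s| * ‖n s‖ := by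
      rw [norm_smul, Real.norm_eq_abs, abs_of_pos hσ.1, abs_of_pos hs0]
      exact mul_le_mul_of_nonneg_right hσ.2 (norm_nonneg _)
    rw [h3]
    linarith [norm_add_le (e₁ s - y) (σ • n s)]
  obtain ⟨u, hu, hw⟩ := hcov _ ⟨hfr, hball⟩
  -- The crossing point lies on one of the two curves. On `e₁` it would give a chord along the
  -- normal, although chords are nearly tangential; on `e₂` the functional `l` would be nonpositive,
  -- although it is positive at the crossing point.
  rcases hw with hw | hw
  · have hu1 : |u| < δ₁ := by rw [abs_of_nonneg hu.1]; exact hu.2.trans_le (min_le_left _ _)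
    have hs1 : |s| < δ₁ := by rw [abs_of_pos hs0]; exact hsδ.2
    have h3 := hstrict s u hs1 hu1
    have h4 : e₁ u - e₁ s = σ • n s := by rw [← hw]; abel
    rw [h4] at h3
    set v := σ • n s - (u - s) • a with hv
    have h5 : σ * ⟪n s, n 0⟫_ℝ ≤ ‖a‖ / 2 * |u - s| * ‖n 0‖ := by
      have h6 : ⟪v, n 0⟫_ℝ = σ * ⟪n s, n 0⟫_ℝ := by
        rw [hv, inner_sub_left, real_inner_smul_left, real_inner_smul_left, han]; ring
      rw [← h6]
      exact (real_inner_le_norm _ _).trans (mul_le_mul_of_nonneg_right h3 (norm_nonneg _))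
    have h6 : |u - s| * ‖a‖ ^ 2 ≤ σ * |⟪n s, a⟫_ℝ| + ‖a‖ / 2 * |u - s| * ‖a‖ := by
      have h7 : (u - s) * ‖a‖ ^ 2 = σ * ⟪n s, a⟫_ℝ - ⟪v, a⟫_ℝ := by
        rw [hv, inner_sub_left, real_inner_smul_left, real_inner_smul_left,
          real_inner_self_eq_norm_sq]; ring
      have h8 : |u - s| * ‖a‖ ^ 2 = |σ * ⟪n s, a⟫_ℝ - ⟪v, a⟫_ℝ| := by
        rw [← h7, abs_mul, abs_of_nonneg (by positivity : 0 ≤ ‖a‖ ^ 2)]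
      rw [h8]
      refine (abs_sub _ _).trans (add_le_add ?_ ?_)
      · rw [abs_mul, abs_of_pos hσ.1]
      · exact (abs_real_inner_le_norm _ _).trans (mul_le_mul_of_nonneg_right h3 (norm_nonneg _))
    have h7 : σ * ‖n 0‖ ≤ ‖a‖ * |u - s| := by
      have h8 : σ * (‖n 0‖ ^ 2 / 2) ≤ σ * ⟪n s, n 0⟫_ℝ := mul_le_mul_of_nonneg_left e4.le hσ.1.le
      nlinarith
    have h8 : σ * |⟪n s, a⟫_ℝ| < σ * (‖a‖ * ‖n 0‖ / 4) := mul_lt_mul_of_pos_left e5 hσ.1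
    have h9 : σ * (‖a‖ * ‖n 0‖ / 4) ≤ ‖a‖ * (‖a‖ * |u - s|) / 4 := by
      have := mul_le_mul_of_nonneg_left h7 hna.le
      linarith
    have h10 : 0 ≤ |u - s| * ‖a‖ ^ 2 := by positivity
    nlinarith
  · have h3 := hl2 u ⟨hu.1, hu.2.trans_le (min_le_right _ _)⟩
    rw [← hw, show e₁ s + σ • n s - y = (e₁ s - y) + σ • n s by abel, inner_add_right,
      inner_smul_right] at h3
    have := mul_pos hσ.1 e3
    linarith

end Crossing

/-! ### Local structure of the boundary. -/

namespace PiecewiseBoundary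

variable {k : WithTop ℕ∞} {α : ℝ≥0} {U : Set Plane} (B : PiecewiseBoundary k α U)

include B in
theorem arc_mem_frontier (i : Fin B.N) {t : ℝ} (ht : t ∈ Icc (0 : ℝ) 1) :
    B.arc i t ∈ frontier U := by
  rw [B.frontier_eq]; exact mem_iUnion.2 ⟨i, t, ht, rfl⟩

theorem contDiffAt_arc (i : Fin B.N) {t : ℝ} (ht : t ∈ Icc (0 : ℝ) 1) :
    ContDiffAt ℝ k (B.arc i) t := (B.smooth i t ht).contDiffAt

theorem continuousOn_arc (i : Fin B.N) : ContinuousOn (B.arc i) (Icc 0 1) :=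
  fun _ ht => (B.contDiffAt_arc i ht).continuousAt.continuousWithinAt

/-- Injectivity is assumed on `[0, 1)`, so the parameter `1` is first replaced by the parameter `0`
of the next arc. -/
theorem eq_of_arc_eq_interior {i j : Fin B.N} {s t : ℝ} (ht : t ∈ Ioo (0 : ℝ) 1)
    (hs : s ∈ Icc (0 : ℝ) 1) (h : B.arc j s = B.arc i t) : j = i ∧ s = t := by
  rcases hs.2.eq_or_lt with rfl | hs1
  · rw [B.joined] at h
    exact absurd (B.simple _ _ 0 (by simp) t (Ioo_subset_Ico_self ht) h).2 ht.1.ne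
  · exact B.simple _ _ s ⟨hs.1, hs1⟩ t (Ioo_subset_Ico_self ht) h

theorem eq_of_arc_eq_corner {i j : Fin B.N} {s : ℝ} (hs : s ∈ Icc (0 : ℝ) 1)
    (h : B.arc j s = B.arc i 1) : (j = i ∧ s = 1) ∨ (j = B.next i ∧ s = 0) := by
  rw [B.joined i] at h
  rcases hs.2.eq_or_lt with rfl | hs1
  · rw [B.joined] at h
    exact Or.inl ⟨B.next.injective (B.simple _ _ 0 (by simp) 0 (by simp) h).1, rfl⟩
  · exact Or.inr (B.simple _ _ s ⟨hs.1, hs1⟩ 0 (by simp) h)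

/-- Near `y` the boundary is covered by the parts of the arcs with parameters close to the
preimages of `y`. -/
theorem exists_cover (y : Plane) (O : Fin B.N → Set ℝ) (hO : ∀ i, IsOpen (O i))
    (h : ∀ i, ∀ s ∈ Icc (0 : ℝ) 1, B.arc i s = y → s ∈ O i) :
    ∃ r > 0, ∀ w ∈ frontier U ∩ Metric.ball y r, ∃ i, ∃ s ∈ Icc (0 : ℝ) 1 ∩ O i,
      B.arc i s = w := by
  -- The parameters outside the sets `O i` are compact, and their image misses `y`, hence a ball
  -- around `y`.
  have hC : IsClosed (⋃ i, B.arc i '' (Icc (0 : ℝ) 1 \ O i)) :=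
    (isCompact_iUnion fun i => (isCompact_Icc.diff (hO i)).image_of_continuousOn
      ((B.continuousOn_arc i).mono sdiff_subset)).isClosed
  have hy : y ∉ ⋃ i, B.arc i '' (Icc (0 : ℝ) 1 \ O i) := by
    rw [mem_iUnion]
    rintro ⟨i, s, hs, hsy⟩
    exact hs.2 (h i s hs.1 hsy)
  obtain ⟨r, hr, hball⟩ := Metric.isOpen_iff.1 hC.isOpen_compl y hy
  refine ⟨r, hr, fun w hw => ?_⟩
  have h1 := hw.1
  rw [B.frontier_eq, mem_iUnion] at h1
  obtain ⟨i, s, hs, rfl⟩ := h1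
  refine ⟨i, s, ⟨hs, ?_⟩, rfl⟩
  by_contra hcon
  exact hball hw.2 (mem_iUnion.2 ⟨i, s, ⟨hs, hcon⟩, rfl⟩)

theorem exists_cover_interior (i : Fin B.N) {t : ℝ} (ht : t ∈ Ioo (0 : ℝ) 1) {δ : ℝ} (hδ : 0 < δ) :
    ∃ r > 0, ∀ w ∈ frontier U ∩ Metric.ball (B.arc i t) r,
      ∃ s ∈ Icc (0 : ℝ) 1, |s - t| < δ ∧ w = B.arc i s := by
  obtain ⟨r, hr, h⟩ := B.exists_cover (B.arc i t) (fun j => {s | j = i ∧ |s - t| < δ})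
    (fun j => by
      by_cases hj : j = i
      · simp only [hj, true_and]; exact isOpen_lt (by fun_prop) continuous_const
      · simp [hj])
    (fun j s hs hjs => by
      obtain ⟨rfl, rfl⟩ := B.eq_of_arc_eq_interior ht hs hjs
      exact ⟨rfl, by simpa using hδ⟩)
  refine ⟨r, hr, fun w hw => ?_⟩
  obtain ⟨j, s, ⟨hs, rfl, hst⟩, rfl⟩ := h w hw
  exact ⟨s, hs, hst, rfl⟩

theorem exists_cover_corner (i : Fin B.N) {δ : ℝ} (hδ : 0 < δ) :
    ∃ r > 0, ∀ w ∈ frontier U ∩ Metric.ball (B.arc i 1) r, ∃ u ∈ Icc (0 : ℝ) 1, u < δ ∧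
      (w = B.arc i (1 - u) ∨ w = B.arc (B.next i) u) := by
  obtain ⟨r, hr, h⟩ := B.exists_cover (B.arc i 1)
    (fun j => {s | (j = i ∧ 1 - δ < s) ∨ (j = B.next i ∧ s < δ)})
    (fun j => by
      refine IsOpen.union ?_ ?_
      · by_cases hj : j = i
        · simp only [hj, true_and]; exact isOpen_lt continuous_const continuous_id
        · simp only [hj, false_and]; exact isOpen_empty
      · by_cases hj : j = B.next i
        · simp only [hj, true_and]; exact isOpen_lt continuous_id continuous_const
        · simp only [hj, false_and]; exact isOpen_empty)
    (fun j s hs hjs => by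
      rcases B.eq_of_arc_eq_corner hs hjs with ⟨h, rfl⟩ | ⟨h, rfl⟩
      · exact Or.inl ⟨h, by linarith⟩
      · exact Or.inr ⟨h, hδ⟩)
  refine ⟨r, hr, fun w hw => ?_⟩
  obtain ⟨j, s, ⟨hs, ⟨rfl, hst⟩ | ⟨rfl, hst⟩⟩, rfl⟩ := h w hw
  · exact ⟨1 - s, ⟨by linarith [hs.2], by linarith [hs.1]⟩, by linarith, Or.inl (by simp)⟩
  · exact ⟨s, hs, hst, Or.inr rfl⟩

/-- The half of the arc `i` next to its end point with parameter `t`. -/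
def halfArc (i : Fin B.N) (t : ℝ) : Set Plane :=
  B.arc i '' {s | s ∈ Icc (0 : ℝ) 1 ∧ |s - t| ≤ 1 / 2}

theorem arc_mem_halfArc (i : Fin B.N) {t : ℝ} (ht : t ∈ Icc (0 : ℝ) 1) :
    B.arc i t ∈ B.halfArc i t := ⟨t, ⟨ht, by simp⟩, rfl⟩

/-- A closed curve may consist of a single arc, both of whose ends are the same corner. Parameters
within `1 / 2` of `t` separate the two ends. -/
theorem eq_of_arc_eq_end {i : Fin B.N} {s t : ℝ} (ht : t = 0 ∨ t = 1) (hs : s ∈ Icc (0 : ℝ) 1)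
    (hst : |s - t| ≤ 1 / 2) (h : B.arc i s = B.arc i t) : s = t := by
  rw [abs_le] at hst
  rcases ht with rfl | rfl
  · exact (B.simple i i s ⟨hs.1, by linarith⟩ 0 (by simp) h).2
  · rcases B.eq_of_arc_eq_corner hs h with h | h
    · exact h.2
    · linarith

theorem exists_halfArc_ball (i : Fin B.N) {t : ℝ} (ht : t = 0 ∨ t = 1) {δ : ℝ} (hδ : 0 < δ) :
    ∃ r > 0, ∀ w ∈ B.halfArc i t ∩ Metric.ball (B.arc i t) r,
      ∃ s ∈ Icc (0 : ℝ) 1, |s - t| < δ ∧ w = B.arc i s := by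
  set T : Set ℝ := Icc 0 1 ∩ {s | |s - t| ≤ 1 / 2} ∩ {s | δ ≤ |s - t|} with hT
  have hTc : IsCompact T := (isCompact_Icc.inter_right
    (isClosed_le (by fun_prop) continuous_const)).inter_right
      (isClosed_le continuous_const (by fun_prop))
  have hC : IsClosed (B.arc i '' T) := (hTc.image_of_continuousOn
    ((B.continuousOn_arc i).mono fun s hs => hs.1.1)).isClosed
  have hy : B.arc i t ∉ B.arc i '' T := by
    rintro ⟨s, hs, h⟩
    have := B.eq_of_arc_eq_end ht hs.1.1 hs.1.2 h
    have h2 : δ ≤ |s - t| := hs.2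
    rw [this, sub_self, abs_zero] at h2
    linarith
  obtain ⟨r, hr, hball⟩ := Metric.isOpen_iff.1 hC.isOpen_compl _ hy
  refine ⟨r, hr, ?_⟩
  rintro _ ⟨⟨s, hs, rfl⟩, hw⟩
  refine ⟨s, hs.1, ?_, rfl⟩
  by_contra hcon
  exact hball hw ⟨s, ⟨hs, not_lt.1 hcon⟩, rfl⟩

theorem exists_ball_subset_halfArc (i : Fin B.N) : ∃ r > 0, frontier U ∩ Metric.ball (B.arc i 1) r ⊆
    B.halfArc i 1 ∪ B.halfArc (B.next i) 0 := by
  obtain ⟨r, hr, h⟩ := B.exists_cover_corner i (δ := 1 / 2) (by norm_num)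
  refine ⟨r, hr, fun w hw => ?_⟩
  obtain ⟨u, hu, hu2, rfl | rfl⟩ := h w hw
  · refine Or.inl ⟨1 - u, ⟨⟨by linarith [hu.2], by linarith [hu.1]⟩, ?_⟩, rfl⟩
    rw [abs_le]; constructor <;> linarith [hu.1]
  · refine Or.inr ⟨u, ⟨hu, ?_⟩, rfl⟩
    rw [abs_le]; constructor <;> linarith [hu.1]

end PiecewiseBoundary

theorem eventually_mem_Icc_one : ∀ᶠ u in 𝓝[>] (0 : ℝ), 1 + (-1) * u ∈ Icc (0 : ℝ) 1 := by
  filter_upwards [Ioo_mem_nhdsGT one_pos] with u hu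
  constructor <;> linarith [hu.1, hu.2]

theorem eventually_mem_Icc_zero : ∀ᶠ u in 𝓝[>] (0 : ℝ), 0 + 1 * u ∈ Icc (0 : ℝ) 1 := by
  filter_upwards [Ioo_mem_nhdsGT one_pos] with u hu
  constructor <;> linarith [hu.1, hu.2]

/-! ### Necessary conditions at a closest point. -/

section ClosestPoint

variable {k : WithTop ℕ∞} {α : ℝ≥0} {K U : Set Plane} (B : PiecewiseBoundary k α U)
variable (hK : AdmissibleBody k α K) (hα : α ≤ 1) (hk : 2 ≤ k) {x y : Plane}

include hK hα hk

theorem hasDerivAt_gauge_sub_curve {e : ℝ → Plane} {a : Plane} (he : HasDerivAt e a 0)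
    (hx : x ≠ e 0) : HasDerivAt (fun u => gauge K (x - e u))
      (-⟪gradient (gauge K) (x - e 0), a⟫_ℝ) 0 := by
  have := (hK.hasFDerivAt_gauge hα hk (sub_ne_zero.2 hx)).comp_hasDerivAt 0 (he.const_sub x)
  exact this.congr_deriv (by rw [map_neg, inner_gradient])

include B in
theorem PiecewiseBoundary.hasDerivAt_gauge_arc (hxy : x ≠ y) {i : Fin B.N} {t ε : ℝ}
    (ht : t ∈ Icc (0 : ℝ) 1) (hy : B.arc i t = y) :
    HasDerivAt (fun u => gauge K (x - B.arc i (t + ε * u)))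
      (-(ε * ⟪gradient (gauge K) (x - y), deriv (B.arc i) t⟫_ℝ)) 0 := by
  have hd : DifferentiableAt ℝ (B.arc i) (t + ε * 0) := by
    simpa using ((B.contDiffAt_arc i ht).of_le hk).differentiableAt (by norm_num)
  have := hasDerivAt_gauge_sub_curve hK hα hk (x := x) (hasDerivAt_reparam hd) (by simpa [hy])
  simpa [hy, inner_smul_right] using this

include B in
theorem PiecewiseBoundary.first_order (hxy : x ≠ y) (hcl : IsClosestPoint K U x y) {i : Fin B.N}
    {t ε : ℝ} (ht : t ∈ Icc (0 : ℝ) 1) (hy : B.arc i t = y)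
    (hε : ∀ᶠ u in 𝓝[>] (0 : ℝ), t + ε * u ∈ Icc (0 : ℝ) 1) :
    ε * ⟪gradient (gauge K) (x - y), deriv (B.arc i) t⟫_ℝ ≤ 0 := by
  have h1 := first_deriv_nonneg_of_min (B.hasDerivAt_gauge_arc hK hα hk hxy (ε := ε) ht hy) (by
    filter_upwards [hε] with u hu
    simpa [hy] using hcl.2 _ (B.arc_mem_frontier i hu))
  linarith

include B in
/-- At a closest point inside an arc, the gradient of the distance is a positive multiple of the
inward normal. -/
theorem PiecewiseBoundary.gradient_eq_interior (hU : IsOpen U) (hxU : x ∈ U)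
    (hcl : IsClosestPoint K U x y) {i : Fin B.N} {t : ℝ} (ht : t ∈ Ioo (0 : ℝ) 1)
    (hy : B.arc i t = y) :
    ∃ l > (0 : ℝ), gradient (gauge K) (x - y) = l • leftNormal (B.arc i) t := by
  have hxy : x ≠ y := by
    rintro rfl
    have := hcl.1
    rw [hU.frontier_eq] at this
    exact this.2 hxU
  set g := gradient (gauge K) (x - y) with hg
  have hg0 : g ≠ 0 := hK.fderiv_gauge_ne_zero hα hk (sub_ne_zero.2 hxy)
  have htI := Ioo_subset_Icc_self ht
  have hc0 := B.regular i t htI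
  have hev : ∀ ε : ℝ, ∀ᶠ u in 𝓝[>] (0 : ℝ), t + ε * u ∈ Icc (0 : ℝ) 1 := fun ε => by
    have : Tendsto (fun u : ℝ => t + ε * u) (𝓝 0) (𝓝 t) :=
      Continuous.tendsto' (by fun_prop) _ _ (by simp)
    exact nhdsWithin_le_nhds (this.eventually (Icc_mem_nhds ht.1 ht.2))
  have h1 := B.first_order hK hα hk hxy hcl htI hy (hev 1)
  have h2 := B.first_order hK hα hk hxy hcl htI hy (hev (-1))
  have h3 : ⟪g, deriv (B.arc i) t⟫_ℝ = 0 := by rw [← hg] at h1 h2; linarith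
  have h4 := eq_smul_perp_of_inner_eq_zero hc0 h3
  refine ⟨_, ?_, h4⟩
  set l := ⟪g, perp (deriv (B.arc i) t)⟫_ℝ / ‖deriv (B.arc i) t‖ ^ 2 with hl
  by_contra hcon
  have hl0 : l ≠ 0 := fun h => hg0 (by rw [h4, h, zero_smul])
  have hlneg : l < 0 := lt_of_le_of_ne (not_lt.1 hcon) hl0
  have hder : HasDerivAt (fun s : ℝ => B.arc i t - s • leftNormal (B.arc i) t)
      (-leftNormal (B.arc i) t) 0 := by
    have := ((hasDerivAt_id (0 : ℝ)).smul_const (leftNormal (B.arc i) t)).const_sub (B.arc i t)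
    simpa using this
  have h5 := hasDerivAt_gauge_sub_curve hK hα hk (x := x) hder (by simpa [hy])
  simp only [zero_smul, sub_zero, hy, inner_neg_right, neg_neg] at h5
  have h6 : ⟪g, leftNormal (B.arc i) t⟫_ℝ < 0 := by
    rw [h4, real_inner_smul_left]
    exact mul_neg_of_neg_of_pos hlneg (real_inner_self_pos.2 (leftNormal_ne_zero hc0))
  -- The outer side of the arc is outside the closure of `U`, hence outside the touching ball, so
  -- the distance cannot decrease in that direction.
  have h7 : 0 ≤ ⟪g, leftNormal (B.arc i) t⟫_ℝ := by
    refine first_deriv_nonneg_of_min h5 ?_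
    filter_upwards [B.inward i t ht] with s hs
    by_contra hlt
    rw [not_le] at hlt
    rw [zero_smul, sub_zero] at hlt
    refine hs.2 (subset_closure (hK.gauge_ball_subset hU hxU hcl hxy ?_))
    rw [hy]; exact hlt
  linarith

end ClosestPoint

theorem continuousAt_leftNormal {c : ℝ → Plane} {t : ℝ} (hc : ContDiffAt ℝ 1 c t) :
    ContinuousAt (leftNormal c) t := by
  have h4 : ContDiffAt ℝ 0 (deriv c) t :=
    ContDiffAt.clm_apply (hc.fderiv_right (m := 0) (by norm_num)) contDiffAt_const
  exact perpCLM.continuous.continuousAt.comp h4.continuousAt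

section Corner

variable {k : WithTop ℕ∞} {α : ℝ≥0} {K U : Set Plane} (B : PiecewiseBoundary k α U)
variable (hK : AdmissibleBody k α K) (hα : α ≤ 1) (hk : 2 ≤ k) {x y : Plane}
variable (hU : IsOpen U) (hxU : x ∈ U) (hcl : IsClosestPoint K U x y)

omit hK hα hk in
include hU hxU hcl in
theorem IsClosestPoint.ne : x ≠ y := by
  rintro rfl
  have := hcl.1
  rw [hU.frontier_eq] at this
  exact this.2 hxU

namespace PiecewiseBoundary

include hK hα hk hU hxU hcl

theorem corner_first_order {i : Fin B.N} (hy : B.arc i 1 = y) :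
    0 ≤ ⟪gradient (gauge K) (x - y), deriv (B.arc i) 1⟫_ℝ ∧
      ⟪gradient (gauge K) (x - y), deriv (B.arc (B.next i)) 0⟫_ℝ ≤ 0 := by
  have hxy := hcl.ne hU hxU
  have h1 := B.first_order hK hα hk hxy hcl (by simp) hy eventually_mem_Icc_one
  have h2 := B.first_order hK hα hk hxy hcl (by simp) (by rw [← B.joined, hy])
    eventually_mem_Icc_zero
  constructor <;> linarith

/-- A corner of angle at most `π` is not approached from outside the domain. -/
theorem corner_normal_nonneg {i : Fin B.N} (hy : B.arc i 1 = y)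
    (hD : 0 < ⟪perp (deriv (B.arc i) 1), deriv (B.arc (B.next i)) 0⟫_ℝ ∨
      ⟪perp (deriv (B.arc i) 1), deriv (B.arc (B.next i)) 0⟫_ℝ = 0 ∧
      0 < ⟪deriv (B.arc i) 1, deriv (B.arc (B.next i)) 0⟫_ℝ) :
    0 ≤ ⟪gradient (gauge K) (x - y), perp (deriv (B.arc i) 1)⟫_ℝ ∧
      0 ≤ ⟪gradient (gauge K) (x - y), perp (deriv (B.arc (B.next i)) 0)⟫_ℝ := by
  have hxy := hcl.ne hU hxU
  have hE := hK.gauge_ball_subset hU hxU hcl hxy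
  set a := deriv (B.arc i) 1 with ha
  set b := deriv (B.arc (B.next i)) 0 with hb
  have ha0 : a ≠ 0 := B.regular i 1 (by simp)
  have hb0 : b ≠ 0 := B.regular _ 0 (by simp)
  set e₁ : ℝ → Plane := fun u => B.arc i (1 + (-1) * u) with he₁
  set e₂ : ℝ → Plane := fun u => B.arc (B.next i) (0 + 1 * u) with he₂
  have hy₁ : e₁ 0 = y := by simp [he₁, hy]
  have hy₂ : e₂ 0 = y := by simp [he₂, ← B.joined, hy]
  have hc₁ : ContDiffAt ℝ 2 (B.arc i) 1 := (B.contDiffAt_arc i (by simp)).of_le hk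
  have hc₂ : ContDiffAt ℝ 2 (B.arc (B.next i)) 0 := (B.contDiffAt_arc _ (by simp)).of_le hk
  have hd₁ : HasStrictDerivAt e₁ (-a) 0 := by
    have h1 := (contDiffAt_reparam (ε := -1) hc₁).hasStrictDerivAt (by norm_num)
    rwa [deriv_reparam (hc₁.differentiableAt (by norm_num)), neg_one_smul] at h1
  have hd₂ : HasStrictDerivAt e₂ b 0 := by
    have h1 := (contDiffAt_reparam (ε := 1) hc₂).hasStrictDerivAt (by norm_num)
    rwa [deriv_reparam (hc₂.differentiableAt (by norm_num)), one_smul] at h1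
  have hcov : ∀ δ > 0, ∃ r > 0, ∀ w ∈ frontier U ∩ Metric.ball y r,
      ∃ u ∈ Ico (0 : ℝ) δ, w = e₁ u ∨ w = e₂ u := by
    intro δ hδ
    obtain ⟨r, hr, h⟩ := B.exists_cover_corner i hδ
    refine ⟨r, hr, fun w hw => ?_⟩
    obtain ⟨u, hu, huδ, h⟩ := h w (by rwa [hy])
    refine ⟨u, ⟨hu.1, huδ⟩, ?_⟩
    simpa [he₁, he₂, ← sub_eq_add_neg] using h
  obtain ⟨ht₁, ht₂⟩ : Continuous (fun u : ℝ => 1 + (-1) * u) ∧ Continuous fun u : ℝ => 0 + 1 * u :=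
    ⟨by fun_prop, by fun_prop⟩
  constructor
  · by_contra! hcon
    -- The arc `i` is followed backwards, so it leaves the corner in direction `-a`, and `-perp a`
    -- is its outer normal.
    obtain ⟨l, h1, h2, h3⟩ := exists_separating_vector (u := -a) (m := -perp a) (c := b)
      (neg_ne_zero.2 ha0) (neg_ne_zero.2 (perp_ne_zero ha0)) (by simp)
      (by simpa only [inner_neg_left, neg_lt_zero, neg_eq_zero] using hD)
    have hn : -leftNormal (B.arc i) (1 + (-1) * 0) = -perp a := by simp [leftNormal, ha]
    refine hK.false_of_crossing hα hk hU hxy hE hcov hd₁ hd₂.hasDerivAt hy₁ hy₂ (l := l)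
      (n := fun u => -leftNormal (B.arc i) (1 + (-1) * u)) ?_ (neg_ne_zero.2 ha0) ?_ ?_ ?_ h1 ?_ h3
      ?_
    · refine (ContinuousAt.comp (g := leftNormal (B.arc i)) ?_ ht₁.continuousAt).neg
      simpa using continuousAt_leftNormal (hc₁.of_le (by norm_num))
    · rw [hn]; exact neg_ne_zero.2 (perp_ne_zero ha0)
    · rw [hn]; simp
    · filter_upwards [Ioo_mem_nhdsGT one_pos] with s hs
      filter_upwards [B.inward i (1 + (-1) * s) ⟨by linarith [hs.2], by linarith [hs.1]⟩] with σ hσ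
      rw [smul_neg, ← sub_eq_add_neg]
      exact hσ.2
    · rw [hn]; exact h2
    · rw [hn, map_neg, ← inner_gradient]; linarith
  · by_contra! hcon
    obtain ⟨l, h1, h2, h3⟩ := exists_separating_vector (u := b) (m := -perp b) (c := -a)
      hb0 (neg_ne_zero.2 (perp_ne_zero hb0)) (by simp) (by
        rw [inner_neg_neg, inner_perp_left, real_inner_comm, inner_neg_right, real_inner_comm a b]
        simpa only [neg_lt_zero, neg_eq_zero] using hD)
    have hn : -leftNormal (B.arc (B.next i)) (0 + 1 * 0) = -perp b := by simp [leftNormal, hb]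
    refine hK.false_of_crossing hα hk hU hxy hE (fun δ hδ => ?_) hd₂ hd₁.hasDerivAt hy₂ hy₁ (l := l)
      (n := fun u => -leftNormal (B.arc (B.next i)) (0 + 1 * u)) ?_ hb0 ?_ ?_ ?_ h1 ?_ h3 ?_
    · obtain ⟨r, hr, h⟩ := hcov δ hδ
      exact ⟨r, hr, fun w hw => (h w hw).imp fun u hu => ⟨hu.1, hu.2.symm⟩⟩
    · refine (ContinuousAt.comp (g := leftNormal (B.arc (B.next i))) ?_ ht₂.continuousAt).neg
      simpa using continuousAt_leftNormal (hc₂.of_le (by norm_num))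
    · rw [hn]; exact neg_ne_zero.2 (perp_ne_zero hb0)
    · rw [hn]; simp
    · filter_upwards [Ioo_mem_nhdsGT one_pos] with s hs
      filter_upwards [B.inward (B.next i) (0 + 1 * s)
        ⟨by linarith [hs.1], by linarith [hs.2]⟩] with σ hσ
      rw [smul_neg, ← sub_eq_add_neg]
      exact hσ.2
    · rw [hn]; exact h2
    · rw [hn, map_neg, ← inner_gradient]; linarith

end PiecewiseBoundary
end Corner

/-- The order `j` is that of the foot point, one less than that of the data. For `∞` and `ω` one
takes `j = k`. -/
theorem exists_eq_add_one {k : WithTop ℕ∞} (hk : 2 ≤ k) :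
    ∃ j : WithTop ℕ∞, k = j + 1 ∧ 1 ≤ j := by
  induction k using WithTop.recTopCoe with
  | top => exact ⟨⊤, rfl, le_top⟩
  | coe n =>
    induction n using WithTop.recTopCoe with
    | top => exact ⟨((⊤ : ℕ∞) : WithTop ℕ∞), rfl, by exact_mod_cast le_top⟩
    | coe n =>
      have hk' : ((2 : ℕ) : WithTop ℕ∞) ≤ ((n : ℕ) : WithTop ℕ∞) := hk
      have h2 : 2 ≤ n := by exact_mod_cast hk'
      refine ⟨((n - 1 : ℕ) : WithTop ℕ∞), ?_, by exact_mod_cast (by omega : 1 ≤ n - 1)⟩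
      change ((n : ℕ) : WithTop ℕ∞) = ((n - 1 : ℕ) : WithTop ℕ∞) + 1
      exact_mod_cast (by omega : n = n - 1 + 1)

theorem fderiv_eq_smul_of_gradient_eq {f : Plane → ℝ} {x n : Plane} {l : ℝ}
    (h : gradient f x = l • n) : fderiv ℝ f x = l • innerSL ℝ n := by
  ext v
  rw [← inner_gradient, h, real_inner_smul_left]
  simp

/-! ### Convex, flat and concave corners. -/

section CornerCases

variable {k : WithTop ℕ∞} {α : ℝ≥0} {K U : Set Plane} (B : PiecewiseBoundary k α U)
variable (hK : AdmissibleBody k α K) (hα : α ≤ 1) (hk : 2 ≤ k) {x y : Plane}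
variable (hU : IsOpen U) (hxU : x ∈ U) (hcl : IsClosestPoint K U x y)

namespace PiecewiseBoundary

theorem inner_perp_eq (i : Fin B.N) :
    ⟪perp (deriv (B.arc (B.next i)) 0), -deriv (B.arc i) 1⟫_ℝ =
      ⟪perp (deriv (B.arc i) 1), deriv (B.arc (B.next i)) 0⟫_ℝ := by
  rw [inner_perp_left, inner_perp_left, ← neg_inj, neg_neg, neg_neg, real_inner_comm, ← perpCLM_apply,
    map_neg, inner_neg_left, perpCLM_apply, inner_perp_left, neg_neg]

include hK hα hk hU hxU hcl

/-- The distance is minimal at `y` along both arcs, and neither outer normal leads into the touching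
ball; at an angle below `π` no gradient meets all four conditions. -/
theorem false_of_convex_corner {i : Fin B.N} (hy : B.arc i 1 = y) (h : B.openingAngle i < π) :
    False := by
  have hD := inner_perp_pos_of_ccwAngle_lt_pi h (B.no_cusp i)
  rw [B.inner_perp_eq] at hD
  obtain ⟨h1, h2⟩ := B.corner_first_order hK hα hk hU hxU hcl hy
  obtain ⟨h3, h4⟩ := B.corner_normal_nonneg hK hα hk hU hxU hcl hy (Or.inl hD)
  exact no_critical_of_convex_corner
    (hK.fderiv_gauge_ne_zero hα hk (sub_ne_zero.2 (hcl.ne hU hxU))) hD h1 h2 h3 h4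

theorem flat_corner {i : Fin B.N} (hy : B.arc i 1 = y) (h : B.openingAngle i = π) :
    (∃ l > (0 : ℝ), gradient (gauge K) (x - y) = l • leftNormal (B.arc i) 1) ∧
      ∃ m > (0 : ℝ), deriv (B.arc (B.next i)) 0 = m • deriv (B.arc i) 1 := by
  obtain ⟨h5, hD⟩ := ccwAngle_eq_pi_iff.1 h
  rw [B.inner_perp_eq] at hD
  rw [inner_neg_right, neg_lt_zero, real_inner_comm] at h5
  obtain ⟨h1, h2⟩ := B.corner_first_order hK hα hk hU hxU hcl hy
  obtain ⟨h3, h4⟩ := B.corner_normal_nonneg hK hα hk hU hxU hcl hy (Or.inr ⟨hD, h5⟩)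
  exact eq_smul_of_flat_corner
    (hK.fderiv_gauge_ne_zero hα hk (sub_ne_zero.2 (hcl.ne hU hxU))) (B.regular i 1 (by simp))
    hD h5 h1 h2 h3

/-- The first order conditions along the two arcs suffice here; the touching ball is not needed. -/
theorem concave_corner {i : Fin B.N} (hy : B.arc i 1 = y) (h : π < B.openingAngle i) :
    (⟪gradient (gauge K) (x - y), deriv (B.arc i) 1⟫_ℝ = 0 →
      (∃ l > (0 : ℝ), gradient (gauge K) (x - y) = l • leftNormal (B.arc i) 1) ∧
      ⟪gradient (gauge K) (x - y), deriv (B.arc (B.next i)) 0⟫_ℝ < 0) ∧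
    (⟪gradient (gauge K) (x - y), deriv (B.arc (B.next i)) 0⟫_ℝ = 0 →
      (∃ l > (0 : ℝ), gradient (gauge K) (x - y) = l • leftNormal (B.arc (B.next i)) 0) ∧
      0 < ⟪gradient (gauge K) (x - y), deriv (B.arc i) 1⟫_ℝ) := by
  have hD := pi_lt_ccwAngle_iff.1 h
  rw [B.inner_perp_eq] at hD
  obtain ⟨h1, h2⟩ := B.corner_first_order hK hα hk hU hxU hcl hy
  have hg := hK.fderiv_gauge_ne_zero hα hk (sub_ne_zero.2 (hcl.ne hU hxU))
  exact ⟨fun h3 => eq_smul_of_concave_corner hg (B.regular i 1 (by simp)) hD h3 h2,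
    fun h3 => eq_smul_of_concave_corner' hg (B.regular _ 0 (by simp)) hD h1 h3⟩

end PiecewiseBoundary

end CornerCases

/-! ### Projections to the two arcs at a corner. -/

section HalfProjection

variable {k : WithTop ℕ∞} {α : ℝ≥0} {K U : Set Plane} (B : PiecewiseBoundary k α U)

namespace PiecewiseBoundary

theorem ckAlphaAround_reparam (hα : α ≤ 1) (hk : 2 ≤ k) (i : Fin B.N) {t ε : ℝ}
    (ht : t ∈ Icc (0 : ℝ) 1) : CkAlphaAround k α (fun u => B.arc i (t + ε * u)) 0 :=
  CkAlphaAround.comp (g := B.arc i) (f := fun u : ℝ => t + ε * u) hα (le_trans (by norm_num) hk)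
    (by simpa using B.smooth i t ht)
    (CkAlphaAround.of_contDiff hα (contDiff_const.add (contDiff_const.mul contDiff_id)))

theorem reparam_mem_Icc {t ε u : ℝ} (hε : t = 0 ∧ ε = 1 ∨ t = 1 ∧ ε = -1)
    (hu : u ∈ Icc (0 : ℝ) 1) : t + ε * u ∈ Icc (0 : ℝ) 1 := by
  obtain ⟨h1, h2⟩ := hu
  rcases hε with ⟨rfl, rfl⟩ | ⟨rfl, rfl⟩ <;> constructor <;> linarith

/-- The parametrization of a segment is arbitrary, but its initial velocity is a limit of
nonnegative multiples of the chord. Testing with the chord `V` and with `perp V`, `-perp V` gives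
the direction. -/
theorem segment_direction (hk : 2 ≤ k) {i : Fin B.N} {t ε : ℝ}
    (hε : t = 0 ∧ ε = 1 ∨ t = 1 ∧ ε = -1)
    (hseg : B.arc i '' Icc (0 : ℝ) 1 = segment ℝ (B.arc i t) (B.arc i (1 - t))) :
    ∃ c > (0 : ℝ), B.arc i (1 - t) - B.arc i t = c • ε • deriv (B.arc i) t := by
  have ht : t ∈ Icc (0 : ℝ) 1 := by rcases hε with ⟨rfl, -⟩ | ⟨rfl, -⟩ <;> simp
  have hε0 : ε ≠ 0 := by rcases hε with ⟨-, rfl⟩ | ⟨-, rfl⟩ <;> norm_num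
  set V := B.arc i (1 - t) - B.arc i t with hV
  set a := ε • deriv (B.arc i) t with ha
  have ha0 : a ≠ 0 := smul_ne_zero hε0 (B.regular i t ht)
  have hd : DifferentiableAt ℝ (B.arc i) (t + ε * 0) := by
    simpa using ((B.contDiffAt_arc i ht).of_le hk).differentiableAt (by norm_num)
  have hder : ∀ w, (∀ θ : ℝ, 0 ≤ θ → 0 ≤ ⟪w, θ • V⟫_ℝ) → 0 ≤ ⟪w, a⟫_ℝ := by
    intro w hw
    have h1 : HasDerivAt (fun u => ⟪w, B.arc i (t + ε * u) - B.arc i t⟫_ℝ) ⟪w, a⟫_ℝ 0 := by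
      have := (innerSL ℝ w).hasFDerivAt.comp_hasDerivAt 0
        ((hasDerivAt_reparam hd).sub_const (B.arc i t))
      exact this.congr_deriv (by rw [innerSL_apply_apply, mul_zero, add_zero])
    refine first_deriv_nonneg_of_min h1 ?_
    filter_upwards [Ioo_mem_nhdsGT one_pos] with u hu
    have h2 : B.arc i (t + ε * u) ∈ segment ℝ (B.arc i t) (B.arc i (1 - t)) := by
      rw [← hseg]
      exact ⟨_, reparam_mem_Icc hε (Ioo_subset_Icc_self hu), rfl⟩
    rw [segment_eq_image'] at h2
    obtain ⟨θ, hθ, h3⟩ := h2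
    have h4 : B.arc i (t + ε * u) - B.arc i t = θ • V := by rw [← h3, hV]; simp
    rw [h4]
    simpa using hw θ hθ.1
  have hV0 : V ≠ 0 := by
    intro h
    have := hder (-a) (by simp [h])
    rw [inner_neg_left] at this
    linarith [real_inner_self_pos.2 ha0]
  have h1 : 0 ≤ ⟪V, a⟫_ℝ := hder V fun θ hθ => by
    rw [inner_smul_right]; exact mul_nonneg hθ real_inner_self_nonneg
  have h2 : ⟪a, perp V⟫_ℝ = 0 := by
    have h3 := hder (perp V) fun θ hθ => by rw [inner_smul_right]; simp
    have h4 := hder (-perp V) fun θ hθ => by rw [inner_smul_right]; simp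
    rw [inner_neg_left] at h4
    rw [real_inner_comm]; linarith
  have h5 := eq_smul_of_inner_perp_eq_zero hV0 h2
  rw [real_inner_comm] at h5
  set m := ⟪V, a⟫_ℝ / ‖V‖ ^ 2
  have hm : 0 < m := by
    refine lt_of_le_of_ne (by positivity) fun h => ha0 ?_
    rw [h5, ← h, zero_smul]
  exact ⟨m⁻¹, inv_pos.2 hm, by rw [h5, smul_smul, inv_mul_cancel₀ hm.ne', one_smul]⟩

theorem segment_eq_of_end {i : Fin B.N} {t : ℝ} (ht : t = 0 ∨ t = 1)
    (hseg : B.arc i '' Icc (0 : ℝ) 1 = segment ℝ (B.arc i 0) (B.arc i 1)) :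
    B.arc i '' Icc (0 : ℝ) 1 = segment ℝ (B.arc i t) (B.arc i (1 - t)) := by
  rcases ht with rfl | rfl
  · simpa using hseg
  · rw [hseg, segment_symm]; simp

variable (hK : AdmissibleBody k α K) (hα : α ≤ 1) (hk : 2 ≤ k) {x y : Plane}
include hK hα hk

/-- Either the second variation is positive and the implicit foot point is truncated, or the normal
is flat with curvature at most `0`. In the latter case the arc is a segment and the linear foot
point is used, with the full chord as unit of length. -/
theorem exists_halfProjection (hxy : x ≠ y) (hcl : IsClosestPoint K U x y) {i : Fin B.N} {t ε l : ℝ}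
    (hε : t = 0 ∧ ε = 1 ∨ t = 1 ∧ ε = -1) (hy : B.arc i t = y) (hl : 0 < l)
    (hg : gradient (gauge K) (x - y) = l • leftNormal (B.arc i) t)
    (hκ : curvatureK K (B.arc i) t * gauge K (x - y) ≠ 1)
    (hflat : unitNormal (B.arc i) t ∈ flatNormals K → 0 < curveCurvature (B.arc i) t ∨
      B.arc i '' Icc (0 : ℝ) 1 = segment ℝ (B.arc i 0) (B.arc i 1)) :
    HasHalfProjection K (frontier U) (B.halfArc i t) x y (ε • deriv (B.arc i) t) := by
  have ht : t ∈ Icc (0 : ℝ) 1 := by rcases hε with ⟨rfl, -⟩ | ⟨rfl, -⟩ <;> simp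
  have ht' : t = 0 ∨ t = 1 := hε.imp And.left And.left
  have hε' : ε = 1 ∨ ε = -1 := hε.imp And.right And.right
  have hε2 : ε * ε = 1 := by rcases hε' with rfl | rfl <;> norm_num
  obtain ⟨j, hkj, hj⟩ := exists_eq_add_one hk
  have hc : ContDiffAt ℝ 2 (B.arc i) t := (B.contDiffAt_arc i ht).of_le hk
  have hc0 := B.regular i t ht
  have hp := fderiv_eq_smul_of_gradient_eq hg
  have hxy' : x - y ≠ 0 := sub_ne_zero.2 hxy
  have hpc : fderiv ℝ (gauge K) (x - y) (deriv (B.arc i) t) = 0 := by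
    rw [hp, smul_apply, innerSL_apply_apply, leftNormal, inner_perp_self, smul_zero]
  subst hy
  have hmin : ∀ᶠ u in 𝓝[>] (0 : ℝ),
      gauge K (x - B.arc i t) ≤ gauge K (x - B.arc i (t + ε * u)) := by
    filter_upwards [Ioo_mem_nhdsGT one_pos] with u hu
    exact hcl.2 _ (B.arc_mem_frontier i (reparam_mem_Icc hε (Ioo_subset_Icc_self hu)))
  rcases hK.second_derivative_pos_or_flat hα hk hε' hc hc0 hxy' hl hp hmin hκ with
    ⟨-, hpos⟩ | ⟨hfl, hκ0⟩
  · set e : ℝ → Plane := fun u => B.arc i (t + ε * u) with he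
    have he0 : e 0 = B.arc i t := by simp [he]
    have hde : deriv e 0 = ε • deriv (B.arc i) t := deriv_reparam (hc.differentiableAt (by norm_num))
    obtain ⟨s, hs, hfoot, -⟩ := hK.exists_foot hα hk (x := x) hj hkj
      (e := e) (B.ckAlphaAround_reparam hα hk i (ε := ε) ht) (by rwa [he0])
      (by rw [distSlope, he0, hde, map_smul, hpc]; simp) (by
        rw [he0, hde, deriv_deriv_reparam hε2 hc]
        simp only [map_smul, smul_apply, smul_eq_mul]
        rw [← mul_assoc, hε2, one_mul]
        exact hpos)
    refine hK.hasHalfProjection_of_foot hα hk hfoot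
      ((contDiffAt_reparam hc).of_le (by norm_num)) he0 hxy (hs.contDiffAt.of_le hj) ?_ ?_ one_pos
      (by rw [hde, one_smul])
    · filter_upwards [Icc_mem_nhdsGE one_pos] with u hu
      exact B.arc_mem_frontier i (reparam_mem_Icc hε hu)
    · intro δ hδ
      obtain ⟨r, hr, h⟩ := B.exists_halfArc_ball i ht' hδ
      refine ⟨r, hr, fun w hw => ?_⟩
      obtain ⟨s, hs, hst, rfl⟩ := h w hw
      refine ⟨ε * (s - t), ?_, by rw [he]; dsimp only; rw [← mul_assoc, hε2, one_mul, add_sub_cancel]⟩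
      rw [abs_lt] at hst
      rcases hε with ⟨rfl, rfl⟩ | ⟨rfl, rfl⟩ <;> constructor <;> linarith [hs.1, hs.2]
  · have hseg := B.segment_eq_of_end ht' ((hflat hfl).resolve_left hκ0.not_gt)
    obtain ⟨c, hc, hV⟩ := B.segment_direction hk hε hseg
    set V := B.arc i (1 - t) - B.arc i t with hVdef
    have hε0 : ε ≠ 0 := by rintro rfl; norm_num at hε2
    have hV0 : V ≠ 0 := by
      rw [hV]; exact smul_ne_zero hc.ne' (smul_ne_zero hε0 hc0)
    obtain ⟨s, hs, hfoot⟩ := hK.exists_foot_line hα hk (j := j) hxy' hV0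
      (by rw [hV, map_smul, map_smul, hpc, smul_zero, smul_zero])
    have hder : HasDerivAt (fun u : ℝ => B.arc i t + u • V) V 0 := by
      simpa using ((hasDerivAt_id (0 : ℝ)).smul_const V).const_add (B.arc i t)
    rw [segment_eq_image'] at hseg
    refine hK.hasHalfProjection_of_foot hα hk hfoot (by fun_prop) (by simp) hxy
      (hs.contDiffAt.of_le hj) ?_ ?_ hc (by rw [hder.deriv, hV])
    · filter_upwards [Icc_mem_nhdsGE one_pos] with u hu
      have : B.arc i t + u • V ∈ B.arc i '' Icc (0 : ℝ) 1 := by rw [hseg]; exact ⟨u, hu, rfl⟩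
      obtain ⟨s, hs, h⟩ := this
      rw [← h]
      exact B.arc_mem_frontier i hs
    · intro δ hδ
      -- The line is parametrized with velocity `V`, so parameters below `δ` correspond to distances
      -- below `δ ‖V‖`.
      refine ⟨δ * ‖V‖, mul_pos hδ (norm_pos_iff.2 hV0), ?_⟩
      rintro _ ⟨⟨s, hs, rfl⟩, hw⟩
      have : B.arc i s ∈ B.arc i '' Icc (0 : ℝ) 1 := ⟨s, hs.1, rfl⟩
      rw [hseg] at this
      obtain ⟨θ, hθ, h⟩ := this
      simp only at h
      refine ⟨θ, ⟨hθ.1, ?_⟩, h.symm⟩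
      rw [Metric.mem_ball, dist_eq_norm, ← h, add_sub_cancel_left, norm_smul, Real.norm_eq_abs,
        abs_of_nonneg hθ.1] at hw
      exact lt_of_mul_lt_mul_right hw (norm_nonneg _)

theorem halfProjection_of_neg (hxy : x ≠ y) {i : Fin B.N} {t ε : ℝ}
    (hε : t = 0 ∧ ε = 1 ∨ t = 1 ∧ ε = -1) (hy : B.arc i t = y)
    (hneg : fderiv ℝ (gauge K) (x - y) (ε • deriv (B.arc i) t) < 0) :
    HasHalfProjection K (frontier U) (B.halfArc i t) x y (ε • deriv (B.arc i) t) ∧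
      ∃ r > 0, ∀ᶠ z in 𝓝 x, ∀ w ∈ B.halfArc i t ∩ Metric.ball y r,
        gauge K (z - y) ≤ gauge K (z - w) := by
  have ht : t ∈ Icc (0 : ℝ) 1 := by rcases hε with ⟨rfl, -⟩ | ⟨rfl, -⟩ <;> simp
  have ht' : t = 0 ∨ t = 1 := hε.imp And.left And.left
  have hc : ContDiffAt ℝ 2 (B.arc i) t := (B.contDiffAt_arc i ht).of_le hk
  subst hy
  refine hK.hasHalfProjection_of_neg hα hk (e := fun u => B.arc i (t + ε * u))
    ((contDiffAt_reparam hc).of_le (by norm_num)) (by simp) hxy (B.arc_mem_frontier i ht) ?_ one_pos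
    (by rw [deriv_reparam (hc.differentiableAt (by norm_num)), one_smul]) hneg
  intro δ hδ
  obtain ⟨r, hr, h⟩ := B.exists_halfArc_ball i ht' hδ
  refine ⟨r, hr, fun w hw => ?_⟩
  obtain ⟨s, hs, hst, rfl⟩ := h w hw
  have hε2 : ε * ε = 1 := by rcases hε with ⟨-, rfl⟩ | ⟨-, rfl⟩ <;> norm_num
  refine ⟨ε * (s - t), ?_, by rw [← mul_assoc, hε2, one_mul, add_sub_cancel]⟩
  rw [abs_lt] at hst
  rcases hε with ⟨rfl, rfl⟩ | ⟨rfl, rfl⟩ <;> constructor <;> linarith [hs.1, hs.2]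

end PiecewiseBoundary

end HalfProjection

/-! ### Regularity over reentrant corners. -/

namespace Setting

variable {k : WithTop ℕ∞} {α : ℝ≥0} {K U : Set Plane} {B : PiecewiseBoundary k α U} {x y : Plane}
variable (S : Setting K B x y) (hα : α ≤ 1) (hk : 2 ≤ k)

include S

theorem ne : x ≠ y := S.closest.ne S.isOpen S.mem.1

theorem unique (w : Plane) (hw : IsClosestPoint K U x w) : w = y := by
  by_contra h
  exact S.mem.2 ⟨S.mem.1, w, y, h, hw, S.closest⟩

theorem distK_eq : distK K U x = gauge K (x - y) :=
  IsLeast.csInf_eq ⟨⟨y, S.closest.1, rfl⟩, by rintro _ ⟨w, hw, rfl⟩; exact S.closest.2 w hw⟩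

theorem flat_of_reentrant {i : Fin B.N} (h : π ≤ B.openingAngle i) :
    (unitNormal (B.arc i) 1 ∈ flatNormals K → 0 < curveCurvature (B.arc i) 1 ∨
      B.arc i '' Icc (0 : ℝ) 1 = segment ℝ (B.arc i 0) (B.arc i 1)) ∧
    (unitNormal (B.arc (B.next i)) 0 ∈ flatNormals K → 0 < curveCurvature (B.arc (B.next i)) 0 ∨
      B.arc (B.next i) '' Icc (0 : ℝ) 1 =
        segment ℝ (B.arc (B.next i) 0) (B.arc (B.next i) 1)) :=
  ⟨S.flatCompatible i 1 (by simp) (Or.inr ⟨i, rfl, h⟩),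
    S.flatCompatible _ 0 (by simp) (Or.inr ⟨i, by rw [B.joined], h⟩)⟩

include hα hk

theorem c11_of_halfProjections {i : Fin B.N} (hy : B.arc i 1 = y) {v₁ v₂ : Plane}
    (h₁ : HasHalfProjection K (frontier U) (B.halfArc i 1) x y v₁)
    (h₂ : HasHalfProjection K (frontier U) (B.halfArc (B.next i) 0) x y v₂)
    (hex : ∀ᶠ z in 𝓝 x, ¬ (0 < fderiv ℝ (gauge K) (z - y) v₁ ∧
      0 < fderiv ℝ (gauge K) (z - y) v₂)) : CkAlphaAround 1 1 (distK K U) x := by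
  obtain ⟨q, hqx, hq, r, hr, hmin⟩ := h₁.combine h₂ (hy ▸ B.exists_ball_subset_halfArc i)
    (hy ▸ B.arc_mem_halfArc i (by simp))
    (by rw [← hy, B.joined]; exact B.arc_mem_halfArc _ (by simp)) hex
  have hqc := (eventually_continuousAt_of_isBigO hq).self_of_nhds
  have hd := S.body.eventually_distK_eq S.bounded S.closest S.unique hqx hqc hr hmin
  refine c11Around_envelope (g := gauge K) ?_ hq hd
  rw [hqx]
  exact S.body.contDiffAt_gauge hα hk (sub_ne_zero.2 S.ne)

/-- By duality: `Dγ` is constant on rays, and the `K`-normal is the support point of `ν`, where `Dγ`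
is `ν / γ°(ν)`. This translates the geometric condition on `x - y` into one on the gradient. -/
theorem sameRay_normalK_iff {i : Fin B.N} {t : ℝ} (ht : t ∈ Icc (0 : ℝ) 1) :
    SameRay ℝ (x - y) (normalK K (B.arc i) t) ↔
      ∃ l > (0 : ℝ), gradient (gauge K) (x - y) = l • leftNormal (B.arc i) t := by
  have hK := S.body
  have hν := leftNormal_ne_zero (B.regular i t ht)
  have hxy := sub_ne_zero.2 S.ne
  have hP := hK.supportPoint_ne_zero hν
  rw [hK.normalK_eq hα hk _ hν]
  constructor
  · intro h
    obtain ⟨r, hr, h1⟩ := h.exists_pos_right hxy hP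
    refine ⟨(polarGauge K (leftNormal (B.arc i) t))⁻¹, inv_pos.2 (hK.polarGauge_pos hν), ?_⟩
    refine ext_inner_right ℝ fun v => ?_
    rw [inner_gradient, h1, hK.fderiv_gauge_smul hα hk hr hP, hK.fderiv_gauge_supportPoint hα hk hν,
      real_inner_smul_left]
    simp
  · rintro ⟨l, hl, h⟩
    have h1 := hK.eq_smul_supportPoint hα hk hxy hν hl (fderiv_eq_smul_of_gradient_eq h)
    rw [h1.1]
    exact SameRay.sameRay_nonneg_smul_left _ (gauge_nonneg _)

theorem eventually_fderiv_neg {v : Plane} (h : fderiv ℝ (gauge K) (x - y) v < 0) :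
    ∀ᶠ z in 𝓝 x, fderiv ℝ (gauge K) (z - y) v < 0 := by
  have h1 : ContinuousAt (fun z => fderiv ℝ (gauge K) (z - y) v) x := by
    have h2 : ContinuousAt (fderiv ℝ (gauge K)) (x - y) :=
      (S.body.hasFDerivAt_fderiv_gauge hα hk (sub_ne_zero.2 S.ne)).continuousAt
    exact (ContinuousAt.comp (g := fderiv ℝ (gauge K)) (f := fun z => z - y) h2
      (continuousAt_id.sub continuousAt_const)).clm_apply continuousAt_const
  exact h1.eventually (gt_mem_nhds h)

/-- At a strict reentrant corner, away from the two normals, the corner is the closest point. -/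
theorem strict_corner {i : Fin B.N} (hy : B.arc i 1 = y) (h : π < B.openingAngle i)
    (h₁ : ¬ SameRay ℝ (x - y) (normalK K (B.arc i) 1))
    (h₂ : ¬ SameRay ℝ (x - y) (normalK K (B.arc (B.next i)) 0)) :
    (∀ᶠ z in 𝓝 x, distK K U z = gauge K (z - y)) ∧ CkAlphaAround k α (distK K U) x := by
  have hK := S.body
  have hc := B.concave_corner hK hα hk S.isOpen S.mem.1 S.closest hy h
  have hf := B.corner_first_order hK hα hk S.isOpen S.mem.1 S.closest hy
  rw [S.sameRay_normalK_iff hα hk (by simp)] at h₁ h₂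
  have hy' : B.arc (B.next i) 0 = y := by rw [← B.joined, hy]
  -- Off the two normals both first order inequalities are strict, so the distance increases from
  -- `y` along either arc.
  obtain ⟨-, r₁, hr₁, e₁⟩ := B.halfProjection_of_neg hK hα hk S.ne (Or.inr ⟨rfl, rfl⟩) hy (by
    rw [map_smul, ← inner_gradient, smul_eq_mul]
    linarith [lt_of_le_of_ne hf.1 fun h => h₁ (hc.1 h.symm).1])
  obtain ⟨-, r₂, hr₂, e₂⟩ := B.halfProjection_of_neg hK hα hk S.ne (Or.inl ⟨rfl, rfl⟩) hy' (by
    rw [map_smul, ← inner_gradient, smul_eq_mul]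
    linarith [lt_of_le_of_ne hf.2 fun h => h₂ (hc.2 h).1])
  obtain ⟨r, hr, hA⟩ := B.exists_ball_subset_halfArc i
  rw [hy] at hA
  have hd := hK.eventually_distK_eq S.bounded S.closest S.unique (q := fun _ => y) rfl
    continuousAt_const (r := min r (min r₁ r₂)) (lt_min hr (lt_min hr₁ hr₂)) (by
      filter_upwards [e₁, e₂] with z e₁ e₂
      refine ⟨S.closest.1, fun w hw => ?_⟩
      have hb := Metric.mem_ball.1 hw.2
      rw [lt_min_iff, lt_min_iff] at hb
      exact (hA ⟨hw.1, Metric.mem_ball.2 hb.1⟩).elim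
        (fun h => e₁ w ⟨h, Metric.mem_ball.2 hb.2.1⟩)
        fun h => e₂ w ⟨h, Metric.mem_ball.2 hb.2.2⟩)
  have hd' : ∀ᶠ z in 𝓝 x, distK K U z = gauge K (z - y) := hd.mono fun z hz => hz.1
  refine ⟨hd', CkAlphaAround.congr ?_ (EventuallyEq.symm hd')⟩
  have h1 : (1 : WithTop ℕ∞) ≤ k := le_trans (by norm_num) hk
  exact CkAlphaAround.comp (g := gauge K) (f := fun z => z - y) hα h1
    (hK.ckAlphaAround_gauge hα h1 (sub_ne_zero.2 S.ne))
    (CkAlphaAround.of_contDiff hα (contDiff_id.sub contDiff_const))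

/-- Critical along one arc means strictly noncritical along the other. The first arc contributes a
truncated foot point, the second only the corner. -/
theorem strict_corner_left {i : Fin B.N} (hy : B.arc i 1 = y) (h : π < B.openingAngle i)
    (h₁ : SameRay ℝ (x - y) (normalK K (B.arc i) 1))
    (hκ : curvatureK K (B.arc i) 1 * distK K U x ≠ 1) : CkAlphaAround 1 1 (distK K U) x := by
  have hK := S.body
  obtain ⟨l, hl, hg⟩ := (S.sameRay_normalK_iff hα hk (by simp)).1 h₁
  have hneg := ((B.concave_corner hK hα hk S.isOpen S.mem.1 S.closest hy h).1 (by
    rw [hg, real_inner_smul_left, leftNormal, inner_perp_self, mul_zero])).2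
  rw [inner_gradient] at hneg
  refine S.c11_of_halfProjections hα hk hy
    (B.exists_halfProjection hK hα hk S.ne S.closest (Or.inr ⟨rfl, rfl⟩) hy hl hg
      (by rwa [← S.distK_eq]) (S.flat_of_reentrant h.le).1)
    (B.halfProjection_of_neg hK hα hk S.ne (Or.inl ⟨rfl, rfl⟩) (by rw [← B.joined, hy])
      (by rwa [one_smul])).1 ?_
  filter_upwards [S.eventually_fderiv_neg hα hk hneg] with z hz
  rw [one_smul]
  exact fun h => h.2.not_gt hz

theorem strict_corner_right {i : Fin B.N} (hy : B.arc i 1 = y) (h : π < B.openingAngle i)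
    (h₁ : SameRay ℝ (x - y) (normalK K (B.arc (B.next i)) 0))
    (hκ : curvatureK K (B.arc (B.next i)) 0 * distK K U x ≠ 1) :
    CkAlphaAround 1 1 (distK K U) x := by
  have hK := S.body
  obtain ⟨l, hl, hg⟩ := (S.sameRay_normalK_iff hα hk (by simp)).1 h₁
  have hpos := ((B.concave_corner hK hα hk S.isOpen S.mem.1 S.closest hy h).2 (by
    rw [hg, real_inner_smul_left, leftNormal, inner_perp_self, mul_zero])).2
  have hneg : fderiv ℝ (gauge K) (x - y) ((-1 : ℝ) • deriv (B.arc i) 1) < 0 := by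
    rw [map_smul, ← inner_gradient, smul_eq_mul]; linarith
  refine S.c11_of_halfProjections hα hk hy
    (B.halfProjection_of_neg hK hα hk S.ne (Or.inr ⟨rfl, rfl⟩) hy hneg).1
    (B.exists_halfProjection hK hα hk S.ne S.closest (Or.inl ⟨rfl, rfl⟩) (by rw [← B.joined, hy])
      hl hg (by rwa [← S.distK_eq]) (S.flat_of_reentrant h.le).2) ?_
  filter_upwards [S.eventually_fderiv_neg hα hk hneg] with z hz
  exact fun h => h.1.not_gt hz

theorem flat_corner {i : Fin B.N} (hy : B.arc i 1 = y) (h : B.openingAngle i = π)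
    (hκ₁ : curvatureK K (B.arc i) 1 * distK K U x ≠ 1)
    (hκ₂ : curvatureK K (B.arc (B.next i)) 0 * distK K U x ≠ 1) :
    CkAlphaAround 1 1 (distK K U) x := by
  have hK := S.body
  obtain ⟨⟨l, hl, hg⟩, m, hm, hb⟩ := B.flat_corner hK hα hk S.isOpen S.mem.1 S.closest hy h
  have hg' : gradient (gauge K) (x - y) = (l / m) • leftNormal (B.arc (B.next i)) 0 := by
    rw [hg, leftNormal, leftNormal, hb, perp_smul, smul_smul, div_mul_cancel₀ _ hm.ne']
  have hfl := S.flat_of_reentrant h.ge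
  rw [S.distK_eq] at hκ₁ hκ₂
  refine S.c11_of_halfProjections hα hk hy
    (B.exists_halfProjection hK hα hk S.ne S.closest (Or.inr ⟨rfl, rfl⟩) hy hl hg hκ₁ hfl.1)
    (B.exists_halfProjection hK hα hk S.ne S.closest (Or.inl ⟨rfl, rfl⟩) (by rw [← B.joined, hy])
      -- Both arcs may move the foot point, but they leave `y` in opposite directions, so no `Dγ(z -
      -- y)` is positive on both.
      (div_pos hl hm) hg' hκ₂ hfl.2) (Eventually.of_forall fun z hz => ?_)
  rw [hb, one_smul, map_smul, map_smul, smul_eq_mul, smul_eq_mul] at hz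
  have := pos_of_mul_pos_right hz.2 hm.le
  linarith [hz.1]

end Setting

/-! ### Closest points inside an arc: regularity and the Hessian. -/

theorem laplacian_eq_of_fderiv_fderiv {f : Plane → ℝ} {x ζ : Plane} {L : ℝ} (hζ : ‖ζ‖ = 1)
    (h : ∀ v w, fderiv ℝ (fderiv ℝ f) x v w = L * ⟪v, ζ⟫_ℝ * ⟪w, ζ⟫_ℝ) :
    Laplacian.laplacian f x = L := by
  rw [InnerProductSpace.laplacian_eq_iteratedFDeriv_orthonormalBasis f
    (EuclideanSpace.basisFun (Fin 2) ℝ)]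
  simp only [iteratedFDeriv_two_apply, h, Fin.sum_univ_two, plane_inner]
  have h1 := plane_norm_sq ζ
  rw [hζ] at h1
  simp
  linear_combination -L * h1

namespace Setting

variable {k : WithTop ℕ∞} {α : ℝ≥0} {K U : Set Plane} {B : PiecewiseBoundary k α U} {x y : Plane}
variable (S : Setting K B x y) (hα : α ≤ 1) (hk : 2 ≤ k)

include S hα hk

theorem regular_of_foot {j : WithTop ℕ∞} (hj : 1 ≤ j) (hkj : k = j + 1) {e : ℝ → Plane}
    {s : Plane → ℝ} (he : CkAlphaAround j α e 0) (hs : CkAlphaAround j α s x)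
    (h : HasFoot K e x s) (hey : e 0 = y) (hA : ∀ᶠ u in 𝓝 (0 : ℝ), e u ∈ frontier U)
    (hS : ∀ δ > 0, ∃ r > 0, ∀ w ∈ frontier U ∩ Metric.ball y r, ∃ u : ℝ, |u| < δ ∧ w = e u) :
    CkAlphaAround k α (distK K U) x ∧
      ∀ᶠ z in 𝓝 x, HasFDerivAt (distK K U) (fderiv ℝ (gauge K) (z - e (s z))) z := by
  have hK := S.body
  have hx' : x - e 0 ≠ 0 := by rw [hey]; exact sub_ne_zero.2 S.ne
  have he1 := he.contDiffAt.of_le hj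
  obtain ⟨δ, hδ, hle⟩ := h.le hK hα hk he1 hx'
  have hs0 := h.1
  have hq : CkAlphaAround j α (fun z => e (s z)) x :=
    CkAlphaAround.comp (g := e) (f := s) hα hj (by rwa [hs0]) hs
  have hqx : e (s x) = y := by rw [hs0, hey]
  have hst : Tendsto s (𝓝 x) (𝓝 0) := by
    have := hs.contDiffAt.continuousAt.tendsto
    rwa [hs0] at this
  obtain ⟨r, hr, hSr⟩ := hS δ hδ
  have hd := hK.eventually_distK_eq S.bounded S.closest S.unique (q := fun z => e (s z)) hqx
    hq.contDiffAt.continuousAt hr (by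
      filter_upwards [hle, hst.eventually hA, hst.eventually (Metric.ball_mem_nhds 0 hδ)]
        with z h1 h2 h3
      refine ⟨h2, fun w hw => ?_⟩
      obtain ⟨u, hu, rfl⟩ := hSr w hw
      rw [Real.dist_eq, sub_zero] at h3
      exact h1 (s z) u h3 hu ((le_total (s z) u).imp (fun h => ⟨le_rfl, h⟩) fun h => ⟨h, le_rfl⟩))
  have hX : x - e (s x) ≠ 0 := by rwa [hs0]
  constructor
  · rw [hkj]
    refine ckAlphaAround_envelope (g := gauge K) hα hj ?_ hq hd
    rw [← hkj]
    exact hK.ckAlphaAround_gauge hα (le_trans (by norm_num) hk) hX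
  · refine eventually_hasFDerivAt_envelope (g := gauge K)
      ((hK.contDiffAt_gauge hα hk hX).of_le (by norm_num)) ?_ hd
    exact ((hq.contDiffAt.of_le hj).eventually (by simp)).mono fun z hz => hz.continuousAt

theorem fderiv_fderiv_of_foot {e : ℝ → Plane} {s : Plane → ℝ} (he : DifferentiableAt ℝ e 0)
    (hs : DifferentiableAt ℝ s x) (hs0 : s x = 0) (hey : e 0 = y)
    (hd : ∀ᶠ z in 𝓝 x, HasFDerivAt (distK K U) (fderiv ℝ (gauge K) (z - e (s z))) z) (v w : Plane) :
    fderiv ℝ (fderiv ℝ (distK K U)) x v w =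
      fderiv ℝ (fderiv ℝ (gauge K)) (x - y) (v - fderiv ℝ s x v • deriv e 0) w := by
  have h1 : fderiv ℝ (distK K U) =ᶠ[𝓝 x] fun z => fderiv ℝ (gauge K) (z - e (s z)) :=
    hd.mono fun z hz => hz.fderiv
  have h2 : HasFDerivAt (fun z => e (s z)) ((fderiv ℝ s x).smulRight (deriv e 0)) x := by
    have h3 : HasDerivAt e (deriv e 0) (s x) := by rw [hs0]; exact he.hasDerivAt
    exact h3.hasFDerivAt.comp x hs.hasFDerivAt |>.congr_fderiv (by ext; simp)
  have h3 : HasFDerivAt (fun z => z - e (s z))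
      (ContinuousLinearMap.id ℝ Plane - (fderiv ℝ s x).smulRight (deriv e 0)) x :=
    (hasFDerivAt_id x).sub h2
  have h4 : x - e (s x) = x - y := by rw [hs0, hey]
  have h5 := S.body.hasFDerivAt_fderiv_gauge hα hk (z := x - e (s x))
    (by rw [h4]; exact sub_ne_zero.2 S.ne)
  have h6 := h5.comp x h3
  rw [h1.fderiv_eq]
  rw [show (fun z => fderiv ℝ (gauge K) (z - e (s z))) =
    fderiv ℝ (gauge K) ∘ fun z => z - e (s z) from rfl, h6.fderiv, h4]
  simp

/-- Differentiate the equation `Dγ(z - e(s z)) e'(s z) = 0` of the foot point. -/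
theorem fderiv_foot {e : ℝ → Plane} {s : Plane → ℝ} (he : ContDiffAt ℝ 2 e 0)
    (hs : DifferentiableAt ℝ s x) (hs0 : s x = 0) (hey : e 0 = y)
    (h : ∀ᶠ z in 𝓝 x, distSlope K e z (s z) = 0) (v : Plane) :
    fderiv ℝ (fderiv ℝ (gauge K)) (x - y) v (deriv e 0) = fderiv ℝ s x v *
      (fderiv ℝ (fderiv ℝ (gauge K)) (x - y) (deriv e 0) (deriv e 0) -
        fderiv ℝ (gauge K) (x - y) (deriv (deriv e) 0)) := by
  have hed := he.differentiableAt (by norm_num)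
  have h2 : HasFDerivAt (fun z => e (s z)) ((fderiv ℝ s x).smulRight (deriv e 0)) x := by
    have h3 : HasDerivAt e (deriv e 0) (s x) := by rw [hs0]; exact hed.hasDerivAt
    exact h3.hasFDerivAt.comp x hs.hasFDerivAt |>.congr_fderiv (by ext; simp)
  have h2' : HasFDerivAt (fun z => deriv e (s z)) ((fderiv ℝ s x).smulRight (deriv (deriv e) 0)) x := by
    have h4 : ContDiffAt ℝ 1 (deriv e) 0 :=
      ContDiffAt.clm_apply (he.fderiv_right (m := 1) (by norm_num)) contDiffAt_const
    have h3 : HasDerivAt (deriv e) (deriv (deriv e) 0) (s x) := by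
      rw [hs0]; exact (h4.differentiableAt (by norm_num)).hasDerivAt
    exact h3.hasFDerivAt.comp x hs.hasFDerivAt |>.congr_fderiv (by ext; simp)
  have h3 : HasFDerivAt (fun z => z - e (s z))
      (ContinuousLinearMap.id ℝ Plane - (fderiv ℝ s x).smulRight (deriv e 0)) x :=
    (hasFDerivAt_id x).sub h2
  have h4 : x - e (s x) = x - y := by rw [hs0, hey]
  have h5 := S.body.hasFDerivAt_fderiv_gauge hα hk (z := x - e (s x))
    (by rw [h4]; exact sub_ne_zero.2 S.ne)
  have h6 := (h5.comp x h3).clm_apply h2'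
  have h7 : HasFDerivAt (fun z => fderiv ℝ (gauge K) (z - e (s z)) (deriv e (s z)))
      (0 : Plane →L[ℝ] ℝ) x := by
    refine (hasFDerivAt_const (0 : ℝ) x).congr_of_eventuallyEq (h.mono fun z hz => ?_)
    rw [distSlope, neg_eq_zero] at hz
    exact hz
  have h8 := congrArg (fun L => L v) (h6.unique h7)
  rw [h4] at h8
  simp [hs0, hey] at h8
  linear_combination h8

end Setting

/-- Both sides are the squared area of the parallelogram spanned by `a` and `P`. -/
theorem inner_sq_mul_norm_sq {a P ζ : Plane} (hP : P ≠ 0) (hζ : ‖ζ‖ = 1) (h : ⟪ζ, P⟫_ℝ = 0) :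
    ⟪a, ζ⟫_ℝ ^ 2 * ‖P‖ ^ 2 = ⟪perp a, P⟫_ℝ ^ 2 := by
  have h1 := eq_smul_perp_of_inner_eq_zero hP h
  set b := ⟪ζ, perp P⟫_ℝ / ‖P‖ ^ 2
  have h2 : b ^ 2 * ‖P‖ ^ 2 = 1 := by
    rw [h1, norm_smul, norm_perp, Real.norm_eq_abs] at hζ
    rw [← sq_abs b, ← mul_pow, hζ, one_pow]
  rw [h1, inner_smul_right, inner_perp_left]
  linear_combination ⟪a, perp P⟫_ℝ ^ 2 * h2

/-- In the application `m` is `D²γ(ζ, ζ)`; `a`, `b`, `c` are the components of `v`, `w` and the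
velocity along `ζ`; `D` is `Ds(v)`; `N` is `‖ν‖³`, `P` is `‖Dγ°(ν)‖²`, `h` is `γ°(ν)` and `e` is
`κ_K d`. -/
theorem hessian_algebra {m a b c D κ N P h e : ℝ} (hm : m * c * c ≠ 0) (hc : c ^ 2 * P = h ^ 2)
    (hh : h ≠ 0) (hκ : m * c * c * e = κ * N / h) (he : 1 - e ≠ 0)
    (hD : m * a * c = D * (m * c * c * (1 - e))) :
    m * (a - D * c) * b = -(κ * N * P) / (h ^ 3 * (1 - e)) * a * b := by
  have hm0 : m ≠ 0 := fun h => hm (by rw [h]; ring)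
  have hc0 : c ≠ 0 := fun h => hm (by rw [h]; ring)
  have h1 : D = a / (c * (1 - e)) := by
    field_simp
    refine mul_left_cancel₀ (mul_ne_zero hm0 hc0) ?_
    linear_combination -hD
  have h2 : κ * N * P = m * h ^ 3 * e := by
    rw [eq_div_iff hh] at hκ
    linear_combination (-P) * hκ + m * e * h * hc
  rw [h1, h2]
  field_simp
  ring

theorem curveCurvature_eq_zero_of_segment {c : ℝ → Plane} {t : ℝ} {p V : Plane} (hV : V ≠ 0)
    (hc : ContDiffAt ℝ 2 c t) (h : ∀ᶠ s in 𝓝 t, ∃ θ : ℝ, c s = p + θ • V) :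
    ⟪deriv c t, perp V⟫_ℝ = 0 ∧ curveCurvature c t = 0 := by
  have h0 : (fun s => ⟪c s, perp V⟫_ℝ) =ᶠ[𝓝 t] fun _ => ⟪p, perp V⟫_ℝ := by
    filter_upwards [h] with s ⟨θ, hs⟩
    rw [hs, inner_add_left, real_inner_smul_left, inner_self_perp, mul_zero, add_zero]
  have h1 : ∀ᶠ s in 𝓝 t, ⟪deriv c s, perp V⟫_ℝ = 0 := by
    filter_upwards [h0.eventuallyEq_nhds, hc.eventually (by simp)] with s h1 h2
    have h3 : HasDerivAt (fun s => ⟪c s, perp V⟫_ℝ) ⟪deriv c s, perp V⟫_ℝ s := by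
      simpa using (h2.differentiableAt (by norm_num)).hasDerivAt.inner ℝ (hasDerivAt_const s (perp V))
    exact h3.unique ((hasDerivAt_const s _).congr_of_eventuallyEq h1)
  have h2 : ⟪deriv (deriv c) t, perp V⟫_ℝ = 0 := by
    have h4 : ContDiffAt ℝ 1 (deriv c) t :=
      ContDiffAt.clm_apply (hc.fderiv_right (m := 1) (by norm_num)) contDiffAt_const
    have h3 : HasDerivAt (fun s => ⟪deriv c s, perp V⟫_ℝ) ⟪deriv (deriv c) t, perp V⟫_ℝ t := by
      simpa using (h4.differentiableAt (by norm_num)).hasDerivAt.inner ℝ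
        (hasDerivAt_const t (perp V))
    exact h3.unique ((hasDerivAt_const t _).congr_of_eventuallyEq h1)
  refine ⟨h1.self_of_nhds, ?_⟩
  have h3 := eq_smul_of_inner_perp_eq_zero hV h1.self_of_nhds
  rw [curveCurvature_eq hc, leftNormal, h3, perp_smul, inner_smul_right, h2, mul_zero, zero_div]

namespace Setting

variable {k : WithTop ℕ∞} {α : ℝ≥0} {K U : Set Plane} {B : PiecewiseBoundary k α U} {x y : Plane}
variable (S : Setting K B x y) (hα : α ≤ 1) (hk : 2 ≤ k)

include S hα hk

/-- All second derivatives reduce to components along `ζ`, because the Hessian of `γ` annihilates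
the radial direction. The derivative of the foot parameter is eliminated with its linear equation,
whose coefficient is the second variation. -/
theorem interior_nonflat {i : Fin B.N} {t l : ℝ} (ht : t ∈ Ioo (0 : ℝ) 1) (hy : B.arc i t = y)
    (hl : 0 < l) (hg : gradient (gauge K) (x - y) = l • leftNormal (B.arc i) t)
    (hflat : unitNormal (B.arc i) t ∉ flatNormals K)
    (hpos : 0 < fderiv ℝ (fderiv ℝ (gauge K)) (x - y) (deriv (B.arc i) t) (deriv (B.arc i) t) -
      fderiv ℝ (gauge K) (x - y) (deriv (deriv (B.arc i)) t)) :
    CkAlphaAround k α (distK K U) x ∧ HasFDerivAt (distK K U) (fderiv ℝ (gauge K) (x - y)) x ∧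
      ∀ ζ : Plane, ‖ζ‖ = 1 → ⟪ζ, x - y⟫_ℝ = 0 → ∀ v w,
        fderiv ℝ (fderiv ℝ (distK K U)) x v w =
          -(curveCurvature (B.arc i) t * ‖leftNormal (B.arc i) t‖ ^ 3 *
            ‖gradient (polarGauge K) (leftNormal (B.arc i) t)‖ ^ 2) /
          (polarGauge K (leftNormal (B.arc i) t) ^ 3 *
            (1 - curvatureK K (B.arc i) t * distK K U x)) * ⟪v, ζ⟫_ℝ * ⟪w, ζ⟫_ℝ := by
  have hK := S.body
  have htI := Ioo_subset_Icc_self ht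
  obtain ⟨j, hkj, hj⟩ := exists_eq_add_one hk
  have hc : ContDiffAt ℝ 2 (B.arc i) t := (B.contDiffAt_arc i htI).of_le hk
  have hc0 := B.regular i t htI
  have hν0 := leftNormal_ne_zero hc0
  have hp := fderiv_eq_smul_of_gradient_eq hg
  have hxy' : x - y ≠ 0 := sub_ne_zero.2 S.ne
  have hpc : fderiv ℝ (gauge K) (x - y) (deriv (B.arc i) t) = 0 := by
    rw [hp, smul_apply, innerSL_apply_apply, leftNormal, inner_perp_self, smul_zero]
  subst hy
  set e : ℝ → Plane := fun u => B.arc i (t + 1 * u) with he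
  have he0 : e 0 = B.arc i t := by simp [he]
  have hce : ContDiffAt ℝ 2 e 0 := contDiffAt_reparam hc
  have hde : deriv e 0 = deriv (B.arc i) t := by
    rw [he, deriv_reparam (hc.differentiableAt (by norm_num)), one_smul]
  have hdde : deriv (deriv e) 0 = deriv (deriv (B.arc i)) t := deriv_deriv_reparam (one_mul 1) hc
  have hek : CkAlphaAround k α e 0 := B.ckAlphaAround_reparam hα hk i htI
  obtain ⟨s, hs, hfoot, hslope⟩ := hK.exists_foot hα hk (x := x) hj hkj hek (by rwa [he0])
    (by rw [distSlope, he0, hde, hpc, neg_zero]) (by rwa [he0, hde, hdde])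
  have hsd : DifferentiableAt ℝ s x := (hs.contDiffAt.of_le hj).differentiableAt (by norm_num)
  have hev : ∀ᶠ u in 𝓝 (0 : ℝ), e u ∈ frontier U := by
    have h1 : Tendsto (fun u : ℝ => t + 1 * u) (𝓝 0) (𝓝 t) :=
      Continuous.tendsto' (by fun_prop) _ _ (by simp)
    exact (h1.eventually (Icc_mem_nhds ht.1 ht.2)).mono fun u hu => B.arc_mem_frontier i hu
  obtain ⟨hreg, hder⟩ := S.regular_of_foot hα hk hj hkj (by subst hkj; exact hek.of_le_one hα) hs
    hfoot he0 hev (fun δ hδ => by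
      obtain ⟨r, hr, h⟩ := B.exists_cover_interior i ht hδ
      refine ⟨r, hr, fun w hw => ?_⟩
      obtain ⟨s, hs, hst, rfl⟩ := h w hw
      exact ⟨s - t, hst, by simp [he]⟩)
  have hd0 := hder.self_of_nhds
  rw [hfoot.1, he0] at hd0
  refine ⟨hreg, hd0, fun ζ hζ hζx v w => ?_⟩
  rw [S.fderiv_fderiv_of_foot hα hk (hce.differentiableAt (by norm_num)) hsd hfoot.1 he0 hder,
    hK.fderiv2_gauge_eq hα hk hxy' hζ hζx]
  have h1 := S.fderiv_foot hα hk hce hsd hfoot.1 he0 hslope v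
  obtain ⟨h2, h3⟩ := (hK.second_derivative_eq hα hk hc hc0 hxy' hl hp).1 hflat
  obtain ⟨hXP, hl'⟩ := hK.eq_smul_supportPoint hα hk hxy' hν0 hl hp
  have hd := hK.gauge_pos_iff.2 hxy'
  have hh := hK.polarGauge_pos hν0
  have hn : ‖leftNormal (B.arc i) t‖ ≠ 0 := norm_ne_zero_iff.2 hν0
  have h4 : fderiv ℝ (gauge K) (x - B.arc i t) (deriv (deriv (B.arc i)) t) =
      curveCurvature (B.arc i) t * ‖leftNormal (B.arc i) t‖ ^ 3 /
        polarGauge K (leftNormal (B.arc i) t) := by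
    rw [hp, hl', curveCurvature_eq hc, smul_apply, innerSL_apply_apply, real_inner_comm,
      smul_eq_mul]
    field_simp
  have hP := hK.supportPoint_ne_zero hν0
  have h5 : ⟪deriv (B.arc i) t, ζ⟫_ℝ ^ 2 * ‖hK.supportPoint (leftNormal (B.arc i) t)‖ ^ 2 =
      polarGauge K (leftNormal (B.arc i) t) ^ 2 := by
    rw [hXP, inner_smul_right] at hζx
    rw [inner_sq_mul_norm_sq hP hζ ((mul_eq_zero.1 hζx).resolve_left hd.ne'),
      hK.polarGauge_eq_inner hν0, leftNormal]
  have hG := hK.fderiv2_gauge_eq hα hk hxy' hζ hζx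
  set m := fderiv ℝ (fderiv ℝ (gauge K)) (x - B.arc i t) ζ ζ with hm
  rw [h3] at hpos
  have h6 : 1 - curvatureK K (B.arc i) t * gauge K (x - B.arc i t) ≠ 0 := fun h => by
    rw [h, mul_zero] at hpos; exact hpos.ne rfl
  rw [hde, hdde, h3, hG, hG] at h1
  rw [h4, hG] at h3
  rw [hG] at h2
  rw [hK.gradient_polarGauge hν0, S.distK_eq, inner_sub_left, hde, real_inner_smul_left]
  exact hessian_algebra h2 h5 hh.ne' (by linear_combination h3) h6 h1

/-- The Hessian of `γ` at `x - y` has rank at most one, with the radial direction in its kernel. It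
vanishes on `V`, which is not radial, so it is zero and the distance inherits a zero Hessian, in
agreement with `κ = 0`. -/
theorem interior_flat {i : Fin B.N} {t : ℝ} (ht : t ∈ Ioo (0 : ℝ) 1) (hy : B.arc i t = y)
    (hpc : fderiv ℝ (gauge K) (x - y) (deriv (B.arc i) t) = 0)
    (h0 : fderiv ℝ (fderiv ℝ (gauge K)) (x - y) (deriv (B.arc i) t) (deriv (B.arc i) t) = 0)
    (hseg : B.arc i '' Icc (0 : ℝ) 1 = segment ℝ (B.arc i 0) (B.arc i 1)) :
    CkAlphaAround k α (distK K U) x ∧ HasFDerivAt (distK K U) (fderiv ℝ (gauge K) (x - y)) x ∧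
      curveCurvature (B.arc i) t = 0 ∧ ∀ v w, fderiv ℝ (fderiv ℝ (distK K U)) x v w = 0 := by
  have hK := S.body
  have htI := Ioo_subset_Icc_self ht
  obtain ⟨j, hkj, hj⟩ := exists_eq_add_one hk
  have hc : ContDiffAt ℝ 2 (B.arc i) t := (B.contDiffAt_arc i htI).of_le hk
  have hc0 := B.regular i t htI
  have hxy' : x - y ≠ 0 := sub_ne_zero.2 S.ne
  set V := B.arc i 1 - B.arc i 0 with hVdef
  have hV0 : V ≠ 0 := by
    intro h
    rw [sub_eq_zero, B.joined] at h
    have h1 : B.arc i (1 / 2) ∈ B.arc i '' Icc (0 : ℝ) 1 := ⟨_, by norm_num, rfl⟩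
    rw [hseg, B.joined, h, segment_same] at h1
    have := (B.simple i i (1 / 2) (by norm_num) 0 (by simp) h1).2
    norm_num at this
  rw [segment_eq_image'] at hseg
  have hline : ∀ s ∈ Icc (0 : ℝ) 1, ∃ θ ∈ Icc (0 : ℝ) 1, B.arc i s = B.arc i 0 + θ • V := by
    intro s hs
    have h1 : B.arc i s ∈ B.arc i '' Icc (0 : ℝ) 1 := ⟨_, hs, rfl⟩
    rw [hseg] at h1
    obtain ⟨θ, hθ, h⟩ := h1
    exact ⟨θ, hθ, h.symm⟩
  obtain ⟨hdir, hκ⟩ := curveCurvature_eq_zero_of_segment hV0 hc (by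
    filter_upwards [Icc_mem_nhds ht.1 ht.2] with s hs
    obtain ⟨θ, -, h⟩ := hline s hs
    exact ⟨θ, h⟩)
  have hcV := eq_smul_of_inner_perp_eq_zero hV0 hdir
  set m := ⟪deriv (B.arc i) t, V⟫_ℝ / ‖V‖ ^ 2
  have hm : m ≠ 0 := fun h => hc0 (by rw [hcV, h, zero_smul])
  have hpV : fderiv ℝ (gauge K) (x - y) V = 0 := by
    rw [hcV, map_smul, smul_eq_mul] at hpc
    exact (mul_eq_zero.1 hpc).resolve_left hm
  have h0V : fderiv ℝ (fderiv ℝ (gauge K)) (x - y) V V = 0 := by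
    rw [hcV] at h0
    simp only [map_smul, smul_apply, smul_eq_mul] at h0
    exact ((mul_eq_zero.1 h0).resolve_left hm |> mul_eq_zero.1).resolve_left hm
  obtain ⟨θ, hθ, hθy⟩ := hline t htI
  rw [hy] at hθy
  have hθ' : θ ∈ Ioo (0 : ℝ) 1 := by
    refine ⟨lt_of_le_of_ne hθ.1 ?_, lt_of_le_of_ne hθ.2 ?_⟩
    · rintro rfl
      rw [zero_smul, add_zero, ← hy] at hθy
      exact ht.1.ne' (B.simple i i t (Ioo_subset_Ico_self ht) 0 (by simp) hθy).2
    · rintro rfl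
      rw [one_smul, hVdef, add_sub_cancel, ← hy] at hθy
      exact ht.2.ne' (B.eq_of_arc_eq_interior ht (by simp) hθy.symm).2
  set e : ℝ → Plane := fun u => y + u • V with he
  have he0 : e 0 = y := by simp [he]
  have hce : ∀ n : WithTop ℕ∞, ContDiff ℝ n e := fun n =>
    contDiff_const.add (contDiff_id.smul contDiff_const)
  have hder : HasDerivAt e V 0 :=
    (((hasDerivAt_id (0 : ℝ)).smul_const V).const_add y).congr_deriv (one_smul ℝ V)
  obtain ⟨s, hs, hfoot⟩ := hK.exists_foot_line hα hk (j := j) hxy' hV0 hpV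
  have hsd : DifferentiableAt ℝ s x := (hs.contDiffAt.of_le hj).differentiableAt (by norm_num)
  have hev : ∀ᶠ u in 𝓝 (0 : ℝ), e u ∈ frontier U := by
    have h1 : Tendsto (fun u : ℝ => θ + u) (𝓝 0) (𝓝 θ) :=
      Continuous.tendsto' (by fun_prop) _ _ (by simp)
    filter_upwards [h1.eventually (Icc_mem_nhds hθ'.1 hθ'.2)] with u hu
    have h2 : e u ∈ B.arc i '' Icc (0 : ℝ) 1 := by
      rw [hseg]
      exact ⟨θ + u, hu, by simp only [he]; rw [hθy, add_smul, add_assoc]⟩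
    obtain ⟨s, hs, h⟩ := h2
    rw [← h]
    exact B.arc_mem_frontier i hs
  obtain ⟨hreg, hder'⟩ := S.regular_of_foot hα hk hj hkj (CkAlphaAround.of_contDiff hα (hce _)) hs
    hfoot he0 hev (fun δ hδ => by
      obtain ⟨r, hr, h⟩ := B.exists_cover_interior i ht one_pos
      rw [hy] at h
      refine ⟨min r (δ * ‖V‖), lt_min hr (mul_pos hδ (norm_pos_iff.2 hV0)), fun w hw => ?_⟩
      have hb := Metric.mem_ball.1 hw.2
      rw [lt_min_iff] at hb
      obtain ⟨s, hs, -, rfl⟩ := h w ⟨hw.1, Metric.mem_ball.2 hb.1⟩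
      obtain ⟨θ', -, hθ's⟩ := hline s hs
      have h3 : B.arc i s = y + (θ' - θ) • V := by rw [hθ's, hθy]; module
      refine ⟨θ' - θ, ?_, h3⟩
      have h4 := hb.2
      rw [h3, dist_eq_norm, add_sub_cancel_left, norm_smul, Real.norm_eq_abs] at h4
      exact lt_of_mul_lt_mul_right h4 (norm_nonneg _))
  have hd0 := hder'.self_of_nhds
  rw [hfoot.1, he0] at hd0
  refine ⟨hreg, hd0, hκ, fun v w => ?_⟩
  rw [S.fderiv_fderiv_of_foot hα hk hder.differentiableAt hsd hfoot.1 he0 hder']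
  have hX := perp_ne_zero hxy'
  have hζ : ‖(‖perp (x - y)‖⁻¹ • perp (x - y))‖ = 1 := norm_smul_inv_norm hX
  have hG := hK.fderiv2_gauge_eq hα hk hxy' hζ (by rw [real_inner_smul_left]; simp)
  rw [hG] at h0V ⊢
  have h5 : ⟪V, ‖perp (x - y)‖⁻¹ • perp (x - y)⟫_ℝ ≠ 0 := by
    intro h
    rw [inner_smul_right, mul_eq_zero] at h
    have h1 := eq_smul_of_inner_perp_eq_zero hxy'
      (h.resolve_left (inv_ne_zero (norm_ne_zero_iff.2 hX)))
    rw [h1, map_smul, hK.fderiv_gauge_self hα hk hxy', smul_eq_mul, mul_eq_zero] at hpV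
    refine hV0 ?_
    rw [h1, hpV.resolve_right (hK.gauge_pos_iff.2 hxy').ne', zero_smul]
  have h6 := ((mul_eq_zero.1 h0V).resolve_right h5 |> mul_eq_zero.1).resolve_right h5
  rw [h6, zero_mul, zero_mul]

/-- Regularity and derivatives of the distance where the closest point is not a reentrant corner. -/
theorem nonreentrant {i : Fin B.N} {t : ℝ} (ht : t ∈ Icc (0 : ℝ) 1) (hy : B.arc i t = y)
    (hre : ¬ B.IsReentrantCorner y) (hκ : curvatureK K (B.arc i) t * distK K U x ≠ 1) :
    CkAlphaAround k α (distK K U) x ∧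
      gradient (distK K U) x =
        (polarGauge K (leftNormal (B.arc i) t))⁻¹ • leftNormal (B.arc i) t ∧
      ∀ ζ : Plane, ‖ζ‖ = 1 → ⟪ζ, x - y⟫_ℝ = 0 → ∀ v w,
        fderiv ℝ (fderiv ℝ (distK K U)) x v w =
          -(curveCurvature (B.arc i) t * ‖leftNormal (B.arc i) t‖ ^ 3 *
            ‖gradient (polarGauge K) (leftNormal (B.arc i) t)‖ ^ 2) /
          (polarGauge K (leftNormal (B.arc i) t) ^ 3 *
            (1 - curvatureK K (B.arc i) t * distK K U x)) * ⟪v, ζ⟫_ℝ * ⟪w, ζ⟫_ℝ := by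
  have hK := S.body
  -- A corner that is not reentrant is never a closest point, so the parameter is interior.
  have hfalse : ∀ i, B.arc i 1 = y → False := fun i hi =>
    B.false_of_convex_corner hK hα hk S.isOpen S.mem.1 S.closest hi
      (not_le.1 fun h => hre ⟨i, hi, h⟩)
  have htO : t ∈ Ioo (0 : ℝ) 1 := by
    refine ⟨lt_of_le_of_ne ht.1 ?_, lt_of_le_of_ne ht.2 ?_⟩
    · rintro rfl
      refine hfalse (B.next.symm i) ?_
      rw [B.joined, Equiv.apply_symm_apply, hy]
    · rintro rfl
      exact hfalse i hy
  obtain ⟨l, hl, hg⟩ := B.gradient_eq_interior hK hα hk S.isOpen S.mem.1 S.closest htO hy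
  have hc : ContDiffAt ℝ 2 (B.arc i) t := (B.contDiffAt_arc i ht).of_le hk
  have hc0 := B.regular i t ht
  have hν0 := leftNormal_ne_zero hc0
  have hp := fderiv_eq_smul_of_gradient_eq hg
  have hxy' : x - y ≠ 0 := sub_ne_zero.2 S.ne
  have hl' := (hK.eq_smul_supportPoint hα hk hxy' hν0 hl hp).2
  have hgrad : HasFDerivAt (distK K U) (fderiv ℝ (gauge K) (x - y)) x →
      gradient (distK K U) x =
        (polarGauge K (leftNormal (B.arc i) t))⁻¹ • leftNormal (B.arc i) t := fun h => by
    rw [← hl', ← hg, gradient, gradient, h.fderiv]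
  rw [S.distK_eq] at hκ
  rcases hK.second_derivative_pos_or_flat hα hk (x := x) (Or.inl rfl) hc hc0 (by rwa [hy]) hl
    (by rwa [hy]) (by
      have h1 : Tendsto (fun u : ℝ => t + 1 * u) (𝓝 0) (𝓝 t) :=
        Continuous.tendsto' (by fun_prop) _ _ (by simp)
      refine nhdsWithin_le_nhds ((h1.eventually (Icc_mem_nhds htO.1 htO.2)).mono fun u hu => ?_)
      rw [hy]
      exact S.closest.2 _ (B.arc_mem_frontier i hu)) (by rwa [hy]) with
    ⟨hfl, hpos⟩ | ⟨hfl, hκ0⟩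
  · rw [hy] at hpos
    obtain ⟨h1, h2, h3⟩ := S.interior_nonflat hα hk htO hy hl hg hfl hpos
    exact ⟨h1, hgrad h2, h3⟩
  · have hseg := (S.flatCompatible i t ht (Or.inl htO) hfl).resolve_left hκ0.not_gt
    have h4 := ((hK.second_derivative_eq hα hk hc hc0 (by rwa [hy]) hl (by rwa [hy])).2 hfl).1
    rw [hy] at h4
    obtain ⟨h1, h2, h3, h5⟩ := S.interior_flat hα hk htO hy (by
      rw [hp, smul_apply, innerSL_apply_apply, leftNormal, inner_perp_self, smul_zero]) h4 hseg
    refine ⟨h1, hgrad h2, fun ζ _ _ v w => ?_⟩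
    rw [h5, h3]
    simp

/-- The right-hand sides do not change under scaling of `ν`: `‖ν‖³` and `γ°(ν)³` scale alike, and
`Dγ°` is homogeneous of degree `0`. -/
theorem nonreentrant_formulas {i : Fin B.N} {t : ℝ} (ht : t ∈ Icc (0 : ℝ) 1) (hy : B.arc i t = y)
    (hre : ¬ B.IsReentrantCorner y) (hκ : curvatureK K (B.arc i) t * distK K U x ≠ 1) :
    CkAlphaAround k α (distK K U) x ∧
      ∀ r : ℝ, 0 < r → ∀ ν : Plane, ν = r • leftNormal (B.arc i) t →
        gradient (distK K U) x = (polarGauge K ν)⁻¹ • ν ∧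
        Laplacian.laplacian (distK K U) x =
          -(curveCurvature (B.arc i) t * ‖ν‖ ^ 3 * ‖gradient (polarGauge K) ν‖ ^ 2) /
            (polarGauge K ν ^ 3 * (1 - curvatureK K (B.arc i) t * distK K U x)) ∧
        ∀ ζ : Plane, ‖ζ‖ = 1 → ⟪ζ, x - y⟫_ℝ = 0 → ∀ v w : Plane,
          fderiv ℝ (fderiv ℝ (distK K U)) x v w =
            Laplacian.laplacian (distK K U) x * ⟪v, ζ⟫_ℝ * ⟪w, ζ⟫_ℝ := by
  have hK := S.body
  have hν0 := leftNormal_ne_zero (B.regular i t ht)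
  obtain ⟨h1, h2, h3⟩ := S.nonreentrant hα hk ht hy hre hκ
  have hX := perp_ne_zero (sub_ne_zero.2 S.ne)
  have hL := laplacian_eq_of_fderiv_fderiv (norm_smul_inv_norm (𝕜 := ℝ) hX)
    (h3 _ (norm_smul_inv_norm (𝕜 := ℝ) hX) (by simp [real_inner_smul_left]))
  refine ⟨h1, fun r hr ν hν => ⟨?_, ?_, fun ζ hζ hζx v w => by rw [h3 ζ hζ hζx, hL]⟩⟩
  · rw [h2, hν, hK.polarGauge_smul hr hν0, smul_smul, mul_inv, mul_right_comm,
      inv_mul_cancel₀ hr.ne', one_mul]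
  · rw [hL, hν, hK.polarGauge_smul hr hν0, hK.gradient_polarGauge (smul_ne_zero hr.ne' hν0),
      hK.supportPoint_smul hr hν0, hK.gradient_polarGauge hν0, norm_smul, Real.norm_eq_abs,
      abs_of_pos hr, mul_pow, mul_pow, mul_assoc (r ^ 3), ← mul_div_mul_left _ _ (pow_ne_zero 3 hr.ne')]
    congr 1
    ring

end Setting

/-! ### The Euclidean unit disc as convex body. -/

section UnitBall

theorem gauge_unitBall : gauge (Metric.closedBall (0 : Plane) 1) = fun z => ‖z‖ := by
  ext z
  rw [gauge_closedBall zero_le_one, div_one]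

theorem polarBody_unitBall : polarBody (Metric.closedBall (0 : Plane) 1) = Metric.closedBall 0 1 := by
  ext x
  rw [polarBody, mem_ofPred_eq, mem_closedBall_zero_iff]
  constructor
  · intro h
    rcases eq_or_ne x 0 with rfl | hx
    · simp
    · have hx' := norm_pos_iff.2 hx
      have h1 := h (‖x‖⁻¹ • x) (by
        rw [mem_closedBall_zero_iff]; exact (norm_smul_inv_norm (𝕜 := ℝ) hx).le)
      rw [inner_smul_right, real_inner_self_eq_norm_sq, sq, inv_mul_cancel_left₀ hx'.ne'] at h1
      exact h1
  · intro h y hy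
    rw [mem_closedBall_zero_iff] at hy
    exact (real_inner_le_norm _ _).trans (mul_le_one₀ h (norm_nonneg _) hy)

theorem polarGauge_unitBall : polarGauge (Metric.closedBall (0 : Plane) 1) = fun z => ‖z‖ := by
  rw [polarGauge, polarBody_unitBall, gauge_unitBall]

theorem hasFDerivAt_plane_norm {p : Plane} (hp : p ≠ 0) :
    HasFDerivAt (fun z : Plane => ‖z‖) (‖p‖⁻¹ • innerSL ℝ p) p := by
  have h1 := (hasStrictFDerivAt_norm_sq p).hasFDerivAt.sqrt (by positivity)
  have h2 : (fun z : Plane => √(‖z‖ ^ 2)) = fun z => ‖z‖ := by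
    ext z; exact Real.sqrt_sq (norm_nonneg z)
  rw [h2, Real.sqrt_sq (norm_nonneg p)] at h1
  refine h1.congr_fderiv ?_
  ext v
  simp
  have := norm_ne_zero_iff.2 hp
  field_simp

theorem gradient_plane_norm {p : Plane} (hp : p ≠ 0) :
    gradient (fun z : Plane => ‖z‖) p = ‖p‖⁻¹ • p := by
  refine ext_inner_right ℝ fun v => ?_
  rw [inner_gradient, (hasFDerivAt_plane_norm hp).fderiv, real_inner_smul_left]
  simp

theorem fderiv_fderiv_plane_norm {p : Plane} (hp : p ≠ 0) (v w : Plane) (hw : ⟪p, w⟫_ℝ = 0) :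
    fderiv ℝ (fderiv ℝ fun z : Plane => ‖z‖) p v w = ‖p‖⁻¹ * ⟪v, w⟫_ℝ := by
  have h1 : (fderiv ℝ fun z : Plane => ‖z‖) =ᶠ[𝓝 p] fun z => ‖z‖⁻¹ • innerSL ℝ z := by
    filter_upwards [isOpen_ne.mem_nhds hp] with z hz
    exact (hasFDerivAt_plane_norm hz).fderiv
  have h2 : HasFDerivAt (fun z : Plane => ‖z‖⁻¹)
      (-(‖p‖ ^ 2)⁻¹ • ‖p‖⁻¹ • innerSL ℝ p) p := by
    have := (hasDerivAt_inv (norm_ne_zero_iff.2 hp)).comp_hasFDerivAt p (hasFDerivAt_plane_norm hp)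
    exact this
  have h3 := h2.smul (innerSL ℝ (E := Plane)).hasFDerivAt
  have h4 : HasFDerivAt (fun z : Plane => ‖z‖⁻¹ • innerSL ℝ z) _ p := h3
  rw [h1.fderiv_eq, h4.fderiv]
  simp
  change ‖p‖⁻¹ * ⟪v, w⟫_ℝ + -((‖p‖ ^ 2)⁻¹ * (‖p‖⁻¹ * ⟪p, v⟫_ℝ) * ⟪p, w⟫_ℝ) = _
  rw [hw]
  ring

theorem frontier_unitBall : frontier (Metric.closedBall (0 : Plane) 1) = Metric.sphere 0 1 :=
  frontier_closedBall 0 one_ne_zero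

theorem bodyCurvature_unitBall {p : Plane} (hp : p ∈ frontier (Metric.closedBall (0 : Plane) 1)) :
    bodyCurvature (Metric.closedBall (0 : Plane) 1) p = 1 := by
  rw [frontier_unitBall, mem_sphere_zero_iff_norm] at hp
  have hp0 : p ≠ 0 := by rintro rfl; simp at hp
  rw [bodyCurvature, levelCurvature, gauge_unitBall, gradient_plane_norm hp0, hp, inv_one, one_smul,
    fderiv_fderiv_plane_norm hp0 _ _ (inner_self_perp p), hp, inner_perp_perp,
    real_inner_self_eq_norm_sq, hp]
  norm_num

theorem flatNormals_unitBall : flatNormals (Metric.closedBall (0 : Plane) 1) = ∅ := by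
  refine eq_empty_of_forall_notMem fun n hn => ?_
  obtain ⟨-, p, hp, h, -⟩ := hn
  rw [bodyCurvature_unitBall hp] at h
  exact one_ne_zero h

theorem admissibleBody_unitBall {k : WithTop ℕ∞} {α : ℝ≥0} (hα : α ≤ 1) :
    AdmissibleBody k α (Metric.closedBall (0 : Plane) 1) where
  compact := isCompact_closedBall 0 1
  strictConvex := strictConvex_closedBall ℝ 0 1
  zero_mem_interior := mem_interior_iff_mem_nhds.2 (Metric.closedBall_mem_nhds 0 one_pos)
  smooth_boundary := by
    intro p hp
    rw [frontier_unitBall, mem_sphere_zero_iff_norm] at hp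
    refine ⟨fun z => ‖z‖ ^ 2 - 1, ?_, ?_, Eventually.of_forall fun z => ?_⟩
    · exact CkAlphaAround.of_contDiff hα ((contDiff_norm_sq ℝ).sub contDiff_const)
    · intro h
      have h1 := ((hasStrictFDerivAt_norm_sq p).hasFDerivAt.sub_const 1).fderiv
      have h2 := inner_gradient (fun z : Plane => ‖z‖ ^ 2 - 1) p p
      rw [h, h1] at h2
      simp [hp] at h2
    · rw [frontier_unitBall, mem_sphere_zero_iff_norm, sub_eq_zero, pow_eq_one_iff_of_nonneg (norm_nonneg z) two_ne_zero]
  finite_flat := by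
    convert finite_empty
    refine eq_empty_of_forall_notMem fun p hp => hp.2 ?_
    rw [bodyCurvature_unitBall hp.1]
    exact one_pos

theorem curvatureK_unitBall {c : ℝ → Plane} {t : ℝ} (h : deriv c t ≠ 0) :
    curvatureK (Metric.closedBall (0 : Plane) 1) c t = curveCurvature c t := by
  have hν := leftNormal_ne_zero h
  rw [curvatureK, if_neg (by rw [flatNormals_unitBall]; exact notMem_empty _), polarGauge_unitBall,
    fderiv_fderiv_plane_norm hν _ _ (inner_self_perp _), curveCurvature]
  have := norm_ne_zero_iff.2 hν
  field_simp

theorem normalK_unitBall {c : ℝ → Plane} {t : ℝ} (h : deriv c t ≠ 0) :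
    normalK (Metric.closedBall (0 : Plane) 1) c t = ‖leftNormal c t‖⁻¹ • leftNormal c t := by
  rw [normalK, polarGauge_unitBall, gradient_plane_norm (leftNormal_ne_zero h)]

theorem distK_unitBall_le {U : Set Plane} {z w : Plane} (hw : w ∈ frontier U) :
    distK (Metric.closedBall (0 : Plane) 1) U z ≤ ‖z - w‖ := by
  rw [distK, gauge_unitBall]
  exact csInf_le ⟨0, by rintro _ ⟨w, -, rfl⟩; exact norm_nonneg _⟩ ⟨w, hw, rfl⟩

theorem le_distK_unitBall_sq {U : Set Plane} {z : Plane} {m : ℝ} (hne : (frontier U).Nonempty)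
    (h : ∀ w ∈ frontier U, m ≤ ‖z - w‖ ^ 2) :
    m ≤ distK (Metric.closedBall (0 : Plane) 1) U z ^ 2 := by
  have h1 : √m ≤ distK (Metric.closedBall (0 : Plane) 1) U z := by
    rw [distK, gauge_unitBall]
    refine le_csInf (hne.image _) ?_
    rintro _ ⟨w, hw, rfl⟩
    exact Real.sqrt_le_iff.2 ⟨norm_nonneg _, h w hw⟩
  exact (Real.sqrt_le_left (by exact (Real.sqrt_nonneg m).trans h1)).1 h1

theorem isClosestPoint_unitBall_iff {U : Set Plane} {x y : Plane} :
    IsClosestPoint (Metric.closedBall (0 : Plane) 1) U x y ↔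
      y ∈ frontier U ∧ ∀ w ∈ frontier U, ‖x - y‖ ^ 2 ≤ ‖x - w‖ ^ 2 := by
  rw [IsClosestPoint, gauge_unitBall]
  simp only [sq_le_sq₀ (norm_nonneg _) (norm_nonneg _)]

end UnitBall

/-! ### An obstruction to being twice continuously differentiable. -/

/-- A function with different one-sided second order bounds is not of class `C²`. -/
theorem not_contDiffAt_two_of_bounds {g : ℝ → ℝ} {A p q : ℝ} (hpq : p < q)
    (h : ∀ᶠ u in 𝓝 0, g u ≤ A + u ^ 2) (hr : ∀ᶠ u in 𝓝[≥] 0, A - p * u ^ 2 ≤ g u)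
    (hl : ∀ᶠ u in 𝓝[≥] 0, g (-u) ≤ A - q * u ^ 2) : ¬ ContDiffAt ℝ 2 g 0 := by
  intro hg
  have hg0 : g 0 = A := by
    have h1 := h.self_of_nhds
    have h2 := hr.self_of_nhdsWithin (by simp)
    simp at h1 h2
    linarith
  have hgd : ∀ᶠ u in 𝓝 0, HasDerivAt g (deriv g u) u :=
    (hg.eventually (by simp)).mono fun u hu => (hu.differentiableAt (by norm_num)).hasDerivAt
  have hgdd : HasDerivAt (deriv g) (deriv (deriv g) 0) 0 := by
    have h4 : ContDiffAt ℝ 1 (deriv g) 0 :=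
      ContDiffAt.clm_apply (hg.fderiv_right (m := 1) (by norm_num)) contDiffAt_const
    exact (h4.differentiableAt (by norm_num)).hasDerivAt
  have hneg : Tendsto (fun u : ℝ => -u) (𝓝 0) (𝓝 0) :=
    Continuous.tendsto' continuous_neg _ _ neg_zero
  have hgd' : ∀ᶠ u in 𝓝 0, HasDerivAt (fun u => g (-u)) (-deriv g (-u)) u := by
    filter_upwards [hneg.eventually hgd] with u hu
    exact (hu.scomp u (hasDerivAt_neg u)).congr_deriv (by simp)
  have hsq : ∀ (c u : ℝ), HasDerivAt (fun u : ℝ => c * u ^ 2) (2 * c * u) u := fun c u => by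
    have := (hasDerivAt_pow 2 u).const_mul c
    exact this.congr_deriv (by norm_num; ring)
  have hlin : ∀ c : ℝ, HasDerivAt (fun u : ℝ => 2 * c * u) (2 * c) 0 := fun c => by
    simpa using (hasDerivAt_id (0 : ℝ)).const_mul (2 * c)
  have hr' := hr.filter_mono (nhdsWithin_mono 0 Ioi_subset_Ici_self)
  have hl' := hl.filter_mono (nhdsWithin_mono 0 Ioi_subset_Ici_self)
  have h1 : deriv g 0 = 0 := by
    refine le_antisymm ?_ ?_
    · have h2 := first_deriv_nonneg_of_min (((hsq 1 0).sub hgd.self_of_nhds)) (by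
        filter_upwards [nhdsWithin_le_nhds h] with u hu
        simp [hg0]; linarith)
      linarith
    · have h2 := first_deriv_nonneg_of_min ((hgd.self_of_nhds).add (hsq p 0)) (by
        filter_upwards [hr'] with u hu
        simp [hg0]; linarith)
      linarith
  -- The bound on the right gives `g''(0) ≥ -2p`, the one on the left gives `g''(0) ≤ -2q`. The
  -- upper bound `A + u²` serves only to get `g(0) = A` and `g'(0) = 0`.
  have h2 := second_deriv_nonneg_of_min (φ := fun u => g u + p * u ^ 2)
    (G := fun u => deriv g u + 2 * p * u) (hgd.mono fun u hu => hu.add (hsq p u)) (by simp [h1])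
    (hgdd.add (hlin p)) (by
      filter_upwards [hr'] with u hu
      simp [hg0]; linarith)
  have h3 : HasDerivAt (fun u => deriv g (-u)) (-deriv (deriv g) 0) 0 := by
    have h4 : HasDerivAt (deriv g) (deriv (deriv g) 0) (-0) := by rwa [neg_zero]
    exact (h4.scomp (0 : ℝ) (hasDerivAt_neg (0 : ℝ))).congr_deriv (by simp)
  have h4 := second_deriv_nonneg_of_min (φ := fun u => -(g (-u) + q * u ^ 2))
    (G := fun u => -(-deriv g (-u) + 2 * q * u)) (hgd'.mono fun u hu => (hu.add (hsq q u)).neg)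
    (by simp [h1]) ((h3.neg.add (hlin q)).neg) (by
      filter_upwards [hl'] with u hu
      simp [hg0]; linarith)
  linarith

theorem plane_mk_eq (a b : ℝ) : (!₂[a, b] : Plane) = a • !₂[1, 0] + b • !₂[0, 1] :=
  plane_ext (by simp) (by simp)

theorem hasDerivAt_plane_mk {f g : ℝ → ℝ} {f' g' t : ℝ} (hf : HasDerivAt f f' t)
    (hg : HasDerivAt g g' t) : HasDerivAt (fun t => (!₂[f t, g t] : Plane)) !₂[f', g'] t := by
  have h : (fun t => (!₂[f t, g t] : Plane)) = fun t => f t • !₂[1, 0] + g t • !₂[0, 1] :=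
    funext fun t => plane_mk_eq _ _
  rw [h, plane_mk_eq f' g']
  exact (hf.smul_const _).add (hg.smul_const _)

theorem contDiff_plane_mk {n : WithTop ℕ∞} {f g : ℝ → ℝ} (hf : ContDiff ℝ n f)
    (hg : ContDiff ℝ n g) : ContDiff ℝ n fun t => (!₂[f t, g t] : Plane) := by
  have h : (fun t => (!₂[f t, g t] : Plane)) = fun t => f t • !₂[1, 0] + g t • !₂[0, 1] :=
    funext fun t => plane_mk_eq _ _
  rw [h]
  exact (hf.smul contDiff_const).add (hg.smul contDiff_const)

/-! ### Domains bounded by two elliptic arcs. -/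

section Lens

/-- The defining function of a domain bounded by two elliptic arcs. -/
noncomputable def lensFun (Φ : ℝ) (β : Fin 2 → ℝ) (z : Plane) : ℝ :=
  (max (z 0 / β 0) (-(z 0 / β 1)) + cos Φ) ^ 2 + z 1 ^ 2

/-- A domain bounded by two elliptic arcs. -/
def lensDomain (Φ : ℝ) (β : Fin 2 → ℝ) : Set Plane := {z | lensFun Φ β z < 1}

/-- The right (`i = 0`) and the left (`i = 1`) half of the plane. -/
noncomputable def lensSign (i : Fin 2) : ℝ := if i = 0 then 1 else -1

/-- The two elliptic arcs bounding `lensDomain`. -/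
noncomputable def lensArc (Φ : ℝ) (β : Fin 2 → ℝ) (i : Fin 2) (t : ℝ) : Plane :=
  lensSign i • !₂[β i * (cos (Φ * (2 * t - 1)) - cos Φ), sin (Φ * (2 * t - 1))]

variable {Φ : ℝ} {β : Fin 2 → ℝ}

theorem lensSign_mul_self (i : Fin 2) : lensSign i * lensSign i = 1 := by
  fin_cases i <;> simp [lensSign]

theorem lensSign_swap (i : Fin 2) : lensSign (Equiv.swap 0 1 i) = -lensSign i := by
  fin_cases i <;> simp [lensSign]

theorem lensSign_ne_zero (i : Fin 2) : lensSign i ≠ 0 := by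
  fin_cases i <;> simp [lensSign]

theorem lensArc_zero (i : Fin 2) (t : ℝ) :
    lensArc Φ β i t 0 = lensSign i * (β i * (cos (Φ * (2 * t - 1)) - cos Φ)) := by
  simp [lensArc]

theorem lensArc_one (i : Fin 2) (t : ℝ) :
    lensArc Φ β i t 1 = lensSign i * sin (Φ * (2 * t - 1)) := by
  simp [lensArc]

theorem contDiff_lensArc (i : Fin 2) {n : WithTop ℕ∞} : ContDiff ℝ n (lensArc Φ β i) := by
  have h : ContDiff ℝ n fun t : ℝ => Φ * (2 * t - 1) := by fun_prop
  exact (contDiff_plane_mk (contDiff_const.mul ((Real.contDiff_cos.comp h).sub contDiff_const))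
    (Real.contDiff_sin.comp h)).const_smul (lensSign i)

theorem hasDerivAt_lensArc (i : Fin 2) (t : ℝ) : HasDerivAt (lensArc Φ β i)
    ((lensSign i * (2 * Φ)) • !₂[-(β i * sin (Φ * (2 * t - 1))), cos (Φ * (2 * t - 1))]) t := by
  have h : HasDerivAt (fun t : ℝ => Φ * (2 * t - 1)) (2 * Φ) t := by
    have := (((hasDerivAt_id t).const_mul 2).sub_const 1).const_mul Φ
    exact this.congr_deriv (by ring)
  have h1 := hasDerivAt_plane_mk ((h.cos.sub_const (cos Φ)).const_mul (β i)) h.sin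
  refine (h1.const_smul (lensSign i)).congr_deriv (plane_ext ?_ ?_)
  · simp; ring
  · simp; ring

theorem hasDerivAt_deriv_lensArc (i : Fin 2) (t : ℝ) : HasDerivAt (deriv (lensArc Φ β i))
    ((lensSign i * (2 * Φ) ^ 2) • !₂[-(β i * cos (Φ * (2 * t - 1))), -sin (Φ * (2 * t - 1))]) t := by
  have h : HasDerivAt (fun t : ℝ => Φ * (2 * t - 1)) (2 * Φ) t := by
    have := (((hasDerivAt_id t).const_mul 2).sub_const 1).const_mul Φ
    exact this.congr_deriv (by ring)
  have h0 : deriv (lensArc Φ β i) = fun t => (lensSign i * (2 * Φ)) •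
      !₂[-(β i * sin (Φ * (2 * t - 1))), cos (Φ * (2 * t - 1))] :=
    funext fun t => (hasDerivAt_lensArc i t).deriv
  have h1 := hasDerivAt_plane_mk (h.sin.const_mul (β i)).neg h.cos
  rw [h0]
  refine (h1.const_smul (lensSign i * (2 * Φ))).congr_deriv (plane_ext ?_ ?_)
  · simp; ring
  · simp; ring

theorem leftNormal_lensArc (i : Fin 2) (t : ℝ) : leftNormal (lensArc Φ β i) t =
    (lensSign i * (2 * Φ)) • !₂[-cos (Φ * (2 * t - 1)), -(β i * sin (Φ * (2 * t - 1)))] := by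
  rw [leftNormal, (hasDerivAt_lensArc i t).deriv, perp_smul]
  refine congrArg _ (plane_ext ?_ ?_) <;> simp

theorem curveCurvature_lensArc (i : Fin 2) (t : ℝ) : curveCurvature (lensArc Φ β i) t =
    (2 * Φ) ^ 3 * β i / ‖leftNormal (lensArc Φ β i) t‖ ^ 3 := by
  rw [curveCurvature_eq (contDiff_lensArc i).contDiffAt, (hasDerivAt_deriv_lensArc i t).deriv]
  congr 1
  rw [leftNormal_lensArc, real_inner_smul_left, inner_smul_right, plane_inner]
  simp
  linear_combination (2 * Φ) ^ 3 * β i * lensSign_mul_self i +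
    lensSign i * lensSign i * (2 * Φ) ^ 3 * β i * sin_sq_add_cos_sq (Φ * (2 * t - 1))

section

variable (hβ : ∀ i, 0 < β i)

theorem continuous_lensFun : Continuous (lensFun Φ β) := by
  unfold lensFun; fun_prop

theorem isOpen_lensDomain : IsOpen (lensDomain Φ β) :=
  isOpen_lt continuous_lensFun continuous_const

include hβ

theorem lensFun_of_sign (i : Fin 2) {z : Plane} (h : 0 ≤ lensSign i * z 0) :
    lensFun Φ β z = (lensSign i * z 0 / β i + cos Φ) ^ 2 + z 1 ^ 2 := by
  have h0 := hβ 0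
  have h1 := hβ 1
  rw [lensFun]
  fin_cases i
  · simp [lensSign] at h ⊢
    rw [max_eq_left]
    exact (neg_nonpos.2 (by positivity)).trans (by positivity)
  · simp [lensSign] at h ⊢
    rw [max_eq_right, neg_div]
    have : z 0 / β 0 ≤ 0 := div_nonpos_of_nonpos_of_nonneg h h0.le
    have : z 0 / β 1 ≤ 0 := div_nonpos_of_nonpos_of_nonneg h h1.le
    linarith

variable (hΦ : π / 2 ≤ Φ) (hΦ' : Φ < π)
include hΦ hΦ'

omit hβ in
theorem cos_nonpos_lens : cos Φ ≤ 0 :=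
  cos_nonpos_of_pi_div_two_le_of_le hΦ (by linarith [pi_pos])

omit hβ in
theorem sin_pos_lens : 0 < sin Φ := sin_pos_of_pos_of_lt_pi (by linarith [pi_pos]) hΦ'

omit hβ in
theorem cos_sq_lt_one_lens : cos Φ ^ 2 < 1 := by
  have := sin_pos_lens hΦ hΦ'
  nlinarith [sin_sq_add_cos_sq Φ]

omit hβ in
-- On each ray the function is a convex quadratic whose value at the origin is `cos² Φ < 1`. So the
-- domain is star-shaped, which identifies its boundary with the level set.
theorem lensFun_smul_lt {z : Plane} (hz : lensFun Φ β z = 1) {r : ℝ} (hr : r ∈ Ico (0 : ℝ) 1) :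
    lensFun Φ β (r • z) < 1 := by
  have hm : max ((r • z) 0 / β 0) (-((r • z) 0 / β 1)) =
      r * max (z 0 / β 0) (-(z 0 / β 1)) := by
    rw [mul_max_of_nonneg _ _ hr.1]
    simp [mul_div_assoc]
  have hc := cos_sq_lt_one_lens hΦ hΦ'
  rw [lensFun] at hz
  rw [lensFun, hm]
  set M := max (z 0 / β 0) (-(z 0 / β 1))
  simp only [PiLp.smul_apply, smul_eq_mul]
  obtain ⟨h0, h1⟩ := hr
  have h2 : (r * M + cos Φ) ^ 2 + (r * z 1) ^ 2 =
      r * ((M + cos Φ) ^ 2 + z 1 ^ 2) + (1 - r) * cos Φ ^ 2 - r * (1 - r) * (M ^ 2 + z 1 ^ 2) := by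
    ring
  rw [h2, hz]
  have h3 : 0 ≤ r * (1 - r) * (M ^ 2 + z 1 ^ 2) :=
    mul_nonneg (mul_nonneg h0 (by linarith)) (by positivity)
  have h4 : (1 - r) * cos Φ ^ 2 < (1 - r) * 1 := mul_lt_mul_of_pos_left hc (by linarith)
  linarith

omit hβ in
theorem frontier_lensDomain : frontier (lensDomain Φ β) = {z | lensFun Φ β z = 1} := by
  refine Subset.antisymm (frontier_lt_subset_eq continuous_lensFun continuous_const) fun z hz => ?_
  rw [isOpen_lensDomain.frontier_eq]
  refine ⟨?_, fun h => (show lensFun Φ β z < 1 from h).ne hz⟩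
  have h1 : Tendsto (fun r : ℝ => r • z) (𝓝[<] 1) (𝓝 z) := by
    have : ContinuousAt (fun r : ℝ => r • z) 1 := by fun_prop
    simpa [ContinuousAt] using this.tendsto.mono_left nhdsWithin_le_nhds
  refine mem_closure_of_tendsto h1 ?_
  filter_upwards [Ioo_mem_nhdsLT one_pos] with r hr
  exact lensFun_smul_lt hΦ hΦ' hz (Ioo_subset_Ico_self hr)

omit hβ hΦ hΦ' in
theorem abs_le_of_lensFun_le {z : Plane} (hz : lensFun Φ β z ≤ 1) :
    max (z 0 / β 0) (-(z 0 / β 1)) ≤ 2 ∧ |z 1| ≤ 1 := by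
  rw [lensFun] at hz
  constructor
  · have h1 : (max (z 0 / β 0) (-(z 0 / β 1)) + cos Φ) ^ 2 ≤ 1 := by nlinarith [sq_nonneg (z 1)]
    have := (abs_le.1 ((sq_le_one_iff_abs_le_one _).1 h1)).2
    linarith [neg_one_le_cos Φ]
  · rw [← sq_le_one_iff_abs_le_one]
    nlinarith [sq_nonneg (max (z 0 / β 0) (-(z 0 / β 1)) + cos Φ)]

omit hΦ hΦ' in
theorem isBounded_lensDomain : Bornology.IsBounded (lensDomain Φ β) := by
  have h0 := hβ 0
  have h1 := hβ 1
  refine (Metric.isBounded_iff_subset_closedBall (0 : Plane)).2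
    ⟨2 * β 0 + 2 * β 1 + 1, fun z hz => ?_⟩
  obtain ⟨h2, h3⟩ := abs_le_of_lensFun_le (le_of_lt hz)
  rw [max_le_iff, div_le_iff₀ h0, neg_le, le_div_iff₀ h1] at h2
  rw [abs_le] at h3
  rw [mem_closedBall_zero_iff, ← sq_le_sq₀ (norm_nonneg _) (by positivity), plane_norm_sq]
  have h4 : z 0 ^ 2 ≤ (2 * β 0 + 2 * β 1) ^ 2 := sq_le_sq' (by linarith) (by linarith)
  have h5 : z 1 ^ 2 ≤ 1 := by nlinarith
  nlinarith

omit hβ in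
theorem cos_lt_cos_lens {t : ℝ} (ht : t ∈ Ioo (0 : ℝ) 1) : cos Φ < cos (Φ * (2 * t - 1)) := by
  have h0 : 0 < Φ := by linarith [pi_pos]
  rw [← cos_abs (Φ * (2 * t - 1))]
  refine cos_lt_cos_of_nonneg_of_le_pi (abs_nonneg _) hΦ'.le ?_
  rw [abs_mul, abs_of_pos h0]
  have : |2 * t - 1| < 1 := abs_lt.2 ⟨by linarith [ht.1], by linarith [ht.2]⟩
  nlinarith

omit hβ in
theorem cos_le_cos_lens {t : ℝ} (ht : t ∈ Icc (0 : ℝ) 1) : cos Φ ≤ cos (Φ * (2 * t - 1)) := by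
  rcases ht.1.eq_or_lt with rfl | h1
  · simp
  rcases ht.2.eq_or_lt with rfl | h2
  · norm_num
  exact (cos_lt_cos_lens hΦ hΦ' ⟨h1, h2⟩).le

theorem lensFun_lensArc (i : Fin 2) {t : ℝ} (ht : t ∈ Icc (0 : ℝ) 1) :
    lensFun Φ β (lensArc Φ β i t) = 1 := by
  have hi := hβ i
  have h1 : lensSign i * lensArc Φ β i t 0 = β i * (cos (Φ * (2 * t - 1)) - cos Φ) := by
    rw [lensArc_zero, ← mul_assoc, lensSign_mul_self, one_mul]
  rw [lensFun_of_sign hβ i (by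
    rw [h1]; exact mul_nonneg hi.le (sub_nonneg.2 (cos_le_cos_lens hΦ hΦ' ht))), h1, lensArc_one,
    mul_div_cancel_left₀ _ hi.ne']
  linear_combination sin (Φ * (2 * t - 1)) ^ 2 * lensSign_mul_self i +
    sin_sq_add_cos_sq (Φ * (2 * t - 1))

omit hβ in
theorem exists_lens_parameter {u v : ℝ} (h : u ^ 2 + v ^ 2 = 1) (hu : cos Φ ≤ u) :
    ∃ t ∈ Icc (0 : ℝ) 1, cos (Φ * (2 * t - 1)) = u ∧ sin (Φ * (2 * t - 1)) = v := by
  have h0 : 0 < Φ := by linarith [pi_pos]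
  have hu1 : -1 ≤ u := by nlinarith [sq_nonneg v]
  have hu2 : u ≤ 1 := by nlinarith [sq_nonneg v]
  have hac : arccos u ≤ Φ := by
    rw [← arccos_cos h0.le hΦ'.le]; exact arccos_le_arccos hu
  have hac0 := arccos_nonneg u
  suffices hφ : ∃ φ, |φ| ≤ Φ ∧ cos φ = u ∧ sin φ = v by
    obtain ⟨φ, h1, h2, h3⟩ := hφ
    rw [abs_le] at h1
    have h4 : Φ * (2 * ((φ / Φ + 1) / 2) - 1) = φ := by field_simp; ring
    refine ⟨(φ / Φ + 1) / 2, ⟨?_, ?_⟩, by rw [h4, h2], by rw [h4, h3]⟩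
    · have : -1 ≤ φ / Φ := by rw [le_div_iff₀ h0]; linarith
      linarith
    · have : φ / Φ ≤ 1 := by rw [div_le_one h0]; exact h1.2
      linarith
  have hs : sin (arccos u) = |v| := by
    rw [sin_arccos, show 1 - u ^ 2 = v ^ 2 by linarith, sqrt_sq_eq_abs]
  rcases le_total 0 v with hv | hv
  · exact ⟨arccos u, by rwa [abs_of_nonneg hac0], cos_arccos hu1 hu2, by rw [hs, abs_of_nonneg hv]⟩
  · exact ⟨-arccos u, by rwa [abs_neg, abs_of_nonneg hac0], by rw [cos_neg, cos_arccos hu1 hu2],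
      by rw [sin_neg, hs, abs_of_nonpos hv, neg_neg]⟩

theorem frontier_lensDomain_eq_iUnion :
    frontier (lensDomain Φ β) = ⋃ i, lensArc Φ β i '' Icc (0 : ℝ) 1 := by
  rw [frontier_lensDomain hΦ hΦ']
  refine Subset.antisymm (fun z hz => ?_) (iUnion_subset fun i => ?_)
  · rw [mem_ofPred_eq] at hz
    obtain ⟨i, hi⟩ : ∃ i : Fin 2, 0 ≤ lensSign i * z 0 := by
      rcases le_total 0 (z 0) with h | h
      · exact ⟨0, by simpa [lensSign]⟩
      · exact ⟨1, by simpa [lensSign]⟩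
    have hb := hβ i
    have hs := lensSign_mul_self i
    rw [lensFun_of_sign hβ i hi] at hz
    obtain ⟨t, ht, h1, h2⟩ := exists_lens_parameter hΦ hΦ' (v := lensSign i * z 1)
      (by rw [← hz]; linear_combination z 1 ^ 2 * hs)
      (le_add_of_nonneg_left (div_nonneg hi hb.le))
    refine mem_iUnion.2 ⟨i, t, ht, plane_ext ?_ ?_⟩
    · rw [lensArc_zero, h1]
      field_simp
      linear_combination z 0 * hs
    · rw [lensArc_one, h2]
      linear_combination z 1 * hs
  · rintro _ ⟨t, ht, rfl⟩
    exact lensFun_lensArc hβ hΦ hΦ' i ht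

/-- On one arc, cosine and sine determine an angle in `[-Φ, Φ]`. Points of different arcs agree only
on the vertical axis, where the parameters `0` of the two arcs give opposite corners. -/
theorem lensArc_injective {i j : Fin 2} {s t : ℝ} (hs : s ∈ Ico (0 : ℝ) 1) (ht : t ∈ Ico (0 : ℝ) 1)
    (h : lensArc Φ β i s = lensArc Φ β j t) : i = j ∧ s = t := by
  have h0 : 0 < Φ := by linarith [pi_pos]
  have hx := congrArg (fun z : Plane => z 0) h
  have hy := congrArg (fun z : Plane => z 1) h
  simp only [lensArc_zero, lensArc_one] at hx hy
  have hS := sin_pos_lens hΦ hΦ'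
  have hcos : ∀ u ∈ Ico (0 : ℝ) 1, cos (Φ * (2 * u - 1)) = cos Φ → u = 0 := by
    intro u hu h
    rcases hu.1.eq_or_lt with h1 | h1
    · exact h1.symm
    · exact absurd h (cos_lt_cos_lens hΦ hΦ' ⟨h1, hu.2⟩).ne'
  have hinj : cos (Φ * (2 * s - 1)) = cos (Φ * (2 * t - 1)) →
      sin (Φ * (2 * s - 1)) = sin (Φ * (2 * t - 1)) → s = t := by
    intro hc hsn
    have hb : ∀ u ∈ Ico (0 : ℝ) 1, |Φ * (2 * u - 1)| ≤ Φ := fun u hu => by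
      rw [abs_mul, abs_of_pos h0]
      have : |2 * u - 1| ≤ 1 := abs_le.2 ⟨by linarith [hu.1], by linarith [hu.2]⟩
      nlinarith
    have h1 : |Φ * (2 * s - 1)| = |Φ * (2 * t - 1)| := injOn_cos
      ⟨abs_nonneg _, (hb s hs).trans hΦ'.le⟩ ⟨abs_nonneg _, (hb t ht).trans hΦ'.le⟩
      (by simpa only [cos_abs])
    rcases abs_eq_abs.1 h1 with h2 | h2
    · have := mul_left_cancel₀ h0.ne' h2; linarith
    · rw [h2, sin_neg] at hsn
      have h3 : sin (Φ * (2 * t - 1)) = 0 := by linarith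
      have h4 := abs_lt.1 ((hb t ht).trans_lt hΦ')
      have h5 := (sin_eq_zero_iff_of_lt_of_lt h4.1 h4.2).1 h3
      rw [h5, neg_zero] at h2
      have h6 := (mul_eq_zero.1 h5).resolve_left h0.ne'
      have h7 := (mul_eq_zero.1 h2).resolve_left h0.ne'
      linarith
  by_cases hij : i = j
  · subst hij
    have hs0 := lensSign_ne_zero i
    refine ⟨rfl, hinj ?_ (mul_left_cancel₀ hs0 hy)⟩
    have := mul_left_cancel₀ (hβ i).ne' (mul_left_cancel₀ hs0 hx)
    linarith
  · exfalso
    have hj : j = Equiv.swap 0 1 i := by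
      fin_cases i <;> fin_cases j <;> simp at hij ⊢
    have hsj : lensSign j = -lensSign i := by rw [hj, lensSign_swap]
    rw [hsj] at hx hy
    have hx' : β i * (cos (Φ * (2 * s - 1)) - cos Φ) + β j * (cos (Φ * (2 * t - 1)) - cos Φ) = 0 :=
      mul_left_cancel₀ (lensSign_ne_zero i) (by linear_combination hx)
    have h1 := mul_nonneg (hβ i).le (sub_nonneg.2 (cos_le_cos_lens hΦ hΦ' (Ico_subset_Icc_self hs)))
    have h2 := mul_nonneg (hβ j).le (sub_nonneg.2 (cos_le_cos_lens hΦ hΦ' (Ico_subset_Icc_self ht)))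
    have h3 := hcos s hs (by
      have := (mul_eq_zero.1 (by linarith : β i * (cos (Φ * (2 * s - 1)) - cos Φ) = 0)).resolve_left
        (hβ i).ne'
      linarith)
    have h4 := hcos t ht (by
      have := (mul_eq_zero.1 (by linarith : β j * (cos (Φ * (2 * t - 1)) - cos Φ) = 0)).resolve_left
        (hβ j).ne'
      linarith)
    rw [h3, h4, neg_mul, ← mul_neg] at hy
    have := mul_left_cancel₀ (lensSign_ne_zero i) hy
    rw [show Φ * (2 * 0 - 1) = -Φ by ring, sin_neg] at this
    linarith

/-- In coordinates that make the ellipse a unit circle, moving along the normal rescales the two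
coordinates by different factors. Both are below `1` in absolute value for small positive `s` and
above `1` for negative `s`. -/
theorem lensFun_normal (i : Fin 2) {t : ℝ} (ht : t ∈ Ioo (0 : ℝ) 1) : ∀ᶠ s in 𝓝 (0 : ℝ),
    lensFun Φ β (lensArc Φ β i t + s • leftNormal (lensArc Φ β i) t) =
      (cos (Φ * (2 * t - 1)) * (1 - 2 * Φ * s / β i)) ^ 2 +
        (sin (Φ * (2 * t - 1)) * (1 - 2 * Φ * s * β i)) ^ 2 := by
  have hi := hβ i
  have hs := lensSign_mul_self i
  have hx : ∀ s : ℝ, lensSign i * (lensArc Φ β i t + s • leftNormal (lensArc Φ β i) t) 0 =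
      β i * (cos (Φ * (2 * t - 1)) - cos Φ) - s * (2 * Φ * cos (Φ * (2 * t - 1))) := fun s => by
    rw [leftNormal_lensArc]
    simp only [PiLp.add_apply, lensArc_zero, PiLp.smul_apply, smul_eq_mul]
    simp
    linear_combination (β i * (cos (Φ * (2 * t - 1)) - cos Φ) -
      s * (2 * Φ * cos (Φ * (2 * t - 1)))) * hs
  have h1 : ∀ᶠ s in 𝓝 (0 : ℝ), 0 < β i * (cos (Φ * (2 * t - 1)) - cos Φ) -
      s * (2 * Φ * cos (Φ * (2 * t - 1))) := by
    have h2 : Tendsto (fun s : ℝ => β i * (cos (Φ * (2 * t - 1)) - cos Φ) -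
      s * (2 * Φ * cos (Φ * (2 * t - 1)))) (𝓝 0) (𝓝 (β i * (cos (Φ * (2 * t - 1)) - cos Φ))) :=
      Continuous.tendsto' (by fun_prop) _ _ (by simp)
    exact h2.eventually (lt_mem_nhds (mul_pos hi (sub_pos.2 (cos_lt_cos_lens hΦ hΦ' ht))))
  filter_upwards [h1] with s h1
  rw [lensFun_of_sign hβ i (by rw [hx]; exact h1.le), hx, leftNormal_lensArc]
  simp only [PiLp.add_apply, lensArc_one, PiLp.smul_apply, smul_eq_mul]
  simp
  have h2 : (β i * (cos (Φ * (2 * t - 1)) - cos Φ) - s * (2 * Φ * cos (Φ * (2 * t - 1)))) / β i +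
      cos Φ = cos (Φ * (2 * t - 1)) * (1 - 2 * Φ * s / β i) := by
    field_simp; ring
  rw [h2]
  linear_combination (sin (Φ * (2 * t - 1)) * (1 - 2 * Φ * s * β i)) ^ 2 * hs

theorem inward_lensArc (i : Fin 2) {t : ℝ} (ht : t ∈ Ioo (0 : ℝ) 1) : ∀ᶠ s in 𝓝[>] (0 : ℝ),
    lensArc Φ β i t + s • leftNormal (lensArc Φ β i) t ∈ lensDomain Φ β ∧
      lensArc Φ β i t - s • leftNormal (lensArc Φ β i) t ∉ closure (lensDomain Φ β) := by
  have h0 : 0 < Φ := by linarith [pi_pos]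
  have hi := hβ i
  have h1 := lensFun_normal hβ hΦ hΦ' i ht
  have hneg : Tendsto (fun u : ℝ => -u) (𝓝 0) (𝓝 0) :=
    Continuous.tendsto' continuous_neg _ _ neg_zero
  have h2 : Tendsto (fun s : ℝ => 2 * Φ * s / β i) (𝓝 0) (𝓝 0) :=
    Continuous.tendsto' (by fun_prop) _ _ (by simp)
  have h3 : Tendsto (fun s : ℝ => 2 * Φ * s * β i) (𝓝 0) (𝓝 0) :=
    Continuous.tendsto' (by fun_prop) _ _ (by simp)
  filter_upwards [nhdsWithin_le_nhds h1, nhdsWithin_le_nhds (hneg.eventually h1),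
    nhdsWithin_le_nhds (h2.eventually (gt_mem_nhds two_pos)),
    nhdsWithin_le_nhds (h3.eventually (gt_mem_nhds two_pos)), self_mem_nhdsWithin]
    with s h4 h5 h6 h7 h8
  have hs : 0 < s := h8
  have ha : 0 < 2 * Φ * s / β i := by positivity
  have hb : 0 < 2 * Φ * s * β i := by positivity
  have hcs := sin_sq_add_cos_sq (Φ * (2 * t - 1))
  have hsc : 0 < sin (Φ * (2 * t - 1)) ^ 2 ∨ 0 < cos (Φ * (2 * t - 1)) ^ 2 := by
    by_contra! h
    linarith [h.1, h.2]
  constructor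
  · rw [lensDomain, mem_ofPred_eq, h4, mul_pow, mul_pow]
    have e1 : (1 - 2 * Φ * s / β i) ^ 2 < 1 := by nlinarith
    have e2 : (1 - 2 * Φ * s * β i) ^ 2 < 1 := by nlinarith
    rcases hsc with h | h <;>
      nlinarith [sq_nonneg (sin (Φ * (2 * t - 1))), sq_nonneg (cos (Φ * (2 * t - 1)))]
  · intro hcl
    have h9 : lensFun Φ β (lensArc Φ β i t - s • leftNormal (lensArc Φ β i) t) ≤ 1 :=
      closure_lt_subset_le continuous_lensFun continuous_const hcl
    rw [neg_smul, ← sub_eq_add_neg] at h5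
    rw [h5, mul_pow, mul_pow] at h9
    have e1 : 1 < (1 - 2 * Φ * -s / β i) ^ 2 := by
      have : 1 - 2 * Φ * -s / β i = 1 + 2 * Φ * s / β i := by ring
      rw [this]; nlinarith
    have e2 : 1 < (1 - 2 * Φ * -s * β i) ^ 2 := by
      have : 1 - 2 * Φ * -s * β i = 1 + 2 * Φ * s * β i := by ring
      rw [this]; nlinarith
    rcases hsc with h | h <;>
      nlinarith [sq_nonneg (sin (Φ * (2 * t - 1))), sq_nonneg (cos (Φ * (2 * t - 1)))]

omit hβ hΦ hΦ' in
theorem lensArc_joined (i : Fin 2) : lensArc Φ β i 1 = lensArc Φ β (Equiv.swap 0 1 i) 0 := by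
  refine plane_ext ?_ ?_
  · rw [lensArc_zero, lensArc_zero]; norm_num
  · rw [lensArc_one, lensArc_one, lensSign_swap, show Φ * (2 * 0 - 1) = -Φ by ring, sin_neg]
    norm_num

omit hβ hΦ hΦ' in
theorem lens_corner (i : Fin 2) :
    ⟪perp (deriv (lensArc Φ β (Equiv.swap 0 1 i)) 0), -deriv (lensArc Φ β i) 1⟫_ℝ =
      (2 * Φ) ^ 2 * (β i + β (Equiv.swap 0 1 i)) * sin Φ * cos Φ ∧
    ⟪deriv (lensArc Φ β (Equiv.swap 0 1 i)) 0, -deriv (lensArc Φ β i) 1⟫_ℝ =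
      (2 * Φ) ^ 2 * (cos Φ ^ 2 - β i * β (Equiv.swap 0 1 i) * sin Φ ^ 2) := by
  have hs := lensSign_mul_self i
  rw [(hasDerivAt_lensArc _ _).deriv, (hasDerivAt_lensArc _ _).deriv, lensSign_swap,
    show Φ * (2 * 0 - 1) = -Φ by ring, show Φ * (2 * 1 - 1) = Φ by ring, sin_neg, cos_neg]
  constructor
  · rw [plane_inner]
    simp
    linear_combination ((2 * Φ) ^ 2 * (β i + β (Equiv.swap 0 1 i)) * sin Φ * cos Φ) * hs
  · rw [plane_inner]
    simp
    linear_combination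
      ((2 * Φ) ^ 2 * (cos Φ ^ 2 - β i * β (Equiv.swap 0 1 i) * sin Φ ^ 2)) * hs

/-- The sine of the opening angle has the sign of `cos Φ`: half ellipses join smoothly, larger arcs
make a reentrant corner. -/
theorem lens_angle (i : Fin 2) :
    (cos Φ = 0 → ccwAngle (deriv (lensArc Φ β (Equiv.swap 0 1 i)) 0) (-deriv (lensArc Φ β i) 1) = π) ∧
    (cos Φ < 0 →
      π < ccwAngle (deriv (lensArc Φ β (Equiv.swap 0 1 i)) 0) (-deriv (lensArc Φ β i) 1)) := by
  have h0 : 0 < Φ := by linarith [pi_pos]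
  have hi := hβ i
  have hj := hβ (Equiv.swap 0 1 i)
  have hS := sin_pos_lens hΦ hΦ'
  obtain ⟨h1, h2⟩ := lens_corner i
  constructor
  · intro hc
    rw [ccwAngle_eq_pi_iff, h1, h2, hc]
    refine ⟨?_, by simp⟩
    have : 0 < (2 * Φ) ^ 2 * (β i * β (Equiv.swap 0 1 i) * sin Φ ^ 2) := by positivity
    linarith
  · intro hc
    rw [pi_lt_ccwAngle_iff, h1]
    exact mul_neg_of_pos_of_neg (by positivity) hc

/-- The boundary of a domain bounded by two elliptic arcs. -/
noncomputable def lensBoundary (k : WithTop ℕ∞) {α : ℝ≥0} (hα : α ≤ 1) :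
    PiecewiseBoundary k α (lensDomain Φ β) where
  N := 2
  arc := lensArc Φ β
  next := Equiv.swap 0 1
  smooth i t _ := CkAlphaAround.of_contDiff hα (contDiff_lensArc i)
  regular i t _ := by
    rw [(hasDerivAt_lensArc i t).deriv]
    refine smul_ne_zero (mul_ne_zero (lensSign_ne_zero i) (by linarith [pi_pos])) fun h => ?_
    have h1 := congrArg (fun z : Plane => z 0) h
    have h2 := congrArg (fun z : Plane => z 1) h
    simp [(hβ i).ne'] at h1 h2
    have := sin_sq_add_cos_sq (Φ * (2 * t - 1))
    rw [h1, h2] at this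
    norm_num at this
  joined := lensArc_joined
  simple _ _ _ hs _ ht h := lensArc_injective hβ hΦ hΦ' hs ht h
  frontier_eq := frontier_lensDomain_eq_iUnion hβ hΦ hΦ'
  inward i _ ht := inward_lensArc hβ hΦ hΦ' i ht
  no_cusp i h := by
    have h1 := lens_angle hβ hΦ hΦ' i
    rcases (cos_nonpos_lens hΦ hΦ').eq_or_lt with hc | hc
    · exact pi_ne_zero ((h1.1 hc).symm.trans h)
    · have := h1.2 hc
      rw [h] at this
      exact pi_pos.not_gt this

end

end Lens

/-! ### Testing the Euclidean distance along a line. -/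

theorem setting_unitBall {k : WithTop ℕ∞} {α : ℝ≥0} (hα : α ≤ 1) {U : Set Plane}
    (B : PiecewiseBoundary k α U) (hU : IsOpen U) (hb : Bornology.IsBounded U) {x y : Plane}
    (hx : x ∈ U) (hy : y ∈ frontier U)
    (h : ∀ w ∈ frontier U, ‖x - w‖ ^ 2 ≤ ‖x - y‖ ^ 2 → w = y) :
    Setting (Metric.closedBall (0 : Plane) 1) B x y where
  body := admissibleBody_unitBall hα
  isOpen := hU
  bounded := hb
  flatCompatible := fun i t _ _ hn => by
    rw [flatNormals_unitBall] at hn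
    exact absurd hn (notMem_empty _)
  mem := ⟨hx, fun ⟨_, a, b, hab, ha, hb⟩ => hab <| by
    rw [isClosestPoint_unitBall_iff] at ha hb
    rw [h a ha.1 (ha.2 y hy), h b hb.1 (hb.2 y hy)]⟩
  closest := by
    rw [isClosestPoint_unitBall_iff]
    refine ⟨hy, fun w hw => ?_⟩
    by_contra! hlt
    rw [h w hw hlt.le] at hlt
    exact lt_irrefl _ hlt

theorem distK_unitBall_sq_le {U : Set Plane} {z w : Plane} (hw : w ∈ frontier U) :
    distK (Metric.closedBall (0 : Plane) 1) U z ^ 2 ≤ ‖z - w‖ ^ 2 := by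
  have h0 : 0 ≤ distK (Metric.closedBall (0 : Plane) 1) U z :=
    Real.sInf_nonneg (by rintro _ ⟨w, -, rfl⟩; exact gauge_nonneg _)
  exact pow_le_pow_left₀ h0 (distK_unitBall_le hw) 2

/-- If `d` were `C²`, so would be its square along the line `x + u v`; squares keep the comparison
with parabolas polynomial. -/
theorem not_contDiffAt_distK_unitBall {U : Set Plane} {x v : Plane} {A p q : ℝ} (hpq : p < q)
    (hne : (frontier U).Nonempty)
    (h : ∀ u : ℝ, ∃ w ∈ frontier U, ‖x + u • v - w‖ ^ 2 ≤ A + u ^ 2)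
    (hr : ∀ u ∈ Icc (0 : ℝ) (1 / 2), ∀ w ∈ frontier U, A - p * u ^ 2 ≤ ‖x + u • v - w‖ ^ 2)
    (hl : ∀ u ∈ Icc (0 : ℝ) (1 / 2), ∃ w ∈ frontier U, ‖x + (-u) • v - w‖ ^ 2 ≤ A - q * u ^ 2) :
    ¬ ContDiffAt ℝ 2 (distK (Metric.closedBall (0 : Plane) 1) U) x := by
  intro hd
  have hI : Icc (0 : ℝ) (1 / 2) ∈ 𝓝[≥] (0 : ℝ) := Icc_mem_nhdsGE (by norm_num)
  refine not_contDiffAt_two_of_bounds (A := A) (p := p)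
    (g := fun u => distK (Metric.closedBall (0 : Plane) 1) U (x + u • v) ^ 2) hpq
    (Eventually.of_forall fun u => ?_) ?_ ?_ ?_
  · obtain ⟨w, hw, h1⟩ := h u
    exact (distK_unitBall_sq_le hw).trans h1
  · filter_upwards [hI] with u hu
    exact le_distK_unitBall_sq hne (hr u hu)
  · filter_upwards [hI] with u hu
    obtain ⟨w, hw, h1⟩ := hl u hu
    exact (distK_unitBall_sq_le hw).trans h1
  · have h1 : ContDiffAt ℝ 2 (fun u : ℝ => x + u • v) 0 := by fun_prop
    have h2 : ContDiffAt ℝ 2 (distK (Metric.closedBall (0 : Plane) 1) U)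
        ((fun u : ℝ => x + u • v) 0) := by simpa using hd
    exact (h2.comp (0 : ℝ) h1).pow 2

theorem exists_radius {u : ℝ} (hu : u ∈ Icc (0 : ℝ) (1 / 2)) :
    ∃ ρ > (0 : ℝ), ρ ^ 2 = 1 / 4 + u ^ 2 ∧ (1 - ρ) ^ 2 ≤ 1 / 4 - 1 / 2 * u ^ 2 := by
  -- This is the bound under which `(1/2 + 3u²/4)² ≤ 1/4 + u²`. Here `ρ` is the distance of the test
  -- point from the centre of a unit circle, so `|1 - ρ|` is its distance from the circle.
  have hu2 : u ^ 2 ≤ 4 / 9 := by nlinarith [hu.1, hu.2]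
  have h1 : 1 / 2 + 3 / 4 * u ^ 2 ≤ √(1 / 4 + u ^ 2) :=
    Real.le_sqrt_of_sq_le (by nlinarith [sq_nonneg u])
  have h2 := Real.sq_sqrt (show 0 ≤ 1 / 4 + u ^ 2 by positivity)
  exact ⟨√(1 / 4 + u ^ 2), Real.sqrt_pos.2 (by positivity), h2, by nlinarith⟩

section Lens

variable {Φ : ℝ} {β : Fin 2 → ℝ}

theorem norm_leftNormal_lensArc (hΦ : 0 < Φ) (i : Fin 2) (t : ℝ) {r : ℝ} (hr : 0 < r)
    (h : r ^ 2 = cos (Φ * (2 * t - 1)) ^ 2 + β i ^ 2 * sin (Φ * (2 * t - 1)) ^ 2) :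
    ‖leftNormal (lensArc Φ β i) t‖ = 2 * Φ * r := by
  rw [← sq_eq_sq₀ (norm_nonneg _) (by positivity), leftNormal_lensArc, plane_norm_sq]
  simp
  linear_combination -(4 * Φ ^ 2) * h + 4 * Φ ^ 2 * (cos (Φ * (2 * t - 1)) ^ 2 +
    β i ^ 2 * sin (Φ * (2 * t - 1)) ^ 2) * lensSign_mul_self i

theorem curvatureK_lensArc (hΦ : 0 < Φ) (i : Fin 2) (t : ℝ) {r : ℝ} (hr : 0 < r)
    (h : r ^ 2 = cos (Φ * (2 * t - 1)) ^ 2 + β i ^ 2 * sin (Φ * (2 * t - 1)) ^ 2) :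
    curvatureK (Metric.closedBall (0 : Plane) 1) (lensArc Φ β i) t = β i / r ^ 3 := by
  have h1 := norm_leftNormal_lensArc hΦ i t hr h
  rw [curvatureK_unitBall, curveCurvature_lensArc, h1]
  · field_simp
  · intro h2
    rw [leftNormal, h2] at h1
    have : (0 : ℝ) < 2 * Φ * r := by positivity
    rw [← h1] at this
    simp [perp] at this

end Lens

/-! ### A non-strict corner: a half ellipse and a half circle. -/

section FlatExample

/-- Semi-axes of the two elliptic arcs: a half ellipse and a half circle. -/
def eggAxes (i : Fin 2) : ℝ := if i = 0 then 2 else 1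

theorem eggAxes_pos (i : Fin 2) : 0 < eggAxes i := by
  unfold eggAxes; split_ifs <;> norm_num

theorem mem_frontier_egg_right {w : Plane} (h : 0 ≤ w 0) :
    w ∈ frontier (lensDomain (π / 2) eggAxes) ↔ w 0 ^ 2 / 4 + w 1 ^ 2 = 1 := by
  rw [frontier_lensDomain le_rfl (by linarith [pi_pos]), mem_ofPred_eq,
    lensFun_of_sign eggAxes_pos 0 (by simpa [lensSign]), cos_pi_div_two]
  simp only [lensSign, eggAxes, if_true]
  rw [show (1 * w 0 / 2 + 0) ^ 2 = w 0 ^ 2 / 4 by ring]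

theorem mem_frontier_egg_left {w : Plane} (h : w 0 ≤ 0) :
    w ∈ frontier (lensDomain (π / 2) eggAxes) ↔ w 0 ^ 2 + w 1 ^ 2 = 1 := by
  rw [frontier_lensDomain le_rfl (by linarith [pi_pos]), mem_ofPred_eq,
    lensFun_of_sign eggAxes_pos 1 (by simpa [lensSign]), cos_pi_div_two]
  simp [lensSign, eggAxes]

/-- At the top the ellipse has curvature `1/4`. At distance `d = 1/2` this gives `d'' = -κ / (1 - κ
d) = -2/7`, hence the coefficient `-1/7` for `d²`; the factor `7/8` in the square is `1 - κ d`. -/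
theorem egg_bound {w : Plane} (hw : w ∈ frontier (lensDomain (π / 2) eggAxes)) {u : ℝ}
    (hu : 0 ≤ u) : 1 / 4 - 1 / 7 * u ^ 2 ≤ (u - w 0) ^ 2 + (1 / 2 - w 1) ^ 2 := by
  rcases le_total 0 (w 0) with h | h
  · rw [mem_frontier_egg_right h] at hw
    have h1 : w 1 ≤ 1 := by nlinarith [sq_nonneg (w 0), sq_nonneg (w 1 - 1)]
    nlinarith [sq_nonneg (u - 7 / 8 * w 0), sq_nonneg (1 - w 1)]
  · rw [mem_frontier_egg_left h] at hw
    have h1 : w 1 ≤ 1 := by nlinarith [sq_nonneg (w 0), sq_nonneg (w 1 - 1)]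
    nlinarith [mul_nonneg hu (neg_nonneg.2 h), sq_nonneg u]

theorem eq_of_egg {w : Plane} (hw : w ∈ frontier (lensDomain (π / 2) eggAxes))
    (h : w 0 ^ 2 + (1 / 2 - w 1) ^ 2 ≤ 1 / 4) : w = !₂[0, 1] := by
  suffices w 1 = 1 ∧ w 0 ^ 2 = 0 from plane_ext (by simpa using this.2) (by simpa using this.1)
  rcases le_total 0 (w 0) with h0 | h0
  · rw [mem_frontier_egg_right h0] at hw
    have h2 : -1 ≤ w 1 := by nlinarith [sq_nonneg (w 0), sq_nonneg (w 1 + 1)]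
    have h1 : w 1 ≤ 1 := by nlinarith [sq_nonneg (w 0), sq_nonneg (w 1 - 1)]
    have h3 : w 1 = 1 := by nlinarith
    exact ⟨h3, by rw [h3] at hw; linarith⟩
  · rw [mem_frontier_egg_left h0] at hw
    have h1 : w 1 ≤ 1 := by nlinarith [sq_nonneg (w 0), sq_nonneg (w 1 - 1)]
    have h3 : w 1 = 1 := by nlinarith
    exact ⟨h3, by rw [h3] at hw; linarith⟩

/-- The two arcs share their tangent at the top but have curvatures `1/4` and `1`, and the Hessian
of the distance depends on the curvature. The products `κ d` are `1/8` and `1/2`. -/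
theorem exists_flat_corner_not_contDiffAt (k : WithTop ℕ∞) {α : ℝ≥0} (hα : α ≤ 1) :
    ∃ (K U : Set Plane) (B : PiecewiseBoundary k α U) (x y : Plane), Setting K B x y ∧
      ∃ i, B.arc i 1 = y ∧ B.openingAngle i = π ∧
        curvatureK K (B.arc i) 1 * distK K U x ≠ 1 ∧
        curvatureK K (B.arc (B.next i)) 0 * distK K U x ≠ 1 ∧
        ¬ ContDiffAt ℝ 2 (distK K U) x := by
  have hΦ : π / 2 < π := by linarith [pi_pos]
  have hy : (!₂[0, 1] : Plane) ∈ frontier (lensDomain (π / 2) eggAxes) := by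
    rw [mem_frontier_egg_right (by simp)]; simp
  have hxw : ∀ (w : Plane) (u : ℝ), ‖(!₂[0, 1 / 2] : Plane) + u • !₂[1, 0] - w‖ ^ 2 =
      (u - w 0) ^ 2 + (1 / 2 - w 1) ^ 2 := fun w u => by
    rw [plane_norm_sq]; simp
  have hxw0 : ∀ w : Plane, ‖(!₂[0, 1 / 2] : Plane) - w‖ ^ 2 = w 0 ^ 2 + (1 / 2 - w 1) ^ 2 :=
    fun w => by rw [plane_norm_sq]; simp
  have hS : Setting (Metric.closedBall (0 : Plane) 1) (lensBoundary eggAxes_pos le_rfl hΦ k hα)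
      !₂[0, 1 / 2] !₂[0, 1] := by
    refine setting_unitBall hα _ isOpen_lensDomain (isBounded_lensDomain eggAxes_pos) ?_ hy
      fun w hw h => eq_of_egg hw ?_
    · rw [lensDomain, mem_ofPred_eq, lensFun, cos_pi_div_two]
      norm_num
    · rw [hxw0, hxw0] at h
      norm_num at h ⊢
      exact h
  have hd : distK (Metric.closedBall (0 : Plane) 1) (lensDomain (π / 2) eggAxes) !₂[0, 1 / 2] =
      1 / 2 := by
    rw [hS.distK_eq, gauge_unitBall]
    dsimp only
    rw [← sq_eq_sq₀ (norm_nonneg _) (by norm_num), hxw0]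
    norm_num
  refine ⟨_, _, _, _, _, hS, (0 : Fin 2), ?_, ?_, ?_, ?_, ?_⟩
  · refine plane_ext ?_ ?_
    · simp only [lensBoundary, lensArc_zero]; norm_num
    · simp only [lensBoundary, lensArc_one]; norm_num [lensSign]
  · exact (lens_angle eggAxes_pos le_rfl hΦ 0).1 cos_pi_div_two
  · have := curvatureK_lensArc (Φ := π / 2) (β := eggAxes) (by positivity) 0 1 (r := 2) two_pos
      (by norm_num [eggAxes])
    simp only [lensBoundary]
    rw [this, hd]
    norm_num [eggAxes]
  · have := curvatureK_lensArc (Φ := π / 2) (β := eggAxes) (by positivity) (Equiv.swap 0 1 0) 0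
      (r := 1) one_pos (by norm_num [eggAxes])
    change curvatureK _ (lensArc (π / 2) eggAxes (Equiv.swap 0 1 0)) 0 * _ ≠ 1
    rw [this, hd]
    norm_num [eggAxes]
  · refine not_contDiffAt_distK_unitBall (v := !₂[1, 0]) (A := 1 / 4) (p := 1 / 7) (q := 1 / 2)
      (by norm_num) ⟨_, hy⟩ (fun u => ⟨_, hy, ?_⟩) (fun u hu w hw => ?_) fun u hu => ?_
    · rw [hxw]; norm_num; linarith
    · rw [hxw]; exact egg_bound hw hu.1
    · have hu0 := hu.1
      obtain ⟨ρ, h0, h1, h2⟩ := exists_radius hu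
      -- Radial projection of the test point `(-u, 1/2)` to the unit circle.
      refine ⟨!₂[-u / ρ, 1 / 2 / ρ], ?_, ?_⟩
      · rw [mem_frontier_egg_left]
        · simp only [Matrix.cons_val_zero, Matrix.cons_val_one]
          field_simp
          linarith
        · exact div_nonpos_of_nonpos_of_nonneg (neg_nonpos.2 hu0) h0.le
      · refine le_trans (le_of_eq ?_) h2
        rw [hxw]
        simp only [Matrix.cons_val_zero, Matrix.cons_val_one]
        field_simp
        linear_combination -4 * (1 - ρ) ^ 2 * h1

end FlatExample

/-! ### A strict corner: the union of two unit discs. -/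

section StrictExample

theorem cos_three_quarter : cos (3 * π / 4) = -(√2 / 2) := by
  rw [show 3 * π / 4 = π - π / 4 by ring, cos_pi_sub, cos_pi_div_four]

theorem sin_three_quarter : sin (3 * π / 4) = √2 / 2 := by
  rw [show 3 * π / 4 = π - π / 4 by ring, sin_pi_sub, sin_pi_div_four]

theorem half_sqrt_two_sq : (√2 / 2) ^ 2 = 1 / 2 := by
  rw [div_pow, Real.sq_sqrt zero_le_two]; norm_num

theorem mem_frontier_twoDiscs {w : Plane} :
    w ∈ frontier (lensDomain (3 * π / 4) 1) ↔ (|w 0| - √2 / 2) ^ 2 + w 1 ^ 2 = 1 := by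
  rw [frontier_lensDomain (by linarith [pi_pos]) (by linarith [pi_pos]), mem_ofPred_eq, lensFun,
    cos_three_quarter]
  simp [abs, sub_eq_add_neg]

theorem abs_le_one_of_sq_add_sq {m n : ℝ} (h : m ^ 2 + n ^ 2 = 1) : |m| ≤ 1 :=
  (sq_le_one_iff_abs_le_one m).1 (by nlinarith [sq_nonneg n])

theorem twoDiscs_bound {c a b u : ℝ} (hc : 0 < c) (hc2 : c ^ 2 = 1 / 2)
    (hw : (|a| - c) ^ 2 + b ^ 2 = 1) (hu : u ∈ Icc (0 : ℝ) (1 / 2)) :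
    1 / 4 ≤ (c / 2 - u * c - a) ^ 2 + (c / 2 - u * c - b) ^ 2 := by
  obtain ⟨hu0, hu1⟩ := hu
  have hmn : (c * ((|a| - c) - b)) ^ 2 + (c * ((|a| - c) + b)) ^ 2 = 1 := by
    linear_combination (2 * (|a| - c) ^ 2 + 2 * b ^ 2) * hc2 + hw
  -- Coordinates on the unit circle, rotated by an eighth of a turn and folded by `|a|`. The corner
  -- is `m = -1`, `n = 0`, and `|a| ≥ 0` becomes `m + n ≥ -1`.
  obtain ⟨m, hm⟩ : ∃ m, m = c * ((|a| - c) - b) := ⟨_, rfl⟩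
  obtain ⟨n, hn⟩ : ∃ n, n = c * ((|a| - c) + b) := ⟨_, rfl⟩
  rw [← hm, ← hn] at hmn
  have hm1 := abs_le.1 (abs_le_one_of_sq_add_sq hmn)
  have hn1 := abs_le.1 (abs_le_one_of_sq_add_sq ((add_comm _ _).trans hmn))
  have hmn' : m + n = 2 * c * |a| - 1 := by rw [hm, hn]; linear_combination -2 * hc2
  have ha := mul_nonneg hc.le (abs_nonneg a)
  rcases le_total 0 a with h | h
  · rw [abs_of_nonneg h] at *
    have key : (c / 2 - u * c - a) ^ 2 + (c / 2 - u * c - b) ^ 2 =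
        1 / 4 + (1 + m) + u ^ 2 + 2 * u * n := by
      rw [hm, hn]; linear_combination hw + (1 / 2 + 2 * u ^ 2) * hc2
    rw [key]
    rcases le_total 0 n with h1 | h1
    · nlinarith [mul_nonneg hu0 h1, sq_nonneg u]
    · have h2 : n ^ 2 ≤ (1 + m) ^ 2 := sq_le_sq' (by linarith) (by linarith)
      rcases le_or_gt 0 m with h3 | h3
      · have := mul_nonneg (by linarith : 0 ≤ 1 + n) hu0
        nlinarith [sq_nonneg u]
      · have h4 : m = -1 := by nlinarith
        have h5 : n = 0 := by rw [h4] at hmn; nlinarith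
        rw [h4, h5]
        nlinarith [sq_nonneg u]
  · rw [abs_of_nonpos h] at *
    have key : (c / 2 - u * c - a) ^ 2 + (c / 2 - u * c - b) ^ 2 =
        1 / 4 + (1 + m) * (1 - 2 * u) - 2 * c * a + u ^ 2 := by
      rw [hm]; linear_combination hw + (1 / 2 - 4 * u + 2 * u ^ 2) * hc2
    rw [key]
    nlinarith [mul_nonneg (by linarith : 0 ≤ 1 + m) (by linarith : 0 ≤ 1 - 2 * u), sq_nonneg u]

/-- The excess over `1/4` is a sum of nonnegative terms that vanish together only at the corner. -/
theorem eq_of_twoDiscs {c a b : ℝ} (hc : 0 < c) (hc2 : c ^ 2 = 1 / 2)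
    (hw : (|a| - c) ^ 2 + b ^ 2 = 1) (h : (c / 2 - a) ^ 2 + (c / 2 - b) ^ 2 ≤ 1 / 4) :
    a = 0 ∧ b = c := by
  have key : (c / 2 - a) ^ 2 + (c / 2 - b) ^ 2 =
      1 / 4 + c * (|a| - a) + 1 / 2 * (a ^ 2 + (b - c) ^ 2) := by
    linear_combination hw / 2 - sq_abs a / 2 - hc2 / 2
  have h1 := mul_nonneg hc.le (sub_nonneg.2 (le_abs_self a))
  have h2 := sq_nonneg a
  have h3 := sq_nonneg (b - c)
  exact ⟨(pow_eq_zero_iff two_ne_zero).1 (by linarith),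
    sub_eq_zero.1 ((pow_eq_zero_iff two_ne_zero).1 (by linarith))⟩

/-- The point `x` lies halfway between the corner and the centre of the right disc. For `u > 0` the
test point moves away from the sector served by the right circle, and `d²` stays at least `1/4`. For
`u < 0` the right circle is closer than the corner and `d²` decreases quadratically. -/
theorem exists_strict_corner_not_contDiffAt (k : WithTop ℕ∞) {α : ℝ≥0} (hα : α ≤ 1) :
    ∃ (K U : Set Plane) (B : PiecewiseBoundary k α U) (x y : Plane), Setting K B x y ∧
      ∃ i, B.arc i 1 = y ∧ π < B.openingAngle i ∧
        ((SameRay ℝ (x - y) (normalK K (B.arc i) 1) ∧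
            curvatureK K (B.arc i) 1 * distK K U x ≠ 1) ∨
          (SameRay ℝ (x - y) (normalK K (B.arc (B.next i)) 0) ∧
            curvatureK K (B.arc (B.next i)) 0 * distK K U x ≠ 1)) ∧
        ¬ ContDiffAt ℝ 2 (distK K U) x := by
  have hπ := pi_pos
  have hΦ : π / 2 ≤ 3 * π / 4 := by linarith
  have hΦ' : 3 * π / 4 < π := by linarith
  have hβ : ∀ i, 0 < (1 : Fin 2 → ℝ) i := fun _ => one_pos
  obtain ⟨c, hcdef⟩ : ∃ c, c = √2 / 2 := ⟨_, rfl⟩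
  have hc : 0 < c := by rw [hcdef]; positivity
  have hc2 : c ^ 2 = 1 / 2 := by rw [hcdef, half_sqrt_two_sq]
  have hfr : ∀ w : Plane, w ∈ frontier (lensDomain (3 * π / 4) 1) ↔
      (|w 0| - c) ^ 2 + w 1 ^ 2 = 1 := fun w => by rw [mem_frontier_twoDiscs, hcdef]
  have hcos : cos (3 * π / 4) = -c := by rw [cos_three_quarter, hcdef]
  have hsin : sin (3 * π / 4) = c := by rw [sin_three_quarter, hcdef]
  have hy : (!₂[0, c] : Plane) ∈ frontier (lensDomain (3 * π / 4) 1) := by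
    rw [hfr]; simp; linarith
  have hxw : ∀ (w : Plane) (u : ℝ), ‖(!₂[c / 2, c / 2] : Plane) + u • !₂[-c, -c] - w‖ ^ 2 =
      (c / 2 - u * c - w 0) ^ 2 + (c / 2 - u * c - w 1) ^ 2 := fun w u => by
    rw [plane_norm_sq]; simp; ring
  have hxw0 : ∀ w : Plane, ‖(!₂[c / 2, c / 2] : Plane) - w‖ ^ 2 =
      (c / 2 - w 0) ^ 2 + (c / 2 - w 1) ^ 2 := fun w => by rw [plane_norm_sq]; simp
  have hxy : ‖(!₂[c / 2, c / 2] : Plane) - !₂[0, c]‖ ^ 2 = 1 / 4 := by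
    rw [hxw0]; simp; linear_combination hc2 / 2
  have hS : Setting (Metric.closedBall (0 : Plane) 1) (lensBoundary hβ hΦ hΦ' k hα)
      !₂[c / 2, c / 2] !₂[0, c] := by
    refine setting_unitBall hα _ isOpen_lensDomain (isBounded_lensDomain hβ) ?_ hy
      fun w hw h => ?_
    · rw [lensDomain, mem_ofPred_eq, lensFun_of_sign hβ 0 (by simp [lensSign]; positivity), hcos]
      simp [lensSign]
      nlinarith
    · rw [hxy, hxw0] at h
      obtain ⟨h1, h2⟩ := eq_of_twoDiscs hc hc2 ((hfr w).1 hw) h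
      exact plane_ext (by simpa using h1) (by simpa using h2)
  have hd : distK (Metric.closedBall (0 : Plane) 1) (lensDomain (3 * π / 4) 1) !₂[c / 2, c / 2] =
      1 / 2 := by
    rw [hS.distK_eq, gauge_unitBall]
    dsimp only
    rw [← sq_eq_sq₀ (norm_nonneg _) (by norm_num), hxy]
    norm_num
  have hr : (1 : ℝ) ^ 2 = cos (3 * π / 4 * (2 * 1 - 1)) ^ 2 +
      (1 : Fin 2 → ℝ) 0 ^ 2 * sin (3 * π / 4 * (2 * 1 - 1)) ^ 2 := by
    simp
  refine ⟨_, _, _, _, _, hS, (0 : Fin 2), ?_, ?_, Or.inl ⟨?_, ?_⟩, ?_⟩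
  · refine plane_ext ?_ ?_
    · simp only [lensBoundary, lensArc_zero]; norm_num
    · simp only [lensBoundary, lensArc_one]; norm_num [lensSign, hsin]
  · exact (lens_angle hβ hΦ hΦ' 0).2 (by rw [hcos]; linarith)
  · change SameRay ℝ _ (normalK _ (lensArc (3 * π / 4) 1 0) 1)
    have h0 : deriv (lensArc (3 * π / 4) 1 0) 1 ≠ 0 :=
      (lensBoundary hβ hΦ hΦ' k hα).regular (0 : Fin 2) 1 (by simp)
    rw [normalK_unitBall h0]
    refine SameRay.nonneg_smul_right ?_ (by positivity)
    have h1 : leftNormal (lensArc (3 * π / 4) 1 0) 1 =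
        (3 * π) • ((!₂[c / 2, c / 2] : Plane) - !₂[0, c]) := by
      rw [leftNormal_lensArc, show 3 * π / 4 * (2 * 1 - 1) = 3 * π / 4 by ring, hcos, hsin]
      refine plane_ext ?_ ?_
      · simp [lensSign]; ring
      · simp [lensSign]; ring
    rw [h1]
    exact SameRay.nonneg_smul_right (SameRay.refl _) (by positivity)
  · have := curvatureK_lensArc (Φ := 3 * π / 4) (β := 1) (by positivity) 0 1 (r := 1) one_pos hr
    simp only [lensBoundary]
    rw [this, hd]
    norm_num
  · refine not_contDiffAt_distK_unitBall (v := !₂[-c, -c]) (A := 1 / 4) (p := 0) (q := 1 / 2)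
      (by norm_num) ⟨_, hy⟩ (fun u => ⟨_, hy, ?_⟩) (fun u hu w hw => ?_) fun u hu => ?_
    · rw [hxw]
      refine le_of_eq ?_
      simp
      linear_combination (1 / 2 + 2 * u ^ 2) * hc2
    · rw [hxw, zero_mul, sub_zero]
      exact twoDiscs_bound hc hc2 ((hfr w).1 hw) hu
    · have hu0 := hu.1
      obtain ⟨ρ, h0, h1, h2⟩ := exists_radius hu
      have h3 : 1 / 2 - u ≤ ρ := by nlinarith
      have h4 : 0 ≤ c + c * (u - 1 / 2) / ρ := by
        have : c + c * (u - 1 / 2) / ρ = c * (ρ - (1 / 2 - u)) / ρ := by field_simp; ring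
        rw [this]
        exact div_nonneg (mul_nonneg hc.le (sub_nonneg.2 h3)) h0.le
      -- Radial projection of the test point from the centre `(c, 0)` of the right disc. It belongs
      -- to the boundary of the union only if its first coordinate is nonnegative, which is `h4`.
      refine ⟨!₂[c + c * (u - 1 / 2) / ρ, c * (u + 1 / 2) / ρ], ?_, ?_⟩
      · rw [hfr]
        simp only [Matrix.cons_val_zero, Matrix.cons_val_one]
        rw [abs_of_nonneg h4, add_sub_cancel_left]
        field_simp
        linear_combination ((2 * u - 1) ^ 2 + (2 * u + 1) ^ 2) * hc2 - 4 * h1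
      · refine le_trans (le_of_eq ?_) h2
        rw [hxw]
        simp only [Matrix.cons_val_zero, Matrix.cons_val_one]
        field_simp
        linear_combination (((2 * u - 1) ^ 2 + (2 * u + 1) ^ 2) * hc2 - 4 * h1) * (1 - ρ) ^ 2

end StrictExample

/-- The factor `r` runs through all inward normals at the parameter `t`. Both `x - y` and the
`K`-normals are nonzero, so `SameRay` means being a positive multiple. Corners that are not
reentrant are admitted in the first part but are never closest points. -/
theorem mainTheorem6 (k : WithTop ℕ∞) (hk : 2 ≤ k) (α : ℝ≥0) (hα : α ≤ 1) :
    (∀ (K U : Set Plane) (B : PiecewiseBoundary k α U) (x y : Plane), Setting K B x y →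
      -- `y` is not a reentrant corner
      (∀ i, ∀ t ∈ Icc (0 : ℝ) 1, B.arc i t = y → ¬ B.IsReentrantCorner y →
        curvatureK K (B.arc i) t * distK K U x ≠ 1 →
          CkAlphaAround k α (distK K U) x ∧
          ∀ r : ℝ, 0 < r → ∀ ν : Plane, ν = r • leftNormal (B.arc i) t →
            gradient (distK K U) x = (polarGauge K ν)⁻¹ • ν ∧
            Laplacian.laplacian (distK K U) x =
              -(curveCurvature (B.arc i) t * ‖ν‖ ^ 3 * ‖gradient (polarGauge K) ν‖ ^ 2) /
                (polarGauge K ν ^ 3 * (1 - curvatureK K (B.arc i) t * distK K U x)) ∧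
            ∀ ζ : Plane, ‖ζ‖ = 1 → ⟪ζ, x - y⟫_ℝ = 0 → ∀ v w : Plane,
              fderiv ℝ (fderiv ℝ (distK K U)) x v w =
                Laplacian.laplacian (distK K U) x * ⟪v, ζ⟫_ℝ * ⟪w, ζ⟫_ℝ) ∧
      -- `y` is a strict reentrant corner
      (∀ i, B.arc i 1 = y → π < B.openingAngle i →
        (¬ SameRay ℝ (x - y) (normalK K (B.arc i) 1) →
          ¬ SameRay ℝ (x - y) (normalK K (B.arc (B.next i)) 0) →
            (∀ᶠ z in 𝓝 x, distK K U z = gauge K (z - y)) ∧ CkAlphaAround k α (distK K U) x) ∧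
        (SameRay ℝ (x - y) (normalK K (B.arc i) 1) →
          curvatureK K (B.arc i) 1 * distK K U x ≠ 1 → CkAlphaAround 1 1 (distK K U) x) ∧
        (SameRay ℝ (x - y) (normalK K (B.arc (B.next i)) 0) →
          curvatureK K (B.arc (B.next i)) 0 * distK K U x ≠ 1 →
            CkAlphaAround 1 1 (distK K U) x)) ∧
      -- `y` is a non-strict reentrant corner
      (∀ i, B.arc i 1 = y → B.openingAngle i = π →
        curvatureK K (B.arc i) 1 * distK K U x ≠ 1 →
        curvatureK K (B.arc (B.next i)) 0 * distK K U x ≠ 1 →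
          CkAlphaAround 1 1 (distK K U) x)) ∧
    -- in general `d_K` is not `C²` along a `K`-normal at a strict reentrant corner
    (∃ (K U : Set Plane) (B : PiecewiseBoundary k α U) (x y : Plane), Setting K B x y ∧
      ∃ i, B.arc i 1 = y ∧ π < B.openingAngle i ∧
        ((SameRay ℝ (x - y) (normalK K (B.arc i) 1) ∧
            curvatureK K (B.arc i) 1 * distK K U x ≠ 1) ∨
          (SameRay ℝ (x - y) (normalK K (B.arc (B.next i)) 0) ∧
            curvatureK K (B.arc (B.next i)) 0 * distK K U x ≠ 1)) ∧
        ¬ ContDiffAt ℝ 2 (distK K U) x) ∧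
    -- in general `d_K` is not `C²` at a non-strict reentrant corner
    (∃ (K U : Set Plane) (B : PiecewiseBoundary k α U) (x y : Plane), Setting K B x y ∧
      ∃ i, B.arc i 1 = y ∧ B.openingAngle i = π ∧
        curvatureK K (B.arc i) 1 * distK K U x ≠ 1 ∧
        curvatureK K (B.arc (B.next i)) 0 * distK K U x ≠ 1 ∧
        ¬ ContDiffAt ℝ 2 (distK K U) x) :=
  ⟨fun _ _ _ _ _ S => ⟨fun _ _ ht hy hre hκ => S.nonreentrant_formulas hα hk ht hy hre hκ,
      fun _ hy h => ⟨S.strict_corner hα hk hy h, S.strict_corner_left hα hk hy h,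
        S.strict_corner_right hα hk hy h⟩,
      fun _ hy h h₁ h₂ => S.flat_corner hα hk hy h h₁ h₂⟩,
    exists_strict_corner_not_contDiffAt k hα, exists_flat_corner_not_contDiffAt k hα⟩
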